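/- **Theorem 8 (orbits of a symmetry subalgebra).** Let $\lambda^1,\dots,\lambda^n$ be smooth functions on an open set $U\subset\mathbb R^n$ with $\lambda^k(u)\neq\lambda^l(u)$ for $k\ne l$, put $\partial_k=\partial/\partial u^k$, $a_{kl}=\dfrac{\partial_l\lambda^k}{\lambda^l-\lambda^k}$ $(k\neq l)$, and suppose that the system $$u^k_t=\lambda^k(u)\,u^k_x,\qquad k=1,\dots,n, \tag{1}$$ is semihamiltonian, i.e. $\partial_l a_{km}=\partial_m a_{kl}$ for pairwise distinct $k,l,m$. Let $j\neq i$ with $\partial_j\lambda^i\neq0$ on $U$ and let $b_{ij}=\dfrac{\partial_i\partial_j\lambda^i}{\partial_j\lambda^i}+\dfrac{\partial_i\lambda^i}{\lambda^j-\lambda^i}$. Let the $i$-th Monge distribution of (1), cut in the space of jets $(x,t,u,u_x)$ by $$dx+\lambda^i dt=0,\quad du^i=0,\quad du^k+(\lambda^i-\lambda^k)u^k_x\,dt=0\ (k\ne i),\quad du^i_x-\Big(\sum_k u^k_x\,\partial_k\lambda^i\Big)u^i_x\,dt=0,$$ admit an extra Riemann invariant of order 1, that is, a smooth first integral $I^i$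 on an open set $\Omega$ of jets with $\partial I^i/\partial u^i_x\neq0$. Consider the subalgebra of commuting flows formed by the (locally defined, smooth) solutions $\mu$ of $$\partial_l\mu^k=a_{kl}(\mu^l-\mu^k)\quad(k\neq l),\qquad \partial_i\mu^i=b_{ij}\mu^i .$$ The orbit of a solution $u$ of (1) consists of all germs of solutions that arise from germs of $u$ by finitely many time-one flows $u^k_\tau=\mu^k(u)u^k_x$ of elements $\mu$ of this subalgebra; the flow carries the base point $(x,t)$ of the germ along $dx/d\tau=-\mu^i$, $dt/d\tau=0$, and the jets at the base point stay in $\Omega$. Let $u$ be a solution of (1) near $z_0=(x_0,t_0)$ whose jet at $z_0$ lies in $\Omega$ and which is generic: $u^k_x(z_0)\neq0$ for all $k$. Then, after restricting $u$ to a suitable neighbourhood $W_0$ of $z_0$, there are an open set $N\subset\Omega$ of jets that contains the jets of $u$ at the points of $W_0$, and a smooth function $\varphi_i$ of one variable, such that on $N$ the function $I^i$ depends only on $(x,t,u,u^i_x)$, and: 1. $u$ satisfies the relation $$I^i(x,t,u,u^i_x)=\varphi_i(u^i) \tag{2}$$ on $W_0$, and a germ of a solution of (1) whose jet at the base point lies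 in $N$ belongs to the orbit of $u$ if and only if it satisfies (2) near its base point; 2. the orbit is fixed by the choice of $\varphi_i$: if a solution $u'$ of (1) near a point $z'$ has its jet at $z'$ in $N$ and satisfies (2) near $z'$ with the same $\varphi_i$, then there are a neighbourhood $W_1$ of $z'$ and a neighbourhood $N'$ of the jet of $u'$ at $z'$ such that the orbits of $u|_{W_0}$ and of $u'|_{W_1}$ contain the same germs of solutions with jets in $N'$. -/

import Mathlib

open Set Filter Topology
open scoped ContDiff

noncomputable section

namespace Hydro

variable {n : ℕ}

/-- The partial derivative of `f` in the `k`-th coordinate, at the point `u`. -/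
def pd (k : Fin n) (f : (Fin n → ℝ) → ℝ) (u : Fin n → ℝ) : ℝ :=
  fderiv ℝ f u (Pi.single k 1)

/-- The characteristic speeds `lam` are smooth and pairwise distinct on the open set `U`
(strict hyperbolicity of the diagonal system `uᵏ_t = lamᵏ(u) uᵏ_x`). -/
structure IsStrictlyHyperbolic (lam : Fin n → (Fin n → ℝ) → ℝ) (U : Set (Fin n → ℝ)) : Prop where
  isOpen : IsOpen U
  smooth : ∀ k, ContDiffOn ℝ ∞ (lam k) U
  distinct : ∀ k l, k ≠ l → ∀ u ∈ U, lam k u ≠ lam l u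

/-- `a_{kl} = ∂_l lamᵏ / (lamˡ - lamᵏ)`, used for `k ≠ l`. -/
def a (lam : Fin n → (Fin n → ℝ) → ℝ) (k l : Fin n) (u : Fin n → ℝ) : ℝ :=
  pd l (lam k) u / (lam l u - lam k u)

/-- `b_{ij} = lamⁱ_{ij} / lamⁱ_j + lamⁱ_i / (lamʲ - lamⁱ)`, used for `i ≠ j` where
`lamⁱ_j` does not vanish. -/
def b (lam : Fin n → (Fin n → ℝ) → ℝ) (i j : Fin n) (u : Fin n → ℝ) : ℝ :=
  pd j (pd i (lam i)) u / pd j (lam i) u + pd i (lam i) u / (lam j u - lam i u)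

/-- Semihamiltonian systems: `∂_l a_{km} = ∂_m a_{kl}` for pairwise distinct `k, l, m`. -/
def IsSemihamiltonian (lam : Fin n → (Fin n → ℝ) → ℝ) (U : Set (Fin n → ℝ)) : Prop :=
  ∀ k l m : Fin n, k ≠ l → k ≠ m → l ≠ m →
    ∀ u ∈ U, pd l (a lam k m) u = pd m (a lam k l) u

/-- `μ` is a smooth solution on the open set `U` of the linear system for commuting flows,
`∂_l μᵏ = a_{kl} (μˡ - μᵏ)` for `k ≠ l`. -/
structure IsCommutingFlow (lam : Fin n → (Fin n → ℝ) → ℝ) (U : Set (Fin n → ℝ))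
    (μ : Fin n → (Fin n → ℝ) → ℝ) : Prop where
  isOpen : IsOpen U
  smooth : ∀ k, ContDiffOn ℝ ∞ (μ k) U
  eqn : ∀ k l, k ≠ l → ∀ u ∈ U, pd l (μ k) u = a lam k l u * (μ l u - μ k u)

/-- The elements over `U` of the subalgebra of commuting flows cut by `μⁱ_i = b_{ij} μⁱ`. -/
def InSubalgebra (lam : Fin n → (Fin n → ℝ) → ℝ) (i j : Fin n) (U : Set (Fin n → ℝ))
    (μ : Fin n → (Fin n → ℝ) → ℝ) : Prop :=
  IsCommutingFlow lam U μ ∧ ∀ u ∈ U, pd i (μ i) u = b lam i j u * μ i u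

/-! ### The jet space and the Monge distributions -/

/-- The space with coordinates `(x, t, u, u_x)`. -/
abbrev Jet (n : ℕ) : Type := ℝ × ℝ × (Fin n → ℝ) × (Fin n → ℝ)

/-- The `i`-th Monge characteristic distribution at the point `q = (x, t, u, p)`, `p = u_x`:
the tangent vectors `X = (dx, dt, du, dp)` such that `dx + lamⁱ dt = 0`, `duⁱ = 0`,
`duᵏ + (lamⁱ - lamᵏ) pᵏ dt = 0` for `k ≠ i`, and `dpⁱ - D_x(lamⁱ) pⁱ dt = 0`. -/
def mongeDistribution (lam : Fin n → (Fin n → ℝ) → ℝ) (i : Fin n) (q : Jet n) : Set (Jet n) :=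
  {X | X.1 + lam i q.2.2.1 * X.2.1 = 0 ∧
    X.2.2.1 i = 0 ∧
    (∀ k, k ≠ i →
      X.2.2.1 k + (lam i q.2.2.1 - lam k q.2.2.1) * q.2.2.2 k * X.2.1 = 0) ∧
    X.2.2.2 i - (∑ k, q.2.2.2 k * pd k (lam i) q.2.2.1) * q.2.2.2 i * X.2.1 = 0}

/-- `J` is a Riemann invariant of the `i`-th Monge distribution on the open set `Ω` of the jet
space (whose points have `u ∈ U`): a smooth first integral of this distribution. -/
structure IsRiemannInvariant (lam : Fin n → (Fin n → ℝ) → ℝ) (U : Set (Fin n → ℝ)) (i : Fin n)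
    (Ω : Set (Jet n)) (J : Jet n → ℝ) : Prop where
  isOpen : IsOpen Ω
  base : ∀ q ∈ Ω, q.2.2.1 ∈ U
  smooth : ContDiffOn ℝ ∞ J Ω
  firstIntegral : ∀ q ∈ Ω, ∀ X ∈ mongeDistribution lam i q, fderiv ℝ J q X = 0

/-- An extra Riemann invariant of order one: a Riemann invariant with `∂J/∂uⁱ_x ≠ 0`. (The
derivatives `∂J/∂uᵏ_x`, `k ≠ i`, of a Riemann invariant vanish. The condition implies that
`J` and the invariant `uⁱ` are functionally independent.) -/
def IsExtraRiemannInvariantOfOrderOne (lam : Fin n → (Fin n → ℝ) → ℝ) (U : Set (Fin n → ℝ))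
    (i : Fin n) (Ω : Set (Jet n)) (J : Jet n → ℝ) : Prop :=
  IsRiemannInvariant lam U i Ω J ∧
    ∀ q ∈ Ω, fderiv ℝ J q (0, 0, 0, Pi.single i 1) ≠ 0

/-! ### Solutions -/

/-- The derivative `u_x` of a function of `z = (x, t)`. -/
def dx (u : ℝ × ℝ → Fin n → ℝ) (z : ℝ × ℝ) : Fin n → ℝ := fderiv ℝ u z (1, 0)

/-- The derivative `u_t` of a function of `z = (x, t)`. -/
def dt (u : ℝ × ℝ → Fin n → ℝ) (z : ℝ × ℝ) : Fin n → ℝ := fderiv ℝ u z (0, 1)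

/-- `u` is a smooth solution of `uᵏ_t = lamᵏ(u) uᵏ_x` on the open set `W`, with values in `U`. -/
structure IsSolution (lam : Fin n → (Fin n → ℝ) → ℝ) (U : Set (Fin n → ℝ)) (W : Set (ℝ × ℝ))
    (u : ℝ × ℝ → Fin n → ℝ) : Prop where
  isOpen : IsOpen W
  mapsTo : MapsTo u W U
  smooth : ContDiffOn ℝ ∞ u W
  eqn : ∀ z ∈ W, ∀ k, dt u z k = lam k (u z) * dx u z k

/-- `u` is a solution in some neighbourhood of `z`. -/
def IsSolutionNear (lam : Fin n → (Fin n → ℝ) → ℝ) (U : Set (Fin n → ℝ)) (z : ℝ × ℝ)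
    (u : ℝ × ℝ → Fin n → ℝ) : Prop :=
  ∃ W : Set (ℝ × ℝ), z ∈ W ∧ IsSolution lam U W u

/-- The point `(x, t, u, u_x)` of the jet space given by `u` at `z = (x, t)`. -/
def jet (u : ℝ × ℝ → Fin n → ℝ) (z : ℝ × ℝ) : Jet n := (z.1, z.2, u z, dx u z)

/-! ### Orbits -/

/-- `μ` is the commuting flow, and `V`, a function of `(x, t, τ)`, is a smooth common solution on
the open set `D` of the system `Vᵏ_t = lamᵏ(V) Vᵏ_x` and of the flow `Vᵏ_τ = μᵏ(V) Vᵏ_x`,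
with values in `U`. -/
structure IsCommonSolution (lam μ : Fin n → (Fin n → ℝ) → ℝ) (U : Set (Fin n → ℝ))
    (D : Set (ℝ × ℝ × ℝ)) (V : ℝ × ℝ × ℝ → Fin n → ℝ) : Prop where
  isOpen : IsOpen D
  mapsTo : MapsTo V D U
  smooth : ContDiffOn ℝ ∞ V D
  eqn_t : ∀ q ∈ D, ∀ k,
    fderiv ℝ V q (0, 1, 0) k = lam k (V q) * fderiv ℝ V q (1, 0, 0) k
  eqn_flow : ∀ q ∈ D, ∀ k,
    fderiv ℝ V q (0, 0, 1) k = μ k (V q) * fderiv ℝ V q (1, 0, 0) k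

/-- A germ of a function of `(x, t)`: the base point, and a function that matters only near it. -/
abbrev PointedFun (n : ℕ) : Type := (ℝ × ℝ) × (ℝ × ℝ → Fin n → ℝ)

/-- The germ `A` is carried to the germ `B` by the time-one flow `u_τ = μ(u) u_x` of an element
`μ` of the subalgebra `μⁱ_i = b_{ij} μⁱ`. The flow carries the base point along `dx/dτ = -μⁱ`,
`dt/dτ = 0` (the generator of the flow is taken in the form with the summand `-μⁱ D_x`), so that
the value of `uⁱ` at the base point is kept. The motion takes place in the set `Ω` of jets. -/
def FlowStep (lam : Fin n → (Fin n → ℝ) → ℝ) (U : Set (Fin n → ℝ)) (i j : Fin n)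
    (Ω : Set (Jet n)) (A B : PointedFun n) : Prop :=
  ∃ (U' : Set (Fin n → ℝ)) (μ : Fin n → (Fin n → ℝ) → ℝ) (D : Set (ℝ × ℝ × ℝ))
    (V : ℝ × ℝ × ℝ → Fin n → ℝ) (ξ : ℝ → ℝ) (t : ℝ),
    U' ⊆ U ∧ InSubalgebra lam i j U' μ ∧ IsCommonSolution lam μ U' D V ∧
    (∀ τ ∈ Icc (0 : ℝ) 1, (ξ τ, t, τ) ∈ D ∧
      HasDerivWithinAt ξ (-(μ i (V (ξ τ, t, τ)))) (Icc (0 : ℝ) 1) τ ∧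
      ((ξ τ, t, V (ξ τ, t, τ), fderiv ℝ V (ξ τ, t, τ) (1, 0, 0)) : Jet n) ∈ Ω) ∧
    A.1 = (ξ 0, t) ∧ (∀ᶠ z in 𝓝 A.1, A.2 z = V (z.1, z.2, 0)) ∧
    B.1 = (ξ 1, t) ∧ (∀ᶠ z in 𝓝 B.1, B.2 z = V (z.1, z.2, 1))

/-- The orbit (within the set `Ω` of jets) of the solution `u` on `W` under the subalgebra
`μⁱ_i = b_{ij} μⁱ`: all germs that arise from germs of `u` at points of `W` by finitely many
flows of elements of the subalgebra. -/
def orbit (lam : Fin n → (Fin n → ℝ) → ℝ) (U : Set (Fin n → ℝ)) (i j : Fin n)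
    (Ω : Set (Jet n)) (W : Set (ℝ × ℝ)) (u : ℝ × ℝ → Fin n → ℝ) : Set (PointedFun n) :=
  {B | ∃ z ∈ W, Relation.ReflTransGen (FlowStep lam U i j Ω) (z, u) B}

/-- Near `z`, the function `v` satisfies the relation `I(x, t, v, vⁱ_x) = φ(vⁱ)`. -/
def SatisfiesRelationNear (i : Fin n) (I : ℝ × ℝ × (Fin n → ℝ) × ℝ → ℝ) (φ : ℝ → ℝ)
    (z : ℝ × ℝ) (v : ℝ × ℝ → Fin n → ℝ) : Prop :=
  ∀ᶠ y in 𝓝 z, I (y.1, y.2, v y, dx v y i) = φ (v y i)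

end Hydro

end

/-! The proof compares two descriptions of the same solutions.

Hodograph description. A solution with all u^k_x ≠ 0 is given locally by x + λ^k(u) t = w^k(u),
where w is a commuting flow (`exists_hodograph`). Flowing for time ε along μ replaces the data w by
w - ε μ (`exists_hodograph_family`). So the orbits are governed by the differences of hodograph data
modulo the subalgebra.

Description by the invariant. The relation J = φ(u^i), solved for the derivative, reads 1/u^i_x =
θ(x,t,u). Since J annihilates the Monge distribution, ∂_k θ = -a_{ik} θ for k ≠ i and θ_t - λ^i θ_x
= -∂_i λ^i. Differentiating the last equation in u^j forces θ_x = b_{ij} (`exists_theta`,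
`isTheta_of_characteristic`). Hence θ = b_{ij} (x + λ^i t) - t ∂_i λ^i + ρ(u). On a hodograph
solution 1/u^i_x = ∂_i w^i - t ∂_i λ^i, and the relation becomes ∂_i w^i = b_{ij} w^i + ρ
(`IsCompatible.relation_iff`). This is an affine equation whose homogeneous part is the one that
cuts out the subalgebra. The solutions with one and the same φ thus have data in one affine space
over the subalgebra.

The flows keep the relation. The equation ∂_i μ^i = b_{ij} μ^i is what makes J constant along the
flow with the moving base point (`IsCommonSolution.fderiv_invariant`), and this passes to whole
neighbourhoods of the base point (`FlowStep.relation`).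

Conversely, the relation gives the orbit. A flow keeps t and u^i at the base point, so only germs
with equal (u^i, t) can be joined. For those, short steps exist by the implicit function theorem
(`eventually_flowStep`, `IsOrbitChart.eventually_connected`), and connectedness of convex sets
chains them while the jets stay in Ω (`IsOrbitChart.connected`). This is why N is cut by the
condition that (u^i, t) is a value taken by u on W₀.

The analytic input is a supply of commuting flows with prescribed values on a transversal curve. A
coordinatewise change of variables turns this into a compatible Darboux system with data on the
diagonal (`exists_darboux`). It is solved as an integral equation along rays, and compatibility
makes the defect of the differential equations vanish. That the flow found in this way represents
the given solution follows from uniqueness for diagonal linear hyperbolic systems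
(`hyperbolic_unique`). -/

noncomputable section

namespace Hydro

/-! ### Smooth inverse and implicit functions on a whole neighbourhood -/

/-- A smooth map with injective derivative at `a` is a local diffeomorphism near `a`. -/
theorem exists_smooth_local_inverse {E : Type*} [NormedAddCommGroup E] [NormedSpace ℝ E]
    [FiniteDimensional ℝ E] {f : E → E} {O : Set E} (hO : IsOpen O) (hf : ContDiffOn ℝ ∞ f O)
    {a : E} (ha : a ∈ O) (hinj : ∀ v, fderiv ℝ f a v = 0 → v = 0) :
    ∃ e : OpenPartialHomeomorph E E, a ∈ e.source ∧ e.source ⊆ O ∧ (∀ x, e x = f x) ∧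
      ContDiffOn ℝ ∞ e.symm e.target := by
  have : CompleteSpace E := FiniteDimensional.complete ℝ E
  have hdet : ∀ x, (∀ v, fderiv ℝ f x v = 0 → v = 0) → (fderiv ℝ f x).det ≠ 0 := by
    intro x hx h0
    obtain ⟨v, hv, hv0⟩ := (LinearMap.bot_lt_ker_of_det_eq_zero h0).ne'
      |> (Submodule.ne_bot_iff _).1
    exact hv0 (hx v hv)
  have hcont : ContinuousOn (fun x => (fderiv ℝ f x).det) O :=
    ContinuousLinearMap.continuous_det.comp_continuousOn
      (hf.continuousOn_fderiv_of_isOpen hO (by simp))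
  -- Only points with nonzero determinant are kept; there the inverse is smooth at every point of
  -- the target, not only at the image of `a`.
  have hO' : IsOpen (O ∩ (fun x => (fderiv ℝ f x).det) ⁻¹' {0}ᶜ) :=
    hcont.isOpen_inter_preimage hO isOpen_compl_singleton
  set O' := O ∩ (fun x => (fderiv ℝ f x).det) ⁻¹' {0}ᶜ with hO'def
  have hder : ∀ x (hx : x ∈ O'), HasFDerivAt f
      ((fderiv ℝ f x).toContinuousLinearEquivOfDetNeZero (by simpa using hx.2) : E →L[ℝ] E) x := by
    intro x hx
    have : DifferentiableAt ℝ f x := (hf.contDiffAt (hO.mem_nhds hx.1)).differentiableAt (by simp)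
    simpa using this.hasFDerivAt
  have haO' : a ∈ O' := ⟨ha, by simpa using hdet a hinj⟩
  have hca : ContDiffAt ℝ ∞ f a := hf.contDiffAt (hO.mem_nhds ha)
  set e₀ := hca.toOpenPartialHomeomorph f (hder a haO') (by simp) with he₀
  have he₀f : ∀ x, e₀ x = f x := fun x => rfl
  refine ⟨e₀.restrOpen O' hO', ⟨hca.mem_toOpenPartialHomeomorph_source (hder a haO') (by simp), haO'⟩,
    fun x hx => hx.2.1, fun x => rfl, ?_⟩
  intro y hy
  have hy1 : y ∈ e₀.target := hy.1
  have hy2 : e₀.symm y ∈ O' := hy.2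
  refine (OpenPartialHomeomorph.contDiffAt_symm (n := ∞) e₀ hy1 (hder _ hy2) ?_).contDiffWithinAt
  exact hf.contDiffAt (hO.mem_nhds hy2.1)

/-- The smooth implicit function theorem, on a whole neighbourhood. -/
theorem exists_smooth_implicit {Y E : Type*} [NormedAddCommGroup Y] [NormedSpace ℝ Y]
    [FiniteDimensional ℝ Y] [NormedAddCommGroup E] [NormedSpace ℝ E]
    [FiniteDimensional ℝ E] {H : Y × E → E} {O : Set (Y × E)} (hO : IsOpen O)
    (hH : ContDiffOn ℝ ∞ H O) {y₀ : Y} {e₀ : E} (h₀ : (y₀, e₀) ∈ O) (hz : H (y₀, e₀) = 0)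
    (hinj : ∀ v : E, fderiv ℝ H (y₀, e₀) (0, v) = 0 → v = 0) :
    ∃ (V : Y → E) (A : Set Y), IsOpen A ∧ y₀ ∈ A ∧ ContDiffOn ℝ ∞ V A ∧ V y₀ = e₀ ∧
      (∀ y ∈ A, (y, V y) ∈ O ∧ H (y, V y) = 0) ∧
      ∀ᶠ p in 𝓝 (y₀, e₀), H p = 0 → p.2 = V p.1 := by
  -- The map (y, e) ↦ (y, H(y, e)) is inverted locally; the implicit function is the second
  -- component of its inverse at (y, 0).
  have hF : ContDiffOn ℝ ∞ (fun p : Y × E => (p.1, H p)) O := contDiffOn_fst.prodMk hH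
  have hd : DifferentiableAt ℝ H (y₀, e₀) :=
    (hH.contDiffAt (hO.mem_nhds h₀)).differentiableAt (by simp)
  obtain ⟨e, hae, heO, hef, hes⟩ := exists_smooth_local_inverse hO hF h₀ (by
    intro v hv
    have h1 : fderiv ℝ (fun p : Y × E => (p.1, H p)) (y₀, e₀) =
        (ContinuousLinearMap.fst ℝ Y E).prod (fderiv ℝ H (y₀, e₀)) :=
      (hasFDerivAt_fst.prodMk hd.hasFDerivAt).fderiv
    rw [h1] at hv
    simp only [ContinuousLinearMap.prod_apply, ContinuousLinearMap.coe_fst', Prod.mk_eq_zero] at hv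
    obtain ⟨v1, v2⟩ := v
    simp only at hv
    obtain ⟨rfl, h2⟩ := hv
    rw [hinj v2 h2]; rfl)
  have hlin : Continuous (fun y : Y => (y, (0 : E))) := by fun_prop
  refine ⟨fun y => (e.symm (y, 0)).2, {y | (y, (0 : E)) ∈ e.target}, e.open_target.preimage hlin, ?_,
    ?_, ?_, ?_, ?_⟩
  · have := e.map_source hae
    rw [hef] at this
    simpa [hz] using this
  · have : ContDiffOn ℝ ∞ (fun y : Y => e.symm (y, (0 : E))) {y | (y, (0 : E)) ∈ e.target} :=
      hes.comp (by fun_prop) (fun y hy => hy)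
    exact contDiff_snd.comp_contDiffOn this
  · have := e.left_inv hae
    rw [hef] at this
    simp only [hz] at this
    simp [this]
  · intro y hy
    have h1 : e.symm (y, 0) ∈ e.source := e.map_target hy
    have h2 := e.right_inv hy
    rw [hef] at h2
    have h3 : (e.symm (y, 0)).1 = y := congrArg Prod.fst h2
    have h4 : H (e.symm (y, 0)) = 0 := congrArg Prod.snd h2
    have h5 : (y, (e.symm (y, 0)).2) = e.symm (y, 0) := Prod.ext h3.symm rfl
    rw [h5]
    exact ⟨heO h1, h4⟩
  · filter_upwards [e.open_source.mem_nhds hae] with p hp hp0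
    have := e.left_inv hp
    rw [hef] at this
    simp only [hp0] at this
    simp [this]

/-! ### Cutoffs and linear ordinary differential equations -/

/-- Multiplication by a bump function supported in `O`. The integral and ordinary differential
equations below are solved for globally smooth coefficients, while only germs matter in the
applications. -/
theorem exists_contDiff_eventuallyEq {E F : Type*} [NormedAddCommGroup E] [NormedSpace ℝ E]
    [FiniteDimensional ℝ E] [NormedAddCommGroup F] [NormedSpace ℝ F] {f : E → F} {O : Set E}
    (hO : IsOpen O) (hf : ContDiffOn ℝ ∞ f O) {a : E} (ha : a ∈ O) :
    ∃ g : E → F, ContDiff ℝ ∞ g ∧ g =ᶠ[𝓝 a] f := by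
  obtain ⟨δ, hδ, hδO⟩ := Metric.isOpen_iff.1 hO a ha
  let χ : ContDiffBump a := ⟨δ / 4, δ / 2, by positivity, by linarith⟩
  refine ⟨fun x => χ x • f x, ?_, ?_⟩
  · rw [contDiff_iff_contDiffAt]
    intro x
    by_cases hx : x ∈ O
    · exact χ.contDiffAt.smul (hf.contDiffAt (hO.mem_nhds hx))
    · have h1 : x ∉ tsupport χ := by
        rw [χ.tsupport_eq]
        intro h
        exact hx (hδO (Metric.closedBall_subset_ball (by show δ / 2 < δ; linarith) h))
      have h2 : (fun x => χ x • f x) =ᶠ[𝓝 x] fun _ => 0 := by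
        filter_upwards [(isClosed_tsupport χ).isOpen_compl.mem_nhds h1] with z hz
        simp [image_eq_zero_of_notMem_tsupport hz]
      exact contDiffAt_const.congr_of_eventuallyEq h2
  · filter_upwards [χ.eventuallyEq_one] with x hx
    simp [hx]

theorem contDiff_primitive {f : ℝ → ℝ} (hf : ContDiff ℝ ∞ f) :
    ContDiff ℝ ∞ (fun s => ∫ x in (0 : ℝ)..s, f x) := by
  have h : ∀ s, HasDerivAt (fun s => ∫ x in (0 : ℝ)..s, f x) (f s) s := fun s =>
    intervalIntegral.integral_hasDerivAt_right (hf.continuous.intervalIntegrable _ _)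
      (hf.continuous.stronglyMeasurableAtFilter _ _) hf.continuous.continuousAt
  rw [contDiff_infty_iff_deriv]
  refine ⟨fun s => (h s).differentiableAt, ?_⟩
  rwa [show deriv (fun s => ∫ x in (0 : ℝ)..s, f x) = f from funext fun s => (h s).deriv]

/-- The scalar linear equation `h' = α h + β` has a global smooth solution. -/
theorem exists_linear_ode {α β : ℝ → ℝ} (hα : ContDiff ℝ ∞ α) (hβ : ContDiff ℝ ∞ β) (y : ℝ) :
    ∃ h : ℝ → ℝ, ContDiff ℝ ∞ h ∧ h 0 = y ∧ ∀ s, HasDerivAt h (α s * h s + β s) s := by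
  have hA := contDiff_primitive hα
  set A := fun s => ∫ x in (0 : ℝ)..s, α x with hAdef
  have hA' : ∀ s, HasDerivAt A (α s) s := fun s =>
    intervalIntegral.integral_hasDerivAt_right (hα.continuous.intervalIntegrable _ _)
      (hα.continuous.stronglyMeasurableAtFilter _ _) hα.continuous.continuousAt
  have hg : ContDiff ℝ ∞ (fun s => Real.exp (-A s) * β s) := by fun_prop
  have hB := contDiff_primitive hg
  set B := fun s => ∫ x in (0 : ℝ)..s, Real.exp (-A x) * β x with hBdef
  have hB' : ∀ s, HasDerivAt B (Real.exp (-A s) * β s) s := fun s =>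
    intervalIntegral.integral_hasDerivAt_right (hg.continuous.intervalIntegrable _ _)
      (hg.continuous.stronglyMeasurableAtFilter _ _) hg.continuous.continuousAt
  -- Variation of constants.
  refine ⟨fun s => Real.exp (A s) * (y + B s), by fun_prop, by simp [hAdef, hBdef], fun s => ?_⟩
  have h1 := (hA' s).exp.mul ((hB' s).const_add y)
  convert! h1 using 1
  have : Real.exp (A s) * Real.exp (-A s) = 1 := by rw [← Real.exp_add]; simp
  linear_combination -(β s) * this

/-! ### Smoothness of superposition operators -/

section Superposition

variable {n : ℕ} {K : Type*} [TopologicalSpace K] [CompactSpace K]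

theorem contDiff_mulContinuousMap : ContDiff ℝ ∞ (ContinuousLinearMap.mul ℝ C(K, ℝ)) :=
  ContinuousLinearMap.contDiff (E := C(K, ℝ)) (F := C(K, ℝ) →L[ℝ] C(K, ℝ)) _

/-- The superposition operator `f ↦ g ∘ f` on tuples of continuous functions. -/
def superposition (g : C(Fin n → ℝ, ℝ)) (f : Fin n → C(K, ℝ)) : C(K, ℝ) :=
  ⟨fun x => g (fun k => f k x), by fun_prop⟩

/-- The range of a tuple of continuous functions on a compact space is compact, so the gradient of
`g` is uniformly continuous around it. The mean value inequality then bounds the remainder by c‖h‖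
at all points of `K` at once. -/
theorem hasFDerivAt_superposition {g : C(Fin n → ℝ, ℝ)} {g' : Fin n → C(Fin n → ℝ, ℝ)}
    (hg : ∀ u, HasFDerivAt g (∑ k, g' k u • ContinuousLinearMap.proj (R := ℝ) k) u)
    (f : Fin n → C(K, ℝ)) :
    HasFDerivAt (superposition g) (∑ k, (ContinuousLinearMap.mul ℝ C(K, ℝ)
      (superposition (g' k) f)).comp (ContinuousLinearMap.proj (R := ℝ) k)) f := by
  set G : (Fin n → ℝ) → ((Fin n → ℝ) →L[ℝ] ℝ) :=
    fun u => ∑ k, g' k u • ContinuousLinearMap.proj (R := ℝ) k with hG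
  have hGc : Continuous G := by fun_prop
  rw [hasFDerivAt_iff_isLittleO_nhds_zero, Asymptotics.isLittleO_iff]
  intro c hc
  let ev : K → (Fin n → ℝ) := fun x k => f k x
  have hev : Continuous ev := by fun_prop
  have hcomp : IsCompact (range ev) := isCompact_range hev
  have hu := hcomp.uniformContinuousAt_of_continuousAt G (fun a _ => hGc.continuousAt)
    (Metric.dist_mem_uniformity hc)
  obtain ⟨δ, hδ, hδ'⟩ := Metric.mem_uniformity_dist.1 hu
  filter_upwards [Metric.ball_mem_nhds (0 : Fin n → C(K, ℝ)) hδ] with h hh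
  have hhn : ‖h‖ < δ := by simpa using hh
  rw [ContinuousMap.norm_le _ (by positivity)]
  intro x
  have hx : ‖(fun k => h k x : Fin n → ℝ)‖ ≤ ‖h‖ := by
    rw [pi_norm_le_iff_of_nonneg (norm_nonneg _)]
    intro k
    exact ((h k).norm_coe_le_norm x).trans (norm_le_pi_norm h k)
  have key := (convex_ball (ev x) δ).norm_image_sub_le_of_norm_hasFDerivWithin_le'
    (f := g) (f' := G) (φ := G (ev x)) (C := c)
    (fun u _ => (hg u).hasFDerivWithinAt)
    (fun u hu' => by
      have := hδ' (a := ev x) (b := u) (by rwa [dist_comm]) (mem_range_self x)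
      have h2 : dist (G (ev x)) (G u) < c := this
      rw [dist_comm, dist_eq_norm] at h2
      exact h2.le)
    (Metric.mem_ball_self hδ) (y := ev x + fun k => h k x)
    (by simpa [dist_eq_norm] using lt_of_le_of_lt hx hhn)
  have e1 : (superposition g (f + h) - superposition g f -
      (∑ k, (ContinuousLinearMap.mul ℝ C(K, ℝ)
      (superposition (g' k) f)).comp (ContinuousLinearMap.proj (R := ℝ) k)) h) x =
      g (ev x + fun k => h k x) - g (ev x) - G (ev x) (ev x + (fun k => h k x) - ev x) := by
    simp [superposition, G, ev]
    rfl
  rw [e1]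
  refine key.trans ?_
  simpa using mul_le_mul_of_nonneg_left hx hc.le

theorem contDiff_partialDeriv {g : (Fin n → ℝ) → ℝ} (hg : ContDiff ℝ ∞ g) (k : Fin n) :
    ContDiff ℝ ∞ (fun u => fderiv ℝ g u (Pi.single k 1)) :=
  (hg.fderiv_right (by simp)).clm_apply contDiff_const

/-- A partial derivative of a smooth function, as a continuous map. -/
def partialDeriv (g : C(Fin n → ℝ, ℝ)) (hg : ContDiff ℝ ∞ g) (k : Fin n) : C(Fin n → ℝ, ℝ) :=
  ⟨fun u => fderiv ℝ g u (Pi.single k 1), (contDiff_partialDeriv hg k).continuous⟩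

theorem fderiv_apply_eq_sum {F : Type*} [NormedAddCommGroup F] [NormedSpace ℝ F]
    (L : (Fin n → ℝ) →L[ℝ] F) (v : Fin n → ℝ) : L v = ∑ k, v k • L (Pi.single k 1) := by
  conv_lhs => rw [← Finset.univ_sum_single v]
  rw [map_sum]
  refine Finset.sum_congr rfl fun k _ => ?_
  have : (Pi.single k (v k) : Fin n → ℝ) = v k • Pi.single k 1 := by
    rw [← Pi.single_smul]; simp
  rw [this, map_smul]

theorem hasFDerivAt_sum_proj (g : C(Fin n → ℝ, ℝ)) (hg : ContDiff ℝ ∞ g) (u : Fin n → ℝ) :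
    HasFDerivAt g (∑ k, partialDeriv g hg k u •
      ContinuousLinearMap.proj (R := ℝ) (φ := fun _ : Fin n => ℝ) k) u := by
  have h1 := (hg.differentiable (by simp) u).hasFDerivAt
  convert! h1 using 1
  ext v
  refine Eq.trans ?_ (fderiv_apply_eq_sum (fderiv ℝ g u) v).symm
  simp only [sum_apply]
  exact Finset.sum_congr rfl fun k _ => mul_comm _ _

theorem contDiff_superposition (g : C(Fin n → ℝ, ℝ)) (hg : ContDiff ℝ ∞ g) :
    ContDiff ℝ ∞ (superposition (K := K) g) := by
  rw [contDiff_infty]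
  intro m
  -- The derivative is built from the superposition operators of the partial derivatives of `g`, so
  -- the induction has to run over all `g` simultaneously.
  induction m generalizing g with
  | zero =>
    rw [Nat.cast_zero, contDiff_zero]
    exact continuous_iff_continuousAt.2 fun f =>
      (hasFDerivAt_superposition (hasFDerivAt_sum_proj g hg) f).continuousAt
  | succ m ih =>
    have hF := hasFDerivAt_superposition (K := K) (hasFDerivAt_sum_proj g hg)
    rw [Nat.cast_succ, contDiff_succ_iff_hasFDerivAt]
    refine ⟨_, ?_, hF⟩
    refine ContDiff.sum fun k _ => ?_
    exact ContDiff.clm_comp (((contDiff_mulContinuousMap (K := K)).of_le (by exact_mod_cast le_top)).comp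
      (ih (partialDeriv g hg k) (contDiff_partialDeriv hg k))) contDiff_const

end Superposition

/-! ### The Cauchy problem with data on the diagonal for a linear Darboux system -/

section Darboux

variable {n : ℕ}

/-- The point at the parameter `ρ` of the segment from `(rᵏ, …, rᵏ)` to `r`. -/
def ray (k : Fin n) (ρ : ℝ) (r : Fin n → ℝ) : Fin n → ℝ := fun m => r k + ρ * (r m - r k)

theorem ray_apply_self (k : Fin n) (ρ : ℝ) (r : Fin n → ℝ) : ray k ρ r k = r k := by simp [ray]

theorem ray_one (k : Fin n) (r : Fin n → ℝ) : ray k 1 r = r := by ext m; simp [ray]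

theorem ray_ray (k : Fin n) (ρ σ : ℝ) (r : Fin n → ℝ) : ray k ρ (ray k σ r) = ray k (ρ * σ) r := by
  ext m; simp only [ray]; ring

theorem norm_ray_le (k : Fin n) {ρ : ℝ} (h0 : 0 ≤ ρ) (h1 : ρ ≤ 1) (r : Fin n → ℝ) :
    ‖ray k ρ r‖ ≤ ‖r‖ := by
  rw [pi_norm_le_iff_of_nonneg (norm_nonneg _)]
  intro m
  have hk := norm_le_pi_norm r k
  have hm := norm_le_pi_norm r m
  rw [Real.norm_eq_abs, abs_le] at *
  simp only [ray]
  constructor <;> nlinarith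

theorem ray_mem_ball (k : Fin n) {ρ : ℝ} (h0 : 0 ≤ ρ) (h1 : ρ ≤ 1) {r : Fin n → ℝ} {δ : ℝ}
    (hr : r ∈ Metric.ball 0 δ) : ray k ρ r ∈ Metric.ball 0 δ := by
  rw [mem_ball_zero_iff] at *
  exact (norm_ray_le k h0 h1 r).trans_lt hr

theorem continuous_ray (k : Fin n) : Continuous fun p : ℝ × (Fin n → ℝ) => ray k p.1 p.2 := by
  unfold ray; fun_prop

/-- The compact set of linear contractions of `ℝⁿ` with the supremum norm. -/
abbrev Contr (n : ℕ) : Type :=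
  Metric.closedBall (0 : (Fin n → ℝ) →L[ℝ] (Fin n → ℝ)) 1

/-- Functions of a contraction form a fixed Banach space. The unknown w of the Darboux system is
encoded as M ↦ w(M r): the point r becomes a parameter of the integral operator, and smoothness of w
in r reduces to smoothness of superposition operators. Rays alone would not suffice as arguments,
because the rays for different indices k are composed when the equation is iterated. -/
instance : CompactSpace (Contr n) :=
  have : ProperSpace ((Fin n → ℝ) →L[ℝ] (Fin n → ℝ)) := FiniteDimensional.proper ℝ _
  isCompact_iff_compactSpace.1 (isCompact_closedBall _ _)

/-- `ray k ρ` as a linear map. -/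
def rayL (k : Fin n) (ρ : ℝ) : (Fin n → ℝ) →L[ℝ] (Fin n → ℝ) :=
  (1 - ρ) • ((ContinuousLinearMap.proj (R := ℝ) (φ := fun _ : Fin n => ℝ) k).smulRight
    (fun _ => (1 : ℝ))) + ρ • ContinuousLinearMap.id ℝ _

theorem rayL_apply (k : Fin n) (ρ : ℝ) (r : Fin n → ℝ) : rayL k ρ r = ray k ρ r := by
  ext m; simp [rayL, ray]; ring

theorem Contr.norm_le (M : Contr n) : ‖(M : (Fin n → ℝ) →L[ℝ] (Fin n → ℝ))‖ ≤ 1 :=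
  mem_closedBall_zero_iff.1 M.2

/-- Composition of contractions. -/
def Contr.comp (N M : Contr n) : Contr n :=
  ⟨N.1.comp M.1, by
    have h1 := N.1.opNorm_comp_le M.1
    have h2 := N.norm_le
    have h3 := M.norm_le
    rw [mem_closedBall_zero_iff]
    exact h1.trans (mul_le_one₀ h2 (norm_nonneg _) h3)⟩

/-- `ray k ρ` as a contraction; the parameter is projected to `[0, 1]`. -/
def Contr.ray (k : Fin n) (ρ : ℝ) : Contr n :=
  ⟨rayL k (projIcc (0 : ℝ) 1 zero_le_one ρ), by
    rw [mem_closedBall_zero_iff]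
    refine ContinuousLinearMap.opNorm_le_bound _ zero_le_one fun r => ?_
    rw [rayL_apply, one_mul]
    exact norm_ray_le k (projIcc (0 : ℝ) 1 zero_le_one ρ).2.1
      (projIcc (0 : ℝ) 1 zero_le_one ρ).2.2 r⟩

theorem Contr.ray_apply (k : Fin n) {ρ : ℝ} (hρ : ρ ∈ Icc (0 : ℝ) 1) (r : Fin n → ℝ) :
    (Contr.ray k ρ).1 r = Hydro.ray k ρ r := by
  simp only [Contr.ray]
  rw [rayL_apply, projIcc_of_mem _ hρ]

theorem Contr.continuous_ray_comp (k : Fin n) :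
    Continuous fun p : Contr n × ℝ => (Contr.ray k p.2).comp p.1 := by
  refine Continuous.subtype_mk ?_ _
  refine Continuous.clm_comp ?_ (continuous_subtype_val.comp continuous_fst)
  have : Continuous fun ρ : ℝ => rayL k (projIcc (0 : ℝ) 1 zero_le_one ρ : ℝ) := by
    unfold rayL
    fun_prop
  exact this.comp continuous_snd

/-- The identity as a contraction. -/
def Contr.one : Contr n :=
  ⟨ContinuousLinearMap.id ℝ _, by
    rw [mem_closedBall_zero_iff]; exact ContinuousLinearMap.norm_id_le⟩

/-- Averaging of a function of contractions over the segment maps `ray k ρ`. -/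
def rayMean (k : Fin n) : C(Contr n, ℝ) →L[ℝ] C(Contr n, ℝ) :=
  LinearMap.mkContinuous
    { toFun := fun f => ⟨fun M => ∫ ρ in (0 : ℝ)..1, f ((Contr.ray k ρ).comp M),
        intervalIntegral.continuous_parametric_intervalIntegral_of_continuous'
          (f := fun M ρ => f ((Contr.ray k ρ).comp M))
          (f.continuous.comp (Contr.continuous_ray_comp k)) 0 1⟩
      map_add' := by
        intro f g
        ext M
        have h : ∀ f : C(Contr n, ℝ), IntervalIntegrable
            (fun ρ : ℝ => f ((Contr.ray k ρ).comp M)) MeasureTheory.volume 0 1 := fun f =>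
          (f.continuous.comp ((Contr.continuous_ray_comp k).comp
            (Continuous.prodMk_right M))).intervalIntegrable _ _
        exact intervalIntegral.integral_add (h f) (h g)
      map_smul' := by
        intro c f
        ext M
        exact intervalIntegral.integral_smul (μ := MeasureTheory.volume) (a := (0 : ℝ)) (b := 1) c
          (fun ρ => f ((Contr.ray k ρ).comp M)) } 1 (by
    intro f
    rw [one_mul, ContinuousMap.norm_le _ (norm_nonneg _)]
    intro M
    have := intervalIntegral.norm_integral_le_of_norm_le_const (a := (0 : ℝ)) (b := 1)
      (f := fun ρ => f ((Contr.ray k ρ).comp M)) (C := ‖f‖) (fun ρ _ => f.norm_coe_le_norm _)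
    simpa using this)

/-- The functions `M ↦ (M r)ᵏ`. -/
def contrCoord : (Fin n → ℝ) →L[ℝ] (Fin n → C(Contr n, ℝ)) :=
  LinearMap.toContinuousLinearMap
    { toFun := fun r k => ⟨fun M => M.1 r k, by fun_prop⟩
      map_add' := by intro r s; ext k M; simp
      map_smul' := by intro c r; ext k M; simp }

/-- The integral operator of the Darboux system, rescaled to the compact set of contractions. -/
def darbouxOp (α : Fin n → Fin n → C(Fin n → ℝ, ℝ)) (r : Fin n → ℝ) :
    (Fin n → C(Contr n, ℝ)) →L[ℝ] (Fin n → C(Contr n, ℝ)) :=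
  ∑ k, ∑ l, (ContinuousLinearMap.single ℝ (fun _ : Fin n => C(Contr n, ℝ)) k).comp
    ((ContinuousLinearMap.mul ℝ C(Contr n, ℝ) (contrCoord r l - contrCoord r k)).comp
      ((rayMean k).comp ((ContinuousLinearMap.mul ℝ C(Contr n, ℝ)
        (superposition (α k l) (contrCoord r))).comp
        (ContinuousLinearMap.proj (R := ℝ) (φ := fun _ : Fin n => C(Contr n, ℝ)) l -
          ContinuousLinearMap.proj (R := ℝ) (φ := fun _ : Fin n => C(Contr n, ℝ)) k))))

theorem darbouxOp_apply (α : Fin n → Fin n → C(Fin n → ℝ, ℝ)) (r : Fin n → ℝ)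
    (X : Fin n → C(Contr n, ℝ)) (k : Fin n) (M : Contr n) :
    darbouxOp α r X k M = ∑ l, (M.1 r l - M.1 r k) *
      ∫ ρ in (0 : ℝ)..1, α k l (((Contr.ray k ρ).comp M).1 r) *
        (X l ((Contr.ray k ρ).comp M) - X k ((Contr.ray k ρ).comp M)) := by
  simp only [darbouxOp, sum_apply, Finset.sum_apply, ContinuousLinearMap.comp_apply]
  rw [Finset.sum_eq_single k]
  · rw [ContinuousMap.coe_sum, Finset.sum_apply]
    refine Finset.sum_congr rfl fun l _ => ?_
    simp only [ContinuousLinearMap.single_apply, Pi.single_eq_same]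
    rfl
  · intro b _ hb
    simp [Pi.single_eq_of_ne hb.symm]
  · simp

theorem contDiff_darbouxOp {α : Fin n → Fin n → C(Fin n → ℝ, ℝ)}
    (hα : ∀ k l, ContDiff ℝ ∞ (α k l)) : ContDiff ℝ ∞ (darbouxOp α) := by
  unfold darbouxOp
  refine ContDiff.sum fun k _ => ContDiff.sum fun l _ => ?_
  have hc : ∀ k : Fin n, ContDiff ℝ ∞ fun r : Fin n → ℝ => contrCoord r k := fun k =>
    contDiff_pi.1 (contrCoord (n := n)).contDiff k
  refine contDiff_const.clm_comp (ContDiff.clm_comp ?_ (contDiff_const.clm_comp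
    (ContDiff.clm_comp ?_ contDiff_const)))
  · exact contDiff_mulContinuousMap.comp ((hc l).sub (hc k))
  · exact contDiff_mulContinuousMap.comp
      ((contDiff_superposition _ (hα k l)).comp (contrCoord (n := n)).contDiff)

/-- All factors (M r)^l - (M r)^k vanish at r = 0. By continuity the operator has norm less than 1
near 0, which makes 1 - `darbouxOp α r` invertible. -/
theorem darbouxOp_zero (α : Fin n → Fin n → C(Fin n → ℝ, ℝ)) : darbouxOp α 0 = 0 := by
  ext X k M
  rw [darbouxOp_apply]
  simp

/-- The rescaled data of the Darboux system. -/
def darbouxData (h : Fin n → C(ℝ, ℝ)) (r : Fin n → ℝ) : Fin n → C(Contr n, ℝ) :=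
  fun k => superposition ⟨fun u => h k (u k), by fun_prop⟩ (contrCoord r)

theorem darbouxData_apply (h : Fin n → C(ℝ, ℝ)) (r : Fin n → ℝ) (k : Fin n) (M : Contr n) :
    darbouxData h r k M = h k (M.1 r k) := rfl

theorem contDiff_darbouxData {h : Fin n → C(ℝ, ℝ)} (hh : ∀ k, ContDiff ℝ ∞ (h k)) :
    ContDiff ℝ ∞ (darbouxData h) := by
  refine contDiff_pi.2 fun k => ?_
  refine (contDiff_superposition _ ?_).comp (contrCoord (n := n)).contDiff
  exact (hh k).comp (contDiff_apply ℝ ℝ k)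

/-- The integral equation of the Darboux system has a smooth solution near `0`. -/
theorem exists_darboux_integral {α : Fin n → Fin n → C(Fin n → ℝ, ℝ)}
    (hα : ∀ k l, ContDiff ℝ ∞ (α k l)) {h : Fin n → C(ℝ, ℝ)} (hh : ∀ k, ContDiff ℝ ∞ (h k)) :
    ∃ δ > 0, ∃ w : (Fin n → ℝ) → Fin n → ℝ, ContDiffOn ℝ ∞ w (Metric.ball 0 δ) ∧
      ∀ r ∈ Metric.ball (0 : Fin n → ℝ) δ, ∀ k,
        w r k = h k (r k) + ∑ l, (r l - r k) * ∫ ρ in (0 : ℝ)..1,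
          α k l (ray k ρ r) * (w (ray k ρ r) l - w (ray k ρ r) k) := by
  have hT := contDiff_darbouxOp hα
  have hnhds : ∀ᶠ r in 𝓝 (0 : Fin n → ℝ), ‖darbouxOp α r‖ < 1 := by
    have h1 := hT.continuous.tendsto 0
    rw [darbouxOp_zero] at h1
    filter_upwards [h1 (Metric.ball_mem_nhds _ one_pos)] with r hr
    have h2 : dist (darbouxOp α r) 0 < 1 := hr
    exact lt_of_eq_of_lt (dist_zero_right
      (E := (Fin n → C(Contr n, ℝ)) →L[ℝ] (Fin n → C(Contr n, ℝ))) (darbouxOp α r)).symm h2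
  obtain ⟨δ, hδ, hball⟩ := Metric.eventually_nhds_iff_ball.1 hnhds
  -- The solution of X = data + operator applied to X; it is smooth in `r` because inversion is
  -- smooth on units.
  let W : (Fin n → ℝ) → (Fin n → C(Contr n, ℝ)) := fun r =>
    Ring.inverse (1 - darbouxOp α r) (darbouxData h r)
  have hunit : ∀ r ∈ Metric.ball (0 : Fin n → ℝ) δ, IsUnit (1 - darbouxOp α r) := fun r hr =>
    isUnit_one_sub_of_norm_lt_one (R := (Fin n → C(Contr n, ℝ)) →L[ℝ] (Fin n → C(Contr n, ℝ)))
      (hball r hr)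
  have huniq : ∀ r ∈ Metric.ball (0 : Fin n → ℝ) δ, ∀ X, X = darbouxData h r + darbouxOp α r X →
      X = W r := by
    intro r hr X hX
    have h1 : (1 - darbouxOp α r) X = darbouxData h r := by
      rw [sub_apply, one_apply_eq_self]
      exact sub_eq_of_eq_add hX
    simp only [W]
    rw [← h1, ← mul_apply_eq_comp, Ring.inverse_mul_cancel _ (hunit r hr)]
    rfl
  have hsol : ∀ r ∈ Metric.ball (0 : Fin n → ℝ) δ, W r = darbouxData h r + darbouxOp α r (W r) := by
    intro r hr
    have h1 : (1 - darbouxOp α r) (W r) = darbouxData h r := by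
      simp only [W]
      rw [← mul_apply_eq_comp, Ring.mul_inverse_cancel _ (hunit r hr)]
      rfl
    rw [sub_apply, one_apply_eq_self] at h1
    exact eq_add_of_sub_eq h1
  have hmem : ∀ r ∈ Metric.ball (0 : Fin n → ℝ) δ, ∀ M : Contr n,
      M.1 r ∈ Metric.ball (0 : Fin n → ℝ) δ := by
    intro r hr M
    rw [mem_ball_zero_iff] at *
    calc ‖M.1 r‖ ≤ ‖M.1‖ * ‖r‖ := M.1.le_opNorm r
      _ ≤ 1 * ‖r‖ := by gcongr; exact M.norm_le
      _ < δ := by simpa using hr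
  -- Composing with M turns the solution for r into a solution for M r, so by uniqueness the encoded
  -- functions for different r all come from one function of a point.
  have hshift : ∀ r ∈ Metric.ball (0 : Fin n → ℝ) δ, ∀ M : Contr n, ∀ k,
      W (M.1 r) k Contr.one = W r k M := by
    intro r hr M k
    have hcont : Continuous fun N : Contr n => N.comp M := by
      refine Continuous.subtype_mk ?_ _
      fun_prop
    let X : Fin n → C(Contr n, ℝ) := fun k => (W r k).comp ⟨fun N => N.comp M, hcont⟩
    have hX : X = W (M.1 r) := by
      apply huniq _ (hmem r hr M)
      ext k N
      have h1 := congrArg (fun Y => Y k (N.comp M)) (hsol r hr)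
      simp only [Pi.add_apply, ContinuousMap.add_apply, darbouxData_apply, darbouxOp_apply] at h1 ⊢
      exact h1
    rw [← hX]
    rfl
  -- That function is read off at the identity contraction.
  refine ⟨δ, hδ, fun r k => W r k Contr.one, ?_, ?_⟩
  · have hW : ContDiffOn ℝ ∞ W (Metric.ball 0 δ) := by
      intro r hr
      refine ContDiffAt.contDiffWithinAt ?_
      refine ContDiffAt.clm_apply ?_ (contDiff_darbouxData hh).contDiffAt
      obtain ⟨x, hx⟩ := hunit r hr
      have h1 := contDiffAt_ringInverse ℝ (n := ∞)
        (R := (Fin n → C(Contr n, ℝ)) →L[ℝ] (Fin n → C(Contr n, ℝ))) x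
      rw [hx] at h1
      exact h1.comp r (contDiffAt_const.sub hT.contDiffAt)
    refine contDiffOn_pi.2 fun k => ?_
    have h2 : ContDiffOn ℝ ∞ (fun r => W r k) (Metric.ball 0 δ) := contDiffOn_pi.1 hW k
    exact (ContinuousMap.evalCLM ℝ (Contr.one : Contr n)).contDiff.comp_contDiffOn h2
  · intro r hr k
    have h1 := congrArg (fun Y => Y k Contr.one) (hsol r hr)
    simp only [Pi.add_apply, ContinuousMap.add_apply, darbouxData_apply, darbouxOp_apply] at h1
    simp only
    rw [h1]
    congr 1
    refine Finset.sum_congr rfl fun l _ => ?_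
    congr 1
    refine intervalIntegral.integral_congr fun ρ hρ => ?_
    rw [uIcc_of_le zero_le_one] at hρ
    have h2 : ((Contr.ray k ρ).comp Contr.one).1 r = ray k ρ r := Contr.ray_apply k hρ r
    rw [h2, ← hshift r hr, ← hshift r hr, h2]

end Darboux

/-! ### Partial derivatives -/

section PartialDerivatives

variable {n : ℕ} {f g : (Fin n → ℝ) → ℝ} {O : Set (Fin n → ℝ)} {u : Fin n → ℝ} {k l : Fin n}

theorem smooth_differentiableAt {E F : Type*} [NormedAddCommGroup E] [NormedSpace ℝ E]
    [NormedAddCommGroup F] [NormedSpace ℝ F] {f : E → F} {O : Set E} (hO : IsOpen O)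
    (hf : ContDiffOn ℝ ∞ f O) {x : E} (hx : x ∈ O) : DifferentiableAt ℝ f x :=
  (hf.contDiffAt (hO.mem_nhds hx)).differentiableAt (by simp)

theorem smooth_fderiv_apply {E F : Type*} [NormedAddCommGroup E] [NormedSpace ℝ E]
    [NormedAddCommGroup F] [NormedSpace ℝ F] {f : E → F} {O : Set E} (hO : IsOpen O)
    (hf : ContDiffOn ℝ ∞ f O) (v : E) : ContDiffOn ℝ ∞ (fun x => fderiv ℝ f x v) O :=
  (hf.fderiv_of_isOpen hO (by simp)).clm_apply contDiffOn_const

theorem fderiv_fderiv_comm {E F : Type*} [NormedAddCommGroup E] [NormedSpace ℝ E]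
    [NormedAddCommGroup F] [NormedSpace ℝ F] {f : E → F} {O : Set E} (hO : IsOpen O)
    (hf : ContDiffOn ℝ ∞ f O) {x : E} (hx : x ∈ O) (v w : E) :
    fderiv ℝ (fun y => fderiv ℝ f y v) x w = fderiv ℝ (fun y => fderiv ℝ f y w) x v := by
  have hd : DifferentiableAt ℝ (fderiv ℝ f) x :=
    smooth_differentiableAt hO (hf.fderiv_of_isOpen hO (by simp)) hx
  have h : ∀ v : E, fderiv ℝ (fun y => fderiv ℝ f y v) x = (fderiv ℝ (fderiv ℝ f) x).flip v := by
    intro v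
    have := fderiv_clm_apply hd (differentiableAt_const v)
    simpa using this
  rw [h, h, ContinuousLinearMap.flip_apply, ContinuousLinearMap.flip_apply]
  have hs : IsSymmSndFDerivAt ℝ f x :=
    (hf.contDiffAt (hO.mem_nhds hx)).isSymmSndFDerivAt (by
      rw [minSmoothness_of_isRCLikeNormedField]
      exact WithTop.coe_le_coe.2 (le_top : (2 : ℕ∞) ≤ ⊤))
  exact hs w v

theorem smooth_pd (hO : IsOpen O) (hf : ContDiffOn ℝ ∞ f O) (k : Fin n) :
    ContDiffOn ℝ ∞ (pd k f) O :=
  smooth_fderiv_apply hO hf _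

theorem pd_comm (hO : IsOpen O) (hf : ContDiffOn ℝ ∞ f O) (hu : u ∈ O) (k l : Fin n) :
    pd k (pd l f) u = pd l (pd k f) u :=
  fderiv_fderiv_comm hO hf hu _ _

theorem pd_congr (h : f =ᶠ[𝓝 u] g) : pd k f u = pd k g u := by
  simp only [pd, h.fderiv_eq]

theorem pd_add (hf : DifferentiableAt ℝ f u) (hg : DifferentiableAt ℝ g u) :
    pd k (fun x => f x + g x) u = pd k f u + pd k g u := by
  simp only [pd]; rw [fderiv_fun_add hf hg]; rfl

theorem pd_sub (hf : DifferentiableAt ℝ f u) (hg : DifferentiableAt ℝ g u) :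
    pd k (fun x => f x - g x) u = pd k f u - pd k g u := by
  simp only [pd]; rw [fderiv_fun_sub hf hg]; rfl

theorem pd_mul (hf : DifferentiableAt ℝ f u) (hg : DifferentiableAt ℝ g u) :
    pd k (fun x => f x * g x) u = pd k f u * g u + f u * pd k g u := by
  simp only [pd]; rw [fderiv_fun_mul hf hg]; simp; ring

theorem pd_const (c : ℝ) : pd k (fun _ => c) u = 0 := by
  simp [pd]

theorem pd_const_mul (hf : DifferentiableAt ℝ f u) (c : ℝ) :
    pd k (fun x => c * f x) u = c * pd k f u := by
  rw [pd_mul (differentiableAt_const c) hf, pd_const]; ring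

theorem pd_sum {ι : Type*} {s : Finset ι} {f : ι → (Fin n → ℝ) → ℝ}
    (hf : ∀ i ∈ s, DifferentiableAt ℝ (f i) u) :
    pd k (fun x => ∑ i ∈ s, f i x) u = ∑ i ∈ s, pd k (f i) u := by
  simp only [pd]; rw [fderiv_fun_sum hf]; simp [sum_apply]

theorem pd_coord : pd k (fun x => x l) u = if l = k then 1 else 0 := by
  have : fderiv ℝ (fun x : Fin n → ℝ => x l) u =
      ContinuousLinearMap.proj (R := ℝ) (φ := fun _ : Fin n => ℝ) l :=
    (hasFDerivAt_apply l u).fderiv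
  simp only [pd, this, ContinuousLinearMap.proj_apply]
  by_cases h : l = k
  · subst h; simp
  · simp [h]

theorem fderiv_eq_sum_pd (f : (Fin n → ℝ) → ℝ) (u v : Fin n → ℝ) :
    fderiv ℝ f u v = ∑ k, v k * pd k f u := by
  rw [fderiv_apply_eq_sum]; rfl

theorem hasDerivAt_comp_curve {c : ℝ → Fin n → ℝ} {c' : Fin n → ℝ} {s : ℝ}
    (hf : DifferentiableAt ℝ f (c s)) (hc : HasDerivAt c c' s) :
    HasDerivAt (fun s => f (c s)) (∑ k, c' k * pd k f (c s)) s := by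
  rw [← fderiv_eq_sum_pd]
  exact hf.hasFDerivAt.comp_hasDerivAt s hc

end PartialDerivatives

/-! ### From the integral equation to the compatible Darboux system -/

section Darboux

variable {n : ℕ}

theorem hasDerivAt_ray (k : Fin n) (r : Fin n → ℝ) (ρ : ℝ) :
    HasDerivAt (fun ρ => ray k ρ r) (fun m => r m - r k) ρ := by
  rw [hasDerivAt_pi]
  intro m
  have := ((hasDerivAt_id ρ).mul_const (r m - r k)).const_add (r k)
  simpa [ray] using this

/-- The solution of the Darboux integral equation satisfies the system in the direction of the
rays from the diagonal. -/
theorem darboux_euler {α : Fin n → Fin n → (Fin n → ℝ) → ℝ} {h : Fin n → ℝ → ℝ} {δ : ℝ}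
    {w : Fin n → (Fin n → ℝ) → ℝ}
    (hα : ∀ k l, ContDiffOn ℝ ∞ (α k l) (Metric.ball 0 δ))
    (hw : ∀ k, ContDiffOn ℝ ∞ (w k) (Metric.ball 0 δ))
    (heq : ∀ r ∈ Metric.ball (0 : Fin n → ℝ) δ, ∀ k,
        w k r = h k (r k) + ∑ l, (r l - r k) * ∫ ρ in (0 : ℝ)..1,
          α k l (ray k ρ r) * (w l (ray k ρ r) - w k (ray k ρ r)))
    {r : Fin n → ℝ} (hr : r ∈ Metric.ball 0 δ) (k : Fin n) :
    ∑ m, (r m - r k) * (pd m (w k) r - α k m r * (w m r - w k r)) = 0 := by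
  let β : Fin n → (Fin n → ℝ) → ℝ := fun l u => α k l u * (w l u - w k u)
  have hβ : ∀ l, ContDiffOn ℝ ∞ (β l) (Metric.ball 0 δ) := fun l => (hα k l).mul ((hw l).sub (hw k))
  have hcr : Continuous fun ρ : ℝ => ray k ρ r := (continuous_ray k).comp (Continuous.prodMk_left r)
  set P : Set ℝ := (fun ρ : ℝ => ray k ρ r) ⁻¹' Metric.ball 0 δ with hP
  have hPo : IsOpen P := Metric.isOpen_ball.preimage hcr
  have h1P : (1 : ℝ) ∈ P := by simp only [hP, mem_preimage, ray_one]; exact hr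
  have hsub : uIcc (0 : ℝ) 1 ⊆ P := fun ρ hρ => by
    rw [uIcc_of_le zero_le_one] at hρ
    exact ray_mem_ball k hρ.1 hρ.2 hr
  have hβc : ∀ l, ContinuousOn (fun ρ => β l (ray k ρ r)) P := fun l =>
    (hβ l).continuousOn.comp hcr.continuousOn (fun ρ hρ => hρ)
  have hR : HasDerivAt (fun σ => h k (r k) + ∑ l, (r l - r k) * ∫ ρ in (0 : ℝ)..σ, β l (ray k ρ r))
      (∑ l, (r l - r k) * β l r) 1 := by
    refine HasDerivAt.const_add _ (HasDerivAt.fun_sum fun l _ => HasDerivAt.const_mul _ ?_)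
    have := intervalIntegral.integral_hasDerivAt_right (a := (0 : ℝ)) (b := 1)
      (f := fun ρ => β l (ray k ρ r))
      ((hβc l).mono hsub).intervalIntegrable
      ((hβc l).stronglyMeasurableAtFilter hPo 1 h1P)
      ((hβc l).continuousAt (hPo.mem_nhds h1P))
    simpa [ray_one] using this
  have hL : HasDerivAt (fun σ => w k (ray k σ r)) (∑ m, (r m - r k) * pd m (w k) r) 1 := by
    have h1 : DifferentiableAt ℝ (w k) (ray k 1 r) := by
      rw [ray_one]; exact smooth_differentiableAt Metric.isOpen_ball (hw k) hr
    have := hasDerivAt_comp_curve h1 (hasDerivAt_ray k r 1)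
    simpa only [ray_one] using this
  -- At the point with parameter σ on the ray, rescaling the integration variable produces integrals
  -- over [0, σ] with an integrand independent of σ. Differentiation at σ = 1 then yields the claim.
  have hLR : (fun σ => w k (ray k σ r)) =ᶠ[𝓝 1]
      (fun σ => h k (r k) + ∑ l, (r l - r k) * ∫ ρ in (0 : ℝ)..σ, β l (ray k ρ r)) := by
    filter_upwards [hPo.mem_nhds h1P] with σ hσ
    rw [heq (ray k σ r) hσ k, ray_apply_self]
    congr 1
    refine Finset.sum_congr rfl fun l _ => ?_
    have h2 : ray k σ r l - r k = σ * (r l - r k) := by simp [ray]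
    have h3 := intervalIntegral.mul_integral_comp_mul_left (a := (0 : ℝ)) (b := 1)
      (f := fun ρ => β l (ray k ρ r)) σ
    rw [mul_zero, mul_one] at h3
    rw [h2, ← h3]
    have h4 : ∀ ρ, α k l (ray k ρ (ray k σ r)) * (w l (ray k ρ (ray k σ r)) -
        w k (ray k ρ (ray k σ r))) = β l (ray k (σ * ρ) r) := fun ρ => by
      rw [ray_ray, mul_comm ρ σ]
    simp only [h4]
    ring
  have := hL.unique (hR.congr_of_eventuallyEq hLR)
  have h5 : ∑ m, (r m - r k) * (pd m (w k) r - α k m r * (w m r - w k r)) =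
      ∑ m, (r m - r k) * pd m (w k) r - ∑ l, (r l - r k) * β l r := by
    rw [← Finset.sum_sub_distrib]
    exact Finset.sum_congr rfl fun m _ => by simp only [β]; ring
  rw [h5, this, sub_self]

/-- The identity for the coefficients that makes a Darboux system compatible. -/
def IsDarboux (α : Fin n → Fin n → (Fin n → ℝ) → ℝ) (u : Fin n → ℝ) : Prop :=
  ∀ k l m : Fin n, k ≠ l → k ≠ m → l ≠ m →
    pd l (α k m) u = α k m u * α m l u + α k l u * α l m u - α k m u * α k l u

/-- The compatibility computation. The Darboux identity removes all terms containing w without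
derivatives, so the cross difference of the right-hand sides is linear and homogeneous in the
defects `d`. -/
theorem darboux_cross {α : Fin n → Fin n → (Fin n → ℝ) → ℝ} {w : Fin n → (Fin n → ℝ) → ℝ}
    {u : Fin n → ℝ} (hD : IsDarboux α u)
    (hα : ∀ k l, DifferentiableAt ℝ (α k l) u) (hw : ∀ k, DifferentiableAt ℝ (w k) u)
    {d : Fin n → Fin n → ℝ} (hd : ∀ k l, d k l = pd l (w k) u - α k l u * (w l u - w k u))
    {k l m : Fin n} (hkl : k ≠ l) (hkm : k ≠ m) (hlm : l ≠ m) :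
    pd m (fun x => α k l x * (w l x - w k x)) u - pd l (fun x => α k m x * (w m x - w k x)) u =
      α k l u * (d l m - d k m) - α k m u * (d m l - d k l) := by
  rw [pd_mul (hα k l) ((hw l).fun_sub (hw k)), pd_mul (hα k m) ((hw m).fun_sub (hw k)),
    pd_sub (hw l) (hw k), pd_sub (hw m) (hw k), hD k l m hkl hkm hlm, hD k m l hkm hkl hlm.symm,
    hd, hd, hd, hd]
  ring

/-- Differentiation of `darboux_euler` transversally to the rays. -/
theorem darboux_euler_transversal {α : Fin n → Fin n → (Fin n → ℝ) → ℝ} {δ : ℝ}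
    {w : Fin n → (Fin n → ℝ) → ℝ}
    (hα : ∀ k l, ContDiffOn ℝ ∞ (α k l) (Metric.ball 0 δ))
    (hD : ∀ r ∈ Metric.ball (0 : Fin n → ℝ) δ, IsDarboux α r)
    (hw : ∀ k, ContDiffOn ℝ ∞ (w k) (Metric.ball 0 δ))
    {d : Fin n → Fin n → (Fin n → ℝ) → ℝ}
    (hd : ∀ k l u, d k l u = pd l (w k) u - α k l u * (w l u - w k u))
    (heuler : ∀ r ∈ Metric.ball (0 : Fin n → ℝ) δ, ∀ k, ∑ m, (r m - r k) * d k m r = 0)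
    {r : Fin n → ℝ} (hr : r ∈ Metric.ball 0 δ) {k l : Fin n} (hkl : k ≠ l) :
    d k l r + ∑ m, (r m - r k) * pd m (d k l) r = -∑ m, (r m - r k) *
      if m = k ∨ m = l then 0 else
        α k l r * (d l m r - d k m r) - α k m r * (d m l r - d k l r) := by
  have hO : IsOpen (Metric.ball (0 : Fin n → ℝ) δ) := Metric.isOpen_ball
  have hβ : ∀ k l, ContDiffOn ℝ ∞ (fun u => α k l u * (w l u - w k u)) (Metric.ball 0 δ) :=
    fun k l => (hα k l).mul ((hw l).sub (hw k))
  have hds : ∀ k l, ContDiffOn ℝ ∞ (d k l) (Metric.ball 0 δ) := fun k l => by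
    rw [show d k l = fun u => pd l (w k) u - α k l u * (w l u - w k u) from funext (hd k l)]
    exact (smooth_pd hO (hw k) l).sub (hβ k l)
  have hdd : ∀ k l, DifferentiableAt ℝ (d k l) r := fun k l => smooth_differentiableAt hO (hds k l) hr
  have hc : ∀ m, DifferentiableAt ℝ (fun u : Fin n → ℝ => u m) r := fun m => by fun_prop
  have h0 : pd l (fun u => ∑ m, (u m - u k) * d k m u) r = 0 := by
    rw [pd_congr (g := fun _ => 0), pd_const]
    filter_upwards [hO.mem_nhds hr] with u hu using heuler u hu k
  rw [pd_sum (fun m _ => ((hc m).fun_sub (hc k)).fun_mul (hdd k m))] at h0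
  -- In each summand the derivative in direction l of the defect with index m is exchanged for the
  -- derivative in direction m of the defect with index l. The second derivatives of w^k commute,
  -- and the error is the term from `darboux_cross`.
  have h1 : ∀ m, pd l (fun u => (u m - u k) * d k m u) r =
      (if m = l then d k l r else 0) + (r m - r k) * pd m (d k l) r + (r m - r k) *
      (if m = k ∨ m = l then 0 else
        α k l r * (d l m r - d k m r) - α k m r * (d m l r - d k l r)) := by
    intro m
    rw [pd_mul ((hc m).fun_sub (hc k)) (hdd k m), pd_sub (hc m) (hc k), pd_coord, pd_coord,
      if_neg hkl]
    by_cases hmk : m = k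
    · subst hmk; simp [hkl]
    by_cases hml : m = l
    · subst hml; simp
    rw [if_neg hml, if_neg hml, if_neg (by tauto)]
    have h2 : ∀ a b, pd a (d k b) r = pd a (pd b (w k)) r -
        pd a (fun u => α k b u * (w b u - w k u)) r := fun a b => by
      rw [← pd_sub (smooth_differentiableAt hO (smooth_pd hO (hw k) b) hr)
        (smooth_differentiableAt hO (hβ k b) hr)]
      exact pd_congr (Eventually.of_forall fun u => hd k b u)
    have h3 := darboux_cross (d := fun k l => d k l r) (hD r hr)
      (fun k l => smooth_differentiableAt hO (hα k l) hr)
      (fun k => smooth_differentiableAt hO (hw k) hr) (fun k l => hd k l r) hkl (Ne.symm hmk)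
      (Ne.symm hml)
    rw [← h3, h2, h2, pd_comm hO (hw k) hr l m]
    ring
  simp only [h1, Finset.sum_add_distrib, Finset.sum_ite_eq', Finset.mem_univ, if_true] at h0
  linarith

/-- The Cauchy problem for a compatible Darboux system with data on the diagonal. -/
theorem exists_darboux {α : Fin n → Fin n → (Fin n → ℝ) → ℝ} {h : Fin n → ℝ → ℝ}
    (hα : ∀ k l, ContDiff ℝ ∞ (α k l)) (hh : ∀ k, ContDiff ℝ ∞ (h k))
    (hD : ∀ᶠ r in 𝓝 (0 : Fin n → ℝ), IsDarboux α r) :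
    ∃ δ > 0, ∃ w : Fin n → (Fin n → ℝ) → ℝ, (∀ k, ContDiffOn ℝ ∞ (w k) (Metric.ball 0 δ)) ∧
      (∀ r ∈ Metric.ball (0 : Fin n → ℝ) δ, ∀ k l, k ≠ l →
        pd l (w k) r = α k l r * (w l r - w k r)) ∧
      ∀ s : ℝ, |s| < δ → ∀ k, w k (fun _ => s) = h k s := by
  obtain ⟨δ₀, hδ₀, W, hW, hWeq⟩ := exists_darboux_integral (n := n)
    (α := fun k l => ⟨α k l, (hα k l).continuous⟩) hα (h := fun k => ⟨h k, (hh k).continuous⟩) hh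
  obtain ⟨δ₁, hδ₁, hDb⟩ := Metric.eventually_nhds_iff_ball.1 hD
  set δ₂ := min δ₀ δ₁ with hδ₂
  have hδ₂p : 0 < δ₂ := lt_min hδ₀ hδ₁
  have hsub0 : Metric.ball (0 : Fin n → ℝ) δ₂ ⊆ Metric.ball 0 δ₀ :=
    Metric.ball_subset_ball (min_le_left _ _)
  let w : Fin n → (Fin n → ℝ) → ℝ := fun k r => W r k
  have hw : ∀ k, ContDiffOn ℝ ∞ (w k) (Metric.ball 0 δ₂) := fun k =>
    (contDiffOn_pi.1 hW k).mono hsub0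
  have hα' : ∀ k l, ContDiffOn ℝ ∞ (α k l) (Metric.ball 0 δ₂) := fun k l => (hα k l).contDiffOn
  have heq : ∀ r ∈ Metric.ball (0 : Fin n → ℝ) δ₂, ∀ k,
        w k r = h k (r k) + ∑ l, (r l - r k) * ∫ ρ in (0 : ℝ)..1,
          α k l (ray k ρ r) * (w l (ray k ρ r) - w k (ray k ρ r)) := fun r hr k =>
    hWeq r (hsub0 hr) k
  let d : Fin n → Fin n → (Fin n → ℝ) → ℝ :=
    fun k l u => pd l (w k) u - α k l u * (w l u - w k u)
  have hO : IsOpen (Metric.ball (0 : Fin n → ℝ) δ₂) := Metric.isOpen_ball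
  have hds : ∀ k l, ContDiffOn ℝ ∞ (d k l) (Metric.ball 0 δ₂) := fun k l =>
    (smooth_pd hO (hw k) l).sub ((hα' k l).mul ((hw l).sub (hw k)))
  have htr : ∀ r ∈ Metric.ball (0 : Fin n → ℝ) δ₂, ∀ k l, k ≠ l → _ := fun r hr k l hkl =>
    darboux_euler_transversal hα' (fun r hr => hDb r (Metric.ball_subset_ball (min_le_right _ _) hr))
      hw (d := d) (fun k l u => rfl) (fun r hr k => darboux_euler hα' hw heq hr k) hr hkl
  obtain ⟨C, hC⟩ : ∃ C, ∀ r ∈ Metric.closedBall (0 : Fin n → ℝ) (δ₂ / 2), ∀ k l, |α k l r| ≤ C := by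
    obtain ⟨C, hC⟩ := (isCompact_closedBall (0 : Fin n → ℝ) (δ₂ / 2)).exists_bound_of_continuousOn
      (f := fun r (k l : Fin n) => α k l r) (by
        refine Continuous.continuousOn ?_
        exact continuous_pi fun k => continuous_pi fun l => (hα k l).continuous)
    refine ⟨C, fun r hr k l => ?_⟩
    exact ((norm_le_pi_norm (fun l => α k l r) l).trans
      (norm_le_pi_norm (fun k l => α k l r) k)).trans (hC r hr)
  have hC0 : 0 ≤ |C| := abs_nonneg C
  -- With n summands of size at most 2ε · 4|C| · B, the condition 16 n ε |C| ≤ 1 makes their sum at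
  -- most B / 2.
  set ε := min (δ₂ / 2) (1 / (16 * (n + 1) * (|C| + 1))) with hε
  have hεp : 0 < ε := lt_min (by positivity) (by positivity)
  have hε2 : ε ≤ δ₂ / 2 := min_le_left _ _
  have hε3 : ε * (16 * (n + 1) * (|C| + 1)) ≤ 1 := by
    have := min_le_right (δ₂ / 2) (1 / (16 * (n + 1) * (|C| + 1)))
    rwa [← hε, le_div_iff₀ (by positivity)] at this
  have hcb : Metric.closedBall (0 : Fin n → ℝ) ε ⊆ Metric.ball 0 δ₂ :=
    Metric.closedBall_subset_ball (by linarith)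
  -- the largest defect vanishes
  let D : (Fin n → ℝ) → Fin n → Fin n → ℝ := fun r k l => if k = l then 0 else d k l r
  have hDc : ContinuousOn (fun r => ‖D r‖) (Metric.closedBall 0 ε) := by
    refine ContinuousOn.norm ?_
    refine continuousOn_pi.2 fun k => continuousOn_pi.2 fun l => ?_
    simp only [D]
    split_ifs
    · exact continuousOn_const
    · exact (hds k l).continuousOn.mono hcb
  obtain ⟨rm, hrm, hmax⟩ := (isCompact_closedBall (0 : Fin n → ℝ) ε).exists_isMaxOn
    ⟨0, Metric.mem_closedBall_self hεp.le⟩ hDc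
  set B := ‖D rm‖ with hB
  have hB0 : 0 ≤ B := norm_nonneg _
  have hdB : ∀ r ∈ Metric.closedBall (0 : Fin n → ℝ) ε, ∀ k l, k ≠ l → |d k l r| ≤ B := by
    intro r hr k l hkl
    have h1 : |D r k l| ≤ ‖D r‖ := (norm_le_pi_norm (D r k) l).trans (norm_le_pi_norm (D r) k)
    simp only [D, if_neg hkl] at h1
    exact h1.trans (hmax hr)
  have hhalf : ∀ r ∈ Metric.closedBall (0 : Fin n → ℝ) ε, ∀ k l, k ≠ l → |d k l r| ≤ B / 2 := by
    intro r hr k l hkl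
    have hray : ∀ ρ ∈ Icc (0 : ℝ) 1, ray k ρ r ∈ Metric.closedBall (0 : Fin n → ℝ) ε := by
      intro ρ hρ
      rw [mem_closedBall_zero_iff] at *
      exact (norm_ray_le k hρ.1 hρ.2 r).trans hr
    -- The function ρ ↦ ρ d(ray ρ) vanishes at 0 and equals the defect at `r` for ρ = 1. Its
    -- derivative is the left side of `htr`, hence of size at most B / 2 when all defects are at
    -- most B. This gives B ≤ B / 2.
    have hder : ∀ ρ ∈ Icc (0 : ℝ) 1, HasDerivWithinAt (fun ρ => ρ * d k l (ray k ρ r))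
        (d k l (ray k ρ r) + ∑ m, (ray k ρ r m - ray k ρ r k) * pd m (d k l) (ray k ρ r))
        (Icc 0 1) ρ := by
      intro ρ hρ
      have h1 := hasDerivAt_comp_curve
        (smooth_differentiableAt hO (hds k l) (hcb (hray ρ hρ))) (hasDerivAt_ray k r ρ)
      have h2 := (hasDerivAt_id ρ).mul h1
      refine HasDerivAt.hasDerivWithinAt ?_
      convert! h2 using 1
      simp only [id, one_mul, Finset.mul_sum]
      congr 1
      refine Finset.sum_congr rfl fun m _ => ?_
      simp only [ray]; ring
    have hbd : ∀ ρ ∈ Ico (0 : ℝ) 1,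
        ‖d k l (ray k ρ r) + ∑ m, (ray k ρ r m - ray k ρ r k) * pd m (d k l) (ray k ρ r)‖ ≤
          B / 2 := by
      intro ρ hρ
      have hρ' : ρ ∈ Icc (0 : ℝ) 1 := ⟨hρ.1, hρ.2.le⟩
      have hx := hray ρ hρ'
      set x := ray k ρ r with hxdef
      rw [htr x (hcb hx) k l hkl, norm_neg]
      have hxn : ‖x‖ ≤ ε := by simpa using hx
      have hxc : ∀ m, |x m| ≤ ε := fun m => (norm_le_pi_norm x m).trans hxn
      have hterm : ∀ m, ‖(x m - x k) * (if m = k ∨ m = l then 0 else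
          α k l x * (d l m x - d k m x) - α k m x * (d m l x - d k l x))‖ ≤
          2 * ε * (4 * |C| * B) := by
        intro m
        rw [norm_mul, Real.norm_eq_abs, Real.norm_eq_abs]
        have h1 : |x m - x k| ≤ 2 * ε := by
          have := abs_sub (x m) (x k)
          linarith [hxc m, hxc k]
        refine mul_le_mul h1 ?_ (abs_nonneg _) (by positivity)
        split_ifs with hm
        · simp; positivity
        push Not at hm
        have hxb : x ∈ Metric.closedBall (0 : Fin n → ℝ) (δ₂ / 2) :=
          Metric.closedBall_subset_closedBall hε2 hx
        have hCk : ∀ a b, |α a b x| ≤ |C| := fun a b => (hC x hxb a b).trans (le_abs_self C)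
        have e1 : |α k l x * (d l m x - d k m x)| ≤ |C| * (2 * B) := by
          rw [abs_mul]
          refine mul_le_mul (hCk k l) ?_ (abs_nonneg _) hC0
          have := abs_sub (d l m x) (d k m x)
          linarith [hdB x hx l m hm.2.symm, hdB x hx k m hm.1.symm]
        have e2 : |α k m x * (d m l x - d k l x)| ≤ |C| * (2 * B) := by
          rw [abs_mul]
          refine mul_le_mul (hCk k m) ?_ (abs_nonneg _) hC0
          have := abs_sub (d m l x) (d k l x)
          linarith [hdB x hx m l hm.2, hdB x hx k l hkl]
        have := abs_sub (α k l x * (d l m x - d k m x)) (α k m x * (d m l x - d k l x))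
        linarith
      refine (norm_sum_le _ _).trans ((Finset.sum_le_sum fun m _ => hterm m).trans ?_)
      rw [Finset.sum_const, Finset.card_univ, Fintype.card_fin, nsmul_eq_mul]
      have h16 : ε * (16 * n * |C|) ≤ 1 := by
        refine le_trans (mul_le_mul_of_nonneg_left ?_ hεp.le) hε3
        have : (0 : ℝ) ≤ n := Nat.cast_nonneg n
        nlinarith
      nlinarith
    have := norm_image_sub_le_of_norm_deriv_le_segment_01' hder hbd
    simpa [ray_one] using this
  have hBz : B = 0 := by
    have h1 : B ≤ B / 2 := by
      rw [hB, pi_norm_le_iff_of_nonneg (by positivity)]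
      intro k
      rw [pi_norm_le_iff_of_nonneg (by positivity)]
      intro l
      simp only [D]
      split_ifs with hkl
      · simp; positivity
      · exact hhalf rm hrm k l hkl
    linarith
  refine ⟨ε, hεp, w, fun k => (hw k).mono (Metric.ball_subset_closedBall.trans hcb), ?_, ?_⟩
  · intro r hr k l hkl
    have := hdB r (Metric.ball_subset_closedBall hr) k l hkl
    rw [hBz, abs_nonpos_iff] at this
    exact sub_eq_zero.1 this
  · intro s hs k
    have hmem : (fun _ => s : Fin n → ℝ) ∈ Metric.ball (0 : Fin n → ℝ) δ₂ := by
      rw [mem_ball_zero_iff, pi_norm_lt_iff hδ₂p]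
      intro _
      rw [Real.norm_eq_abs]; linarith
    rw [heq _ hmem k]
    simp

end Darboux

/-! ### Uniqueness for diagonal linear hyperbolic systems in two variables -/

theorem nonpos_of_hasDerivAt_of_le {g : ℝ → ℝ} {g' ε : ℝ} (hε : 0 < ε) (hg : HasDerivAt g g' 0)
    (hle : ∀ s ∈ Ioo 0 ε, g s ≤ g 0) : g' ≤ 0 := by
  have h1 := (hg.hasDerivWithinAt (s := Ioi 0))
  rw [hasDerivWithinAt_iff_tendsto_slope' (by simp)] at h1
  refine le_of_tendsto h1 ?_
  filter_upwards [Ioo_mem_nhdsGT hε] with s hs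
  rw [slope_def_field, sub_zero]
  exact div_nonpos_of_nonpos_of_nonneg (by linarith [hle s hs]) hs.1.le

theorem exists_norm_eq_pi_norm {n : ℕ} {v : Fin n → ℝ} (hv : 0 < ‖v‖) : ∃ k, |v k| = ‖v‖ := by
  by_contra! h
  have : ‖v‖ < ‖v‖ := by
    rw [pi_norm_lt_iff hv]
    exact fun k => lt_of_le_of_ne (norm_le_pi_norm v k) (h k)
  exact lt_irrefl _ this

/-- A maximum principle. If the weighted norm exp(-κ(t - t₀))‖R‖ had a positive maximum over a
trapezoid based on the initial line, then the component realizing the norm there could not grow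
backwards along its characteristic direction. The equation and the choice κ > |B|, with |B| bounding
the row sums of the coefficients, contradict this. -/
theorem hyperbolic_unique_forward {n : ℕ} {R : ℝ × ℝ → Fin n → ℝ} {c : Fin n → ℝ × ℝ → ℝ}
    {C : Fin n → Fin n → ℝ × ℝ → ℝ} {z₀ : ℝ × ℝ} {W : Set (ℝ × ℝ)} (hW : W ∈ 𝓝 z₀)
    (hR : ∀ z ∈ W, DifferentiableAt ℝ R z) (hc : ∀ k, ContinuousOn (c k) W)
    (hC : ∀ k l, ContinuousOn (C k l) W)
    (heq : ∀ z ∈ W, ∀ k, fderiv ℝ R z (0, 1) k - c k z * fderiv ℝ R z (1, 0) k =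
      ∑ l, C k l z * R z l)
    (h0 : ∀ z ∈ W, z.2 = z₀.2 → R z = 0) :
    ∀ᶠ z in 𝓝 z₀, z₀.2 ≤ z.2 → R z = 0 := by
  obtain ⟨δ, hδ, hδW⟩ := Metric.nhds_basis_closedBall.mem_iff.1 hW
  have hcomp : IsCompact (Metric.closedBall z₀ δ) := isCompact_closedBall _ _
  obtain ⟨Λ, hΛ⟩ := hcomp.exists_bound_of_continuousOn (f := fun z k => c k z)
    (continuousOn_pi.2 fun k => (hc k).mono hδW)
  obtain ⟨B, hB⟩ := hcomp.exists_bound_of_continuousOn (f := fun z k => ∑ l, |C k l z|)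
    (continuousOn_pi.2 fun k => continuousOn_finsetSum _ fun l _ => ((hC k l).mono hδW).abs)
  have hΛ' : ∀ z ∈ Metric.closedBall z₀ δ, ∀ k, |c k z| ≤ |Λ| := fun z hz k =>
    ((norm_le_pi_norm (fun k => c k z) k).trans (hΛ z hz)).trans (le_abs_self Λ)
  have hB' : ∀ z ∈ Metric.closedBall z₀ δ, ∀ k, ∑ l, |C k l z| ≤ |B| := fun z hz k =>
    ((le_abs_self _).trans ((norm_le_pi_norm (fun k => ∑ l, |C k l z|) k).trans (hB z hz))).trans
      (le_abs_self B)
  have hΛ0 : 0 ≤ |Λ| := abs_nonneg _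
  set η := δ / (2 * (|Λ| + 1)) with hη
  have hηp : 0 < η := by positivity
  have hηδ : (|Λ| + 1) * η = δ / 2 := by rw [hη]; field_simp
  -- The sides have slope |Λ| + 1, larger than every characteristic speed, so a backward
  -- characteristic segment from a point of `Q` stays in `Q` until it reaches the initial line.
  set Q : Set (ℝ × ℝ) := {z | z₀.2 ≤ z.2 ∧ z.2 ≤ z₀.2 + η ∧
    |z.1 - z₀.1| ≤ δ - (|Λ| + 1) * (z.2 - z₀.2)} with hQ
  have hQsub : Q ⊆ Metric.closedBall z₀ δ := by
    rintro ⟨x, t⟩ ⟨h1, h2, h3⟩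
    simp only at h1 h2 h3
    rw [Metric.mem_closedBall, Prod.dist_eq, max_le_iff, Real.dist_eq, Real.dist_eq]
    constructor
    · simp only; nlinarith
    · simp only; rw [abs_of_nonneg (by linarith)]; nlinarith
  have hQc : IsCompact Q := by
    refine hcomp.of_isClosed_subset ?_ hQsub
    refine (isClosed_le continuous_const continuous_snd).inter
      ((isClosed_le continuous_snd continuous_const).inter
      (isClosed_le (f := fun z : ℝ × ℝ => |z.1 - z₀.1|)
        (g := fun z : ℝ × ℝ => δ - (|Λ| + 1) * (z.2 - z₀.2)) (by fun_prop) (by fun_prop)))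
  set κ := |B| + 1 with hκ
  have hcont : ContinuousOn (fun z => Real.exp (-(κ * (z.2 - z₀.2))) * ‖R z‖) Q := by
    refine ContinuousOn.mul (Continuous.continuousOn (by fun_prop)) (ContinuousOn.norm ?_)
    exact fun z hz => (hR z (hδW (hQsub hz))).continuousAt.continuousWithinAt
  obtain ⟨m, hmQ, hmax⟩ := hQc.exists_isMaxOn ⟨z₀, le_rfl, by linarith, by simpa using hδ.le⟩ hcont
  have hzero : R m = 0 := by
    by_contra hne
    have hpos : 0 < ‖R m‖ := norm_pos_iff.2 hne
    obtain ⟨k, hk⟩ := exists_norm_eq_pi_norm hpos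
    have hmW : m ∈ W := hδW (hQsub hmQ)
    have hmt : z₀.2 < m.2 := lt_of_le_of_ne hmQ.1 fun h => hne (h0 m hmW h.symm)
    set γ : ℝ → ℝ × ℝ := fun s => m + s • (c k m, (-1 : ℝ)) with hγ
    have hγd : HasDerivAt γ (c k m, (-1 : ℝ)) 0 := by
      have := ((hasDerivAt_id (0 : ℝ)).smul_const (c k m, (-1 : ℝ))).const_add m
      rw [one_smul] at this
      exact this
    have hγ0 : γ 0 = m := by simp [hγ]
    have hRd : HasDerivAt (fun s => R (γ s) k)
        (c k m * fderiv ℝ R m (1, 0) k - fderiv ℝ R m (0, 1) k) 0 := by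
      have h1 := (hR m hmW).hasFDerivAt
      rw [← hγ0] at h1
      have h2 := h1.comp_hasDerivAt 0 hγd
      rw [hasDerivAt_pi] at h2
      have h3 := h2 k
      rw [hγ0] at h3
      convert! h3 using 1
      have : ((c k m, (-1 : ℝ)) : ℝ × ℝ) = c k m • (1, 0) - (0, 1) := by simp
      rw [this, map_sub, map_smul]
      simp
    -- The weight is squared together with the component, since the absolute value need not be
    -- differentiable.
    set E : ℝ → ℝ := fun s => Real.exp (-(2 * κ * (m.2 - s - z₀.2))) with hE
    have hEd : HasDerivAt E (2 * κ * E 0) 0 := by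
      have h1 : HasDerivAt (fun s : ℝ => -(2 * κ * (m.2 - s - z₀.2))) (2 * κ) 0 := by
        have := ((((hasDerivAt_id (0 : ℝ)).const_sub m.2).sub_const z₀.2).const_mul (2 * κ)).fun_neg
        simpa only [id, mul_neg, neg_neg, mul_one] using this
      have := h1.exp
      rw [mul_comm (2 * κ)]
      exact this
    have hgd := hEd.mul (hRd.pow 2)
    have hle := nonpos_of_hasDerivAt_of_le (ε := m.2 - z₀.2) (by linarith) hgd (by
      intro s hs
      have hsQ : γ s ∈ Q := by
        have hcb := hΛ' m (hQsub hmQ) k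
        obtain ⟨-, h2, h3⟩ := hmQ
        refine ⟨?_, ?_, ?_⟩
        · simp [hγ]; linarith [hs.2]
        · simp [hγ]; linarith [hs.1]
        · simp only [hγ, Prod.fst_add, Prod.snd_add, Prod.smul_mk, smul_eq_mul]
          have e1 : |m.1 + s * c k m - z₀.1| ≤ |m.1 - z₀.1| + s * |c k m| := by
            have := abs_add_le (m.1 - z₀.1) (s * c k m)
            rw [abs_mul, abs_of_pos hs.1] at this
            rwa [show m.1 + s * c k m - z₀.1 = m.1 - z₀.1 + s * c k m by ring]
          have := mul_le_mul_of_nonneg_left hcb hs.1.le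
          linarith [hs.1]
      have h1 := hmax hsQ
      simp only [mem_ofPred_eq] at h1
      have h2 : |R (γ s) k| ≤ ‖R (γ s)‖ := norm_le_pi_norm (R (γ s)) k
      have h3 : (γ s).2 = m.2 - s := by simp [hγ, sub_eq_add_neg]
      rw [h3] at h1
      have h4 : Real.exp (-(κ * (m.2 - s - z₀.2))) * |R (γ s) k| ≤
          Real.exp (-(κ * (m.2 - z₀.2))) * |R m k| := by
        rw [hk]
        exact (mul_le_mul_of_nonneg_left h2 (Real.exp_pos _).le).trans h1
      have h5 : ∀ s x, E s * x ^ 2 = (Real.exp (-(κ * (m.2 - s - z₀.2))) * |x|) ^ 2 := by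
        intro s x
        rw [mul_pow, sq_abs, ← Real.exp_nat_mul]
        simp only [hE]; congr 2; push_cast; ring
      simp only [Pi.mul_apply, Pi.pow_apply]
      rw [h5, h5, hγ0, sub_zero]
      exact pow_le_pow_left₀ (by positivity) h4 2)
    have hEp : 0 < E 0 := Real.exp_pos _
    have hS : |∑ l, C k l m * R m l| ≤ |B| * |R m k| := by
      refine (Finset.abs_sum_le_sum_abs _ _).trans ?_
      rw [hk]
      refine le_trans ?_ (mul_le_mul_of_nonneg_right (hB' m (hQsub hmQ) k) (norm_nonneg _))
      rw [Finset.sum_mul]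
      refine Finset.sum_le_sum fun l _ => ?_
      rw [abs_mul]
      exact mul_le_mul_of_nonneg_left (norm_le_pi_norm (R m) l) (abs_nonneg _)
    have heqm := heq m hmW k
    have hx : c k m * fderiv ℝ R m (1, 0) k - fderiv ℝ R m (0, 1) k = -∑ l, C k l m * R m l := by
      rw [← heqm]; ring
    simp only [hγ0, hx, Pi.pow_apply] at hle
    have hRk : 0 < |R m k| := by rw [hk]; exact hpos
    have hprod : R m k * ∑ l, C k l m * R m l ≤ |B| * R m k ^ 2 := by
      refine (le_abs_self _).trans ?_
      rw [abs_mul, ← sq_abs (R m k)]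
      nlinarith
    have hsq : 0 < R m k ^ 2 := by rw [← sq_abs]; positivity
    have : 2 * E 0 * (κ * R m k ^ 2 - R m k * ∑ l, C k l m * R m l) ≤ 0 := by
      norm_num at hle
      linarith
    have h6 : 0 < κ * R m k ^ 2 - R m k * ∑ l, C k l m * R m l := by
      rw [hκ]; nlinarith
    nlinarith
  have hall : ∀ z ∈ Q, R z = 0 := by
    intro z hz
    have h1 := hmax hz
    simp only [mem_ofPred_eq, hzero, norm_zero, mul_zero] at h1
    have h2 : ‖R z‖ ≤ 0 := nonpos_of_mul_nonpos_right h1 (Real.exp_pos _)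
    exact norm_le_zero_iff.1 h2
  filter_upwards [Metric.ball_mem_nhds z₀ (show 0 < min η (δ / 2) by positivity)] with z hz hzt
  rw [Metric.mem_ball, Prod.dist_eq, max_lt_iff, Real.dist_eq, Real.dist_eq, lt_min_iff,
    lt_min_iff] at hz
  refine hall z ⟨hzt, ?_, ?_⟩
  · linarith [le_abs_self (z.2 - z₀.2), hz.2.1]
  · have h1 : z.2 - z₀.2 ≤ η := by linarith [le_abs_self (z.2 - z₀.2), hz.2.1]
    have h2 : (|Λ| + 1) * (z.2 - z₀.2) ≤ δ / 2 := by
      rw [← hηδ]; exact mul_le_mul_of_nonneg_left h1 (by positivity)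
    linarith [hz.1.2]

/-- Zero Cauchy data on `t = t₀` force the zero solution near the point `z₀`. -/
theorem hyperbolic_unique {n : ℕ} {R : ℝ × ℝ → Fin n → ℝ} {c : Fin n → ℝ × ℝ → ℝ}
    {C : Fin n → Fin n → ℝ × ℝ → ℝ} {z₀ : ℝ × ℝ} {W : Set (ℝ × ℝ)} (hW : W ∈ 𝓝 z₀)
    (hR : ∀ z ∈ W, DifferentiableAt ℝ R z) (hc : ∀ k, ContinuousOn (c k) W)
    (hC : ∀ k l, ContinuousOn (C k l) W)
    (heq : ∀ z ∈ W, ∀ k, fderiv ℝ R z (0, 1) k - c k z * fderiv ℝ R z (1, 0) k =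
      ∑ l, C k l z * R z l)
    (h0 : ∀ z ∈ W, z.2 = z₀.2 → R z = 0) :
    ∀ᶠ z in 𝓝 z₀, R z = 0 := by
  have hfw := hyperbolic_unique_forward hW hR hc hC heq h0
  -- The reflection t ↦ 2t₀ - t reduces the past to the future; it changes the sign of the speeds
  -- and of the coefficients.
  let L : ℝ × ℝ →L[ℝ] ℝ × ℝ := (ContinuousLinearMap.fst ℝ ℝ ℝ).prod (-ContinuousLinearMap.snd ℝ ℝ ℝ)
  let σ : ℝ × ℝ → ℝ × ℝ := fun z => L z + (0, 2 * z₀.2)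
  have hσv : ∀ z, σ z = (z.1, 2 * z₀.2 - z.2) := fun z => by simp [σ, L]; ring
  have hσσ : ∀ z, σ (σ z) = z := fun z => by rw [hσv, hσv]; ext <;> simp
  have hσ0 : σ z₀ = z₀ := by rw [hσv]; ext <;> simp; ring
  have hσc : Continuous σ := by fun_prop
  have hσd : ∀ z, HasFDerivAt σ L z := fun z => L.hasFDerivAt.add_const _
  have hbw := hyperbolic_unique_forward (z₀ := z₀) (W := σ ⁻¹' W) (R := fun z => R (σ z))
    (c := fun k z => -c k (σ z)) (C := fun k l z => -C k l (σ z))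
    (hσc.continuousAt.preimage_mem_nhds (by rwa [hσ0]))
    (fun z hz => (hR _ hz).comp z (hσd z).differentiableAt)
    (fun k => ((hc k).comp hσc.continuousOn fun z hz => hz).neg)
    (fun k l => ((hC k l).comp hσc.continuousOn fun z hz => hz).neg)
    (fun z hz k => by
      have h1 : fderiv ℝ (fun z => R (σ z)) z = (fderiv ℝ R (σ z)).comp L :=
        ((hR _ hz).hasFDerivAt.comp z (hσd z)).fderiv
      have h2 := heq _ hz k
      have e1 : L (0, 1) = -(0, 1) := by simp [L]
      have e2 : L (1, 0) = (1, 0) := by simp [L]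
      rw [h1, ContinuousLinearMap.comp_apply, ContinuousLinearMap.comp_apply, e1, e2, map_neg]
      simp only [neg_mul, Finset.sum_neg_distrib, Pi.neg_apply]
      linarith)
    (fun z hz hzt => h0 _ hz (by rw [hσv]; simp only; linarith))
  have hbw' : ∀ᶠ z in 𝓝 z₀, z₀.2 ≤ (σ z).2 → R (σ (σ z)) = 0 := by
    have := hσc.tendsto z₀
    rw [hσ0] at this
    exact this.eventually hbw
  filter_upwards [hfw, hbw'] with z h1 h2
  rcases le_total z₀.2 z.2 with h | h
  · exact h1 h
  · rw [hσσ, hσv] at h2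
    exact h2 (by simp only; linarith)

variable {n : ℕ} {lam : Fin n → (Fin n → ℝ) → ℝ} {U : Set (Fin n → ℝ)}

/-! ### Commuting flows -/

theorem a_self (lam : Fin n → (Fin n → ℝ) → ℝ) (k : Fin n) (u : Fin n → ℝ) : a lam k k u = 0 := by
  simp [a]

theorem IsStrictlyHyperbolic.smooth_a (hyp : IsStrictlyHyperbolic lam U) (k l : Fin n) :
    ContDiffOn ℝ ∞ (a lam k l) U := by
  by_cases hkl : k = l
  · subst hkl
    exact contDiffOn_const.congr fun u _ => a_self lam k u
  · exact (smooth_pd hyp.isOpen (hyp.smooth k) l).div ((hyp.smooth l).sub (hyp.smooth k))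
      fun u hu => sub_ne_zero.2 (hyp.distinct l k (Ne.symm hkl) u hu)

theorem IsStrictlyHyperbolic.pd_lam (hyp : IsStrictlyHyperbolic lam U) {k l : Fin n} (hkl : k ≠ l)
    {u : Fin n → ℝ} (hu : u ∈ U) : pd l (lam k) u = a lam k l u * (lam l u - lam k u) := by
  rw [a, div_mul_cancel₀]
  exact sub_ne_zero.2 (hyp.distinct l k (Ne.symm hkl) u hu)

theorem IsStrictlyHyperbolic.isCommutingFlow_lam (hyp : IsStrictlyHyperbolic lam U) :
    IsCommutingFlow lam U lam :=
  ⟨hyp.isOpen, hyp.smooth, fun _ _ hkl _ hu => hyp.pd_lam hkl hu⟩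

theorem IsCommutingFlow.differentiableAt {μ : Fin n → (Fin n → ℝ) → ℝ}
    (h : IsCommutingFlow lam U μ) (k : Fin n) {u : Fin n → ℝ} (hu : u ∈ U) :
    DifferentiableAt ℝ (μ k) u :=
  smooth_differentiableAt h.isOpen (h.smooth k) hu

theorem IsCommutingFlow.mono {μ : Fin n → (Fin n → ℝ) → ℝ} (h : IsCommutingFlow lam U μ)
    {U' : Set (Fin n → ℝ)} (hU' : IsOpen U') (hs : U' ⊆ U) : IsCommutingFlow lam U' μ :=
  ⟨hU', fun k => (h.smooth k).mono hs, fun k l hkl u hu => h.eqn k l hkl u (hs hu)⟩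

theorem IsCommutingFlow.sub {μ ν : Fin n → (Fin n → ℝ) → ℝ} (hμ : IsCommutingFlow lam U μ)
    (hν : IsCommutingFlow lam U ν) : IsCommutingFlow lam U (fun k u => μ k u - ν k u) :=
  ⟨hμ.isOpen, fun k => (hμ.smooth k).sub (hν.smooth k), fun k l hkl u hu => by
    rw [pd_sub (hμ.differentiableAt k hu) (hν.differentiableAt k hu), hμ.eqn k l hkl u hu,
      hν.eqn k l hkl u hu]; ring⟩

theorem IsCommutingFlow.const_mul {μ : Fin n → (Fin n → ℝ) → ℝ} (hμ : IsCommutingFlow lam U μ)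
    (c : ℝ) : IsCommutingFlow lam U (fun k u => c * μ k u) :=
  ⟨hμ.isOpen, fun k => contDiffOn_const.mul (hμ.smooth k), fun k l hkl u hu => by
    rw [pd_const_mul (hμ.differentiableAt k hu), hμ.eqn k l hkl u hu]; ring⟩

theorem IsCommutingFlow.sum {ι : Type*} [Fintype ι] {μ : ι → Fin n → (Fin n → ℝ) → ℝ}
    (hU : IsOpen U) (hμ : ∀ m, IsCommutingFlow lam U (μ m)) :
    IsCommutingFlow lam U (fun k u => ∑ m, μ m k u) :=
  ⟨hU, fun k => ContDiffOn.sum fun m _ => (hμ m).smooth k, fun k l hkl u hu => by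
    rw [pd_sum fun m _ => (hμ m).differentiableAt k hu]
    simp only [(hμ _).eqn k l hkl u hu]
    rw [← Finset.mul_sum, Finset.sum_sub_distrib]⟩

/-- The characteristic speeds give the Darboux identity for the coefficients `a`. -/
theorem isDarboux_a (hyp : IsStrictlyHyperbolic lam U) (semi : IsSemihamiltonian lam U)
    {u : Fin n → ℝ} (hu : u ∈ U) : IsDarboux (a lam) u := by
  intro k l m hkl hkm hlm
  have hd : ∀ k l, DifferentiableAt ℝ (a lam k l) u := fun k l =>
    smooth_differentiableAt hyp.isOpen (hyp.smooth_a k l) hu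
  have hl : ∀ k, DifferentiableAt ℝ (lam k) u := fun k =>
    smooth_differentiableAt hyp.isOpen (hyp.smooth k) hu
  -- Both orders of the mixed derivative of λ^k are expressed through the coefficients a. The
  -- semihamiltonian property equates the two derivatives of a, and the nonzero factor λ^m - λ^l can
  -- be cancelled.
  have key : ∀ p q, k ≠ p → k ≠ q → p ≠ q → pd p (pd q (lam k)) u =
      pd p (a lam k q) u * (lam q u - lam k u) + a lam k q u *
        (a lam q p u * (lam p u - lam q u) - a lam k p u * (lam p u - lam k u)) := by
    intro p q hkp hkq hpq
    rw [pd_congr (g := fun x => a lam k q x * (lam q x - lam k x)),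
      pd_mul (hd k q) ((hl q).fun_sub (hl k)), pd_sub (hl q) (hl k), hyp.pd_lam hpq.symm hu,
      hyp.pd_lam hkp hu]
    filter_upwards [hyp.isOpen.mem_nhds hu] with x hx using hyp.pd_lam hkq hx
  have h1 := key l m hkl hkm hlm
  have h2 := key m l hkm hkl hlm.symm
  rw [pd_comm hyp.isOpen (hyp.smooth k) hu l m, h2, ← semi k l m hkl hkm hlm u hu] at h1
  have hne : lam m u - lam l u ≠ 0 := sub_ne_zero.2 (hyp.distinct m l hlm.symm u hu)
  apply mul_right_cancel₀ hne
  linear_combination -h1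

/-! ### Coordinatewise changes of variables and the Cauchy problem for commuting flows -/

theorem fderiv_comp_apply {E : Type*} [NormedAddCommGroup E] [NormedSpace ℝ E]
    {f : (Fin n → ℝ) → ℝ} {v : E → Fin n → ℝ} {y : E} (hf : DifferentiableAt ℝ f (v y))
    (hv : DifferentiableAt ℝ v y) (e : E) :
    fderiv ℝ (fun y => f (v y)) y e = ∑ l, fderiv ℝ v y e l * pd l f (v y) := by
  rw [← fderiv_eq_sum_pd]
  have : fderiv ℝ (fun y => f (v y)) y = (fderiv ℝ f (v y)).comp (fderiv ℝ v y) :=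
    (hf.hasFDerivAt.comp y hv.hasFDerivAt).fderiv
  rw [this]; rfl

/-- A coordinatewise change of variables. -/
def diagMap (γ : ℝ → Fin n → ℝ) (r : Fin n → ℝ) : Fin n → ℝ := fun k => γ (r k) k

theorem contDiff_diagMap {γ : ℝ → Fin n → ℝ} (hγ : ContDiff ℝ ∞ γ) : ContDiff ℝ ∞ (diagMap γ) := by
  refine contDiff_pi.2 fun k => ?_
  exact (contDiff_pi.1 hγ k).comp (contDiff_apply ℝ ℝ k)

theorem hasFDerivAt_comp_coord {g : ℝ → ℝ} {g' : ℝ} {r : Fin n → ℝ} {m : Fin n}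
    (hg : HasDerivAt g g' (r m)) : HasFDerivAt (fun r : Fin n → ℝ => g (r m))
      (g' • ContinuousLinearMap.proj (R := ℝ) (φ := fun _ : Fin n => ℝ) m) r :=
  hg.comp_hasFDerivAt r (hasFDerivAt_apply (𝕜 := ℝ) m r)

theorem fderiv_diagMap {γ : ℝ → Fin n → ℝ} (hγ : ContDiff ℝ ∞ γ) (r v : Fin n → ℝ) (k : Fin n) :
    fderiv ℝ (diagMap γ) r v k = v k * deriv γ (r k) k := by
  have hd : DifferentiableAt ℝ γ (r k) := hγ.differentiable (by simp) _
  have h1 : HasDerivAt (fun s => γ s k) (deriv γ (r k) k) (r k) := hasDerivAt_pi.1 hd.hasDerivAt k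
  have h2 := hasFDerivAt_comp_coord (r := r) h1
  have h3 : fderiv ℝ (diagMap γ) r v k = fderiv ℝ (fun r => diagMap γ r k) r v := by
    rw [(hasFDerivAt_pi'.1 ((contDiff_diagMap hγ).differentiable (by simp) r).hasFDerivAt k).fderiv]
    rfl
  rw [h3, show (fun r => diagMap γ r k) = fun r : Fin n → ℝ => γ (r k) k from rfl, h2.fderiv]
  simp [mul_comm]

theorem pd_comp_diagMap {γ : ℝ → Fin n → ℝ} (hγ : ContDiff ℝ ∞ γ) {f : (Fin n → ℝ) → ℝ}
    {r : Fin n → ℝ} (hf : DifferentiableAt ℝ f (diagMap γ r)) (l : Fin n) :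
    pd l (fun r => f (diagMap γ r)) r = deriv γ (r l) l * pd l f (diagMap γ r) := by
  rw [pd, fderiv_comp_apply hf ((contDiff_diagMap hγ).differentiable (by simp) r),
    Finset.sum_eq_single l]
  · rw [fderiv_diagMap hγ]; simp
  · intro m _ hm
    rw [fderiv_diagMap hγ, Pi.single_eq_of_ne hm]; simp
  · simp

/-- The Cauchy problem for commuting flows on a transversal curve. -/
theorem exists_commutingFlow (hyp : IsStrictlyHyperbolic lam U) (semi : IsSemihamiltonian lam U)
    {γ : ℝ → Fin n → ℝ} (hγ : ContDiff ℝ ∞ γ) (h0 : γ 0 ∈ U) (hγ' : ∀ k, deriv γ 0 k ≠ 0)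
    {h : Fin n → ℝ → ℝ} (hh : ∀ k, ContDiff ℝ ∞ (h k)) :
    ∃ (U' : Set (Fin n → ℝ)) (w : Fin n → (Fin n → ℝ) → ℝ), γ 0 ∈ U' ∧ U' ⊆ U ∧
      IsCommutingFlow lam U' w ∧ ∀ᶠ s in 𝓝 (0 : ℝ), ∀ k, w k (γ s) = h k s := by
  -- The map sends the diagonal to the curve `γ` and acts on each coordinate separately. The form of
  -- the system is therefore kept, and the coefficient with index l only gains the factor (γ^l)'.
  have hΓ := contDiff_diagMap hγ
  have hΓ0 : diagMap γ 0 = γ 0 := rfl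
  have hγd : ContDiff ℝ ∞ (deriv γ) := (contDiff_infty_iff_deriv.1 hγ).2
  obtain ⟨e, he0, -, hee, hes⟩ := exists_smooth_local_inverse (f := diagMap γ) isOpen_univ
    hΓ.contDiffOn (a := 0) (mem_univ _) (by
      intro v hv
      ext k
      have := congrFun hv k
      rw [fderiv_diagMap hγ] at this
      exact (mul_eq_zero.1 this).resolve_right (hγ' k))
  have hO : IsOpen (diagMap γ ⁻¹' U) := hyp.isOpen.preimage hΓ.continuous
  have hαs : ∀ k l, ContDiffOn ℝ ∞ (fun r : Fin n → ℝ => a lam k l (diagMap γ r) * deriv γ (r l) l)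
      (diagMap γ ⁻¹' U) := fun k l => by
    refine ((hyp.smooth_a k l).comp hΓ.contDiffOn fun r hr => hr).mul (ContDiff.contDiffOn ?_)
    exact (contDiff_pi.1 hγd l).comp (contDiff_apply ℝ ℝ l)
  -- Global smooth coefficients with the right germs at 0; the Darboux identity is needed only near
  -- 0.
  choose α hα hαe using fun k l => exists_contDiff_eventuallyEq hO (hαs k l) (a := 0) h0
  have hall : ∀ᶠ r in 𝓝 (0 : Fin n → ℝ), ∀ k l,
      α k l =ᶠ[𝓝 r] fun r : Fin n → ℝ => a lam k l (diagMap γ r) * deriv γ (r l) l := by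
    rw [eventually_all]; intro k
    rw [eventually_all]; intro l
    exact (hαe k l).eventually_nhds
  have hD : ∀ᶠ r in 𝓝 (0 : Fin n → ℝ), IsDarboux α r := by
    filter_upwards [hall, hO.mem_nhds h0] with r hr hrU
    intro k l m hkl hkm hlm
    have hda : DifferentiableAt ℝ (a lam k m) (diagMap γ r) :=
      smooth_differentiableAt hyp.isOpen (hyp.smooth_a k m) hrU
    have hdc : DifferentiableAt ℝ (fun r : Fin n → ℝ => deriv γ (r m) m) r :=
      ((contDiff_pi.1 hγd m).comp (contDiff_apply ℝ ℝ m)).differentiable (by simp) r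
    have hdc0 : pd l (fun r : Fin n → ℝ => deriv γ (r m) m) r = 0 := by
      have h1 : DifferentiableAt ℝ (fun s => deriv γ s m) (r m) :=
        (contDiff_pi.1 hγd m).differentiable (by simp) _
      rw [pd, (hasFDerivAt_comp_coord h1.hasDerivAt).fderiv]
      simp [hlm.symm]
    rw [pd_congr (hr k m), pd_mul (f := fun r => a lam k m (diagMap γ r))
      (hda.comp r (hΓ.differentiable (by simp) r)) hdc, hdc0,
      pd_comp_diagMap hγ hda, isDarboux_a hyp semi hrU k l m hkl hkm hlm,
      (hr k m).eq_of_nhds, (hr m l).eq_of_nhds, (hr k l).eq_of_nhds, (hr l m).eq_of_nhds]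
    ring
  obtain ⟨δ, hδ, W, hW, hWeq, hWh⟩ := exists_darboux hα hh hD
  have hne : ∀ᶠ r in 𝓝 (0 : Fin n → ℝ), ∀ l, deriv γ (r l) l ≠ 0 := by
    rw [eventually_all]; intro l
    have : Continuous fun r : Fin n → ℝ => deriv γ (r l) l :=
      ((contDiff_pi.1 hγd l).comp (contDiff_apply ℝ ℝ l)).continuous
    exact this.continuousAt.eventually_ne (hγ' l)
  have hs0 : ∀ᶠ r in 𝓝 (0 : Fin n → ℝ), r ∈ e.source := e.open_source.mem_nhds he0
  have hU0 : ∀ᶠ r in 𝓝 (0 : Fin n → ℝ), r ∈ diagMap γ ⁻¹' U := hO.mem_nhds h0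
  have hδ0 : ∀ᶠ r in 𝓝 (0 : Fin n → ℝ), r ∈ Metric.ball (0 : Fin n → ℝ) δ :=
    Metric.ball_mem_nhds _ hδ
  obtain ⟨ε, hε, hεb⟩ := Metric.eventually_nhds_iff_ball.1
    (hδ0.and (hs0.and (hU0.and (hne.and hall))))
  have hmem0 : ∀ r ∈ Metric.ball (0 : Fin n → ℝ) ε,
      diagMap γ r ∈ e.target ∩ e.symm ⁻¹' Metric.ball 0 ε := by
    intro r hr
    have hs := (hεb r hr).2.1
    rw [← hee]
    exact ⟨e.map_source hs, by rw [mem_preimage, e.left_inv hs]; exact hr⟩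
  refine ⟨e.target ∩ e.symm ⁻¹' Metric.ball 0 ε, fun k u => W k (e.symm u), ?_, ?_,
    ⟨e.isOpen_inter_preimage_symm Metric.isOpen_ball, ?_, ?_⟩, ?_⟩
  · exact hmem0 0 (Metric.mem_ball_self hε)
  · rintro u ⟨hu1, hu2⟩
    have := (hεb _ hu2).2.2.1
    rw [mem_preimage, ← hee, e.right_inv hu1] at this
    exact this
  · intro k
    exact (hW k).comp (hes.mono inter_subset_left) fun u hu => (hεb _ hu.2).1
  · rintro k l hkl u ⟨hu1, hu2⟩
    set r := e.symm u with hr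
    obtain ⟨hrδ, hrs, hrU, hrne, hrα⟩ := hεb r hu2
    have hru : diagMap γ r = u := by rw [← hee, hr, e.right_inv hu1]
    have hdw : DifferentiableAt ℝ (fun u => W k (e.symm u)) u := by
      have h1 := smooth_differentiableAt Metric.isOpen_ball (hW k) hrδ
      exact h1.comp u (smooth_differentiableAt e.open_target hes hu1)
    have h1 : W k =ᶠ[𝓝 r] fun r => W k (e.symm (diagMap γ r)) := by
      filter_upwards [e.open_source.mem_nhds hrs] with r' hr'
      rw [← hee, e.left_inv hr']
    have h2 := pd_comp_diagMap hγ (r := r) (f := fun u => W k (e.symm u)) (by rwa [hru]) l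
    rw [← pd_congr h1, hWeq r hrδ k l hkl, (hrα k l).eq_of_nhds, hru] at h2
    apply mul_left_cancel₀ (hrne l)
    rw [← h2]; ring
  · have hc : Continuous fun s : ℝ => (fun _ => s : Fin n → ℝ) := by fun_prop
    have h1 := hc.tendsto 0
    filter_upwards [h1 (e.open_source.mem_nhds he0),
      (Metric.ball_mem_nhds (0 : ℝ) hδ)] with s hs hsδ k
    have h2 : γ s = e (fun _ => s) := by rw [hee]; rfl
    rw [h2, e.left_inv hs, hWh s (by simpa using hsδ)]

/-! ### The generalized hodograph method -/

/-- A function with the hodograph representation `x + lamᵏ t = wᵏ` near `z`. -/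
def IsHodograph (lam : Fin n → (Fin n → ℝ) → ℝ) (w : Fin n → (Fin n → ℝ) → ℝ) (z : ℝ × ℝ)
    (v : ℝ × ℝ → Fin n → ℝ) : Prop :=
  ContinuousAt v z ∧ ∀ᶠ y in 𝓝 z, ∀ k, y.1 + lam k (v y) * y.2 = w k (v y)

theorem IsSolution.differentiableAt {W : Set (ℝ × ℝ)} {v : ℝ × ℝ → Fin n → ℝ}
    (hv : IsSolution lam U W v) {z : ℝ × ℝ} (hz : z ∈ W) : DifferentiableAt ℝ v z :=
  smooth_differentiableAt hv.isOpen hv.smooth hz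

/-- Every solution with nonvanishing derivatives arises by the generalized hodograph method. -/
theorem exists_hodograph (hyp : IsStrictlyHyperbolic lam U) (semi : IsSemihamiltonian lam U)
    {W : Set (ℝ × ℝ)} {v : ℝ × ℝ → Fin n → ℝ} (hv : IsSolution lam U W v) {z : ℝ × ℝ}
    (hz : z ∈ W) (hgen : ∀ k, dx v z k ≠ 0) :
    ∃ (U' : Set (Fin n → ℝ)) (w : Fin n → (Fin n → ℝ) → ℝ), v z ∈ U' ∧ U' ⊆ U ∧
      IsCommutingFlow lam U' w ∧ IsHodograph lam w z v := by
  let ι : ℝ → ℝ × ℝ := fun s => z + s • ((1 : ℝ), (0 : ℝ))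
  have hι : ContDiff ℝ ∞ ι := by fun_prop
  have hι0 : ι 0 = z := by simp [ι]
  have hιv : ∀ s, ι s = (z.1 + s, z.2) := fun s => by ext <;> simp [ι]
  have hιd : HasDerivAt ι ((1 : ℝ), (0 : ℝ)) 0 := by
    have := ((hasDerivAt_id (0 : ℝ)).smul_const ((1 : ℝ), (0 : ℝ))).const_add z
    rw [one_smul] at this
    exact this
  have hP : IsOpen (ι ⁻¹' W) := hv.isOpen.preimage hι.continuous
  have h0P : (0 : ℝ) ∈ ι ⁻¹' W := by rw [mem_preimage, hι0]; exact hz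
  have hvι : ContDiffOn ℝ ∞ (fun s => v (ι s)) (ι ⁻¹' W) :=
    hv.smooth.comp hι.contDiffOn fun s hs => hs
  obtain ⟨γ, hγ, hγe⟩ := exists_contDiff_eventuallyEq hP hvι h0P
  have hhs : ∀ k, ContDiffOn ℝ ∞ (fun s => z.1 + s + lam k (v (ι s)) * z.2) (ι ⁻¹' W) := fun k => by
    refine ContDiffOn.add (by fun_prop) (ContDiffOn.mul ?_ contDiffOn_const)
    exact (hyp.smooth k).comp hvι fun s hs => hv.mapsTo hs
  -- The data that the hodograph formula prescribes for w on the curve x ↦ v(x, t₀), where t₀ is the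
  -- value of t at `z`. Its transversality is the assumption that no v^k_x vanishes at `z`.
  choose h hh hhe using fun k => exists_contDiff_eventuallyEq hP (hhs k) h0P
  have hγ0 : γ 0 = v z := by rw [hγe.eq_of_nhds, hι0]
  have hγ' : ∀ k, deriv γ 0 k ≠ 0 := by
    intro k
    have h1 : HasDerivAt (fun s => v (ι s)) (fderiv ℝ v z (1, 0)) 0 := by
      have h2 := (hv.differentiableAt hz).hasFDerivAt
      rw [← hι0] at h2
      have := h2.comp_hasDerivAt 0 hιd
      rwa [hι0] at this
    rw [hγe.deriv_eq, h1.deriv]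
    exact hgen k
  obtain ⟨U', w, hU0, hU'U, hw, hwh⟩ := exists_commutingFlow hyp semi hγ
    (by rw [hγ0]; exact hv.mapsTo hz) hγ' hh
  rw [hγ0] at hU0
  have hvc : ContinuousAt v z := (hv.differentiableAt hz).continuousAt
  refine ⟨U', w, hU0, hU'U, hw, hvc, ?_⟩
  -- The residual of the hodograph formula. Since both λ and w are commuting flows, R^k_t - λ^k
  -- R^k_x = ∑_l A_{kl} (R^l - R^k). The residual vanishes for t = t₀, hence identically near `z`.
  let R : ℝ × ℝ → Fin n → ℝ := fun y k => y.1 + lam k (v y) * y.2 - w k (v y)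
  let A : Fin n → Fin n → ℝ × ℝ → ℝ := fun k l y =>
    a lam k l (v y) * (lam l (v y) - lam k (v y)) * fderiv ℝ v y (1, 0) l
  have hI : ∀ᶠ y in 𝓝 z, y.2 = z.2 → R y = 0 := by
    have h1 : ∀ᶠ s in 𝓝 (0 : ℝ), ∀ k, z.1 + s + lam k (v (ι s)) * z.2 = w k (v (ι s)) := by
      have h2 : ∀ᶠ s in 𝓝 (0 : ℝ), ∀ k, h k s = z.1 + s + lam k (v (ι s)) * z.2 := by
        rw [eventually_all]; exact hhe
      filter_upwards [hwh, h2, hγe] with s e1 e2 e3 k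
      rw [← e2 k, ← e1 k, e3]
    have hc : Tendsto (fun y : ℝ × ℝ => y.1 - z.1) (𝓝 z) (𝓝 0) := by
      have : Continuous fun y : ℝ × ℝ => y.1 - z.1 := by fun_prop
      simpa using this.tendsto z
    filter_upwards [hc.eventually h1] with y hy hyz
    have hιy : ι (y.1 - z.1) = y := by rw [hιv]; ext <;> simp [hyz]
    rw [hιy] at hy
    ext k
    have := hy k
    simp only [R, Pi.zero_apply, hyz]
    linarith
  have hN : {y | y ∈ W ∧ v y ∈ U' ∧ (y.2 = z.2 → R y = 0)} ∈ 𝓝 z := by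
    filter_upwards [hv.isOpen.mem_nhds hz, hvc.preimage_mem_nhds (hw.isOpen.mem_nhds hU0), hI]
      with y h1 h2 h3 using ⟨h1, h2, h3⟩
  have hlv : ∀ k, ∀ y ∈ W, DifferentiableAt ℝ (fun y => lam k (v y)) y := fun k y hy =>
    (smooth_differentiableAt hyp.isOpen (hyp.smooth k) (hv.mapsTo hy)).comp y
      (hv.differentiableAt hy)
  have hlc : ∀ k, ContinuousOn (fun y => lam k (v y)) W := fun k y hy =>
    (hlv k y hy).continuousAt.continuousWithinAt
  have hAc : ∀ k l, ContinuousOn (A k l) W := by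
    intro k l
    refine ContinuousOn.mul (ContinuousOn.mul ?_ ((hlc l).sub (hlc k))) ?_
    · exact (hyp.smooth_a k l).continuousOn.comp hv.smooth.continuousOn hv.mapsTo
    · exact (continuous_apply l).comp_continuousOn
        (smooth_fderiv_apply hv.isOpen hv.smooth _).continuousOn
  have hRkd : ∀ y ∈ W, v y ∈ U' → ∀ k, DifferentiableAt ℝ (fun y => R y k) y := by
    intro y hy hyU k
    refine DifferentiableAt.sub (DifferentiableAt.add (by fun_prop)
      ((hlv k y hy).mul (by fun_prop))) ?_
    exact (hw.differentiableAt k hyU).comp y (hv.differentiableAt hy)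
  have hmain := hyperbolic_unique (R := R) (c := fun k y => lam k (v y))
    (C := fun k l y => A k l y - if l = k then ∑ m, A k m y else 0) hN
    (fun y hy => differentiableAt_pi.2 fun k => hRkd y hy.1 hy.2.1 k)
    (fun k => (hlc k).mono fun y hy => hy.1)
    (fun k l => by
      refine ContinuousOn.sub ((hAc k l).mono fun y hy => hy.1) ?_
      split_ifs
      · exact (continuousOn_finsetSum _ fun m _ => hAc k m).mono fun y hy => hy.1
      · exact continuousOn_const)
    (fun y hy k => by
      obtain ⟨hyW, hyU, -⟩ := hy
      have hvd := hv.differentiableAt hyW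
      have hwd : DifferentiableAt ℝ (fun y => w k (v y)) y :=
        (hw.differentiableAt k hyU).comp y hvd
      have hld := hlv k y hyW
      have hcomp : ∀ e, fderiv ℝ R y e k = fderiv ℝ (fun y => R y k) y e := fun e => by
        rw [(hasFDerivAt_pi'.1 (differentiableAt_pi.2 (hRkd y hyW hyU)).hasFDerivAt k).fderiv]
        rfl
      have hRe : ∀ e : ℝ × ℝ, fderiv ℝ R y e k = e.1 +
          ((∑ l, fderiv ℝ v y e l * pd l (lam k) (v y)) * y.2 + lam k (v y) * e.2) -
          ∑ l, fderiv ℝ v y e l * pd l (w k) (v y) := by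
        intro e
        have h1 : HasFDerivAt (fun y : ℝ × ℝ => R y k) _ y :=
          ((hasFDerivAt_fst (𝕜 := ℝ) (p := y)).fun_add
            (hld.hasFDerivAt.mul (hasFDerivAt_snd (𝕜 := ℝ) (p := y)))).fun_sub hwd.hasFDerivAt
        rw [hcomp, h1.fderiv]
        simp only [sub_apply, add_apply,
          smul_apply, ContinuousLinearMap.coe_fst',
          ContinuousLinearMap.coe_snd', smul_eq_mul]
        rw [fderiv_comp_apply (hw.differentiableAt k hyU) hvd,
          fderiv_comp_apply (smooth_differentiableAt hyp.isOpen (hyp.smooth k) (hv.mapsTo hyW)) hvd]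
        ring
      have hterm : ∀ l, fderiv ℝ v y (0, 1) l * pd l (lam k) (v y) * y.2 -
          fderiv ℝ v y (0, 1) l * pd l (w k) (v y) - lam k (v y) *
          (fderiv ℝ v y (1, 0) l * pd l (lam k) (v y) * y.2 -
            fderiv ℝ v y (1, 0) l * pd l (w k) (v y)) = A k l y * (R y l - R y k) := by
        intro l
        have ht : fderiv ℝ v y (0, 1) l = lam l (v y) * fderiv ℝ v y (1, 0) l := hv.eqn y hyW l
        rw [ht]
        by_cases hkl : k = l
        · subst hkl; simp [A, a_self]; ring
        · rw [hyp.pd_lam hkl (hv.mapsTo hyW), hw.eqn k l hkl _ hyU]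
          simp only [A, R]; ring
      rw [hRe, hRe]
      simp only [sub_mul, ite_mul, zero_mul, Finset.sum_sub_distrib, Finset.sum_ite_eq',
        Finset.mem_univ, if_true]
      have hsum := Finset.sum_congr (rfl : (Finset.univ : Finset (Fin n)) = Finset.univ)
        fun l _ => hterm l
      simp only [mul_sub, mul_add, Finset.sum_sub_distrib, Finset.mul_sum, Finset.sum_mul] at hsum ⊢
      linarith)
    (fun y hy => hy.2.2)
  filter_upwards [hmain] with y hy k
  have := congrFun hy k
  simp only [R, Pi.zero_apply] at this
  linarith

/-- A family of solutions from the generalized hodograph method: the solution with the data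
`w - ∑ εₘ μₘ`, as a function of `(x, t, ε)`. -/
theorem exists_hodograph_family (hyp : IsStrictlyHyperbolic lam U) {N : ℕ}
    {U₁ : Set (Fin n → ℝ)} (hU₁ : U₁ ⊆ U) {w : Fin n → (Fin n → ℝ) → ℝ}
    (hw : IsCommutingFlow lam U₁ w) {μ : Fin N → Fin n → (Fin n → ℝ) → ℝ}
    (hμ : ∀ m, IsCommutingFlow lam U₁ (μ m)) {x₁ t₁ : ℝ} {u₁ : Fin n → ℝ} (hu₁ : u₁ ∈ U₁)
    (h₁ : ∀ k, x₁ + lam k u₁ * t₁ = w k u₁)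
    (hne : ∀ k, pd k (w k) u₁ - t₁ * pd k (lam k) u₁ ≠ 0) :
    ∃ (V : ℝ × ℝ × (Fin N → ℝ) → Fin n → ℝ) (A : Set (ℝ × ℝ × (Fin N → ℝ))), IsOpen A ∧
      (x₁, t₁, 0) ∈ A ∧ ContDiffOn ℝ ∞ V A ∧ V (x₁, t₁, 0) = u₁ ∧ MapsTo V A U₁ ∧
      (∀ y ∈ A, ∀ k, y.1 + lam k (V y) * y.2.1 + ∑ m, y.2.2 m * μ m k (V y) = w k (V y)) ∧
      (∀ y ∈ A, ∀ e k, fderiv ℝ V y e k =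
        (e.1 + e.2.1 * lam k (V y) + ∑ m, e.2.2 m * μ m k (V y)) * fderiv ℝ V y (1, 0, 0) k) ∧
      (∀ y ∈ A, ∀ k, fderiv ℝ V y (1, 0, 0) k * (pd k (w k) (V y) - y.2.1 * pd k (lam k) (V y) -
        ∑ m, y.2.2 m * pd k (μ m k) (V y)) = 1) ∧
      ∀ᶠ p in 𝓝 (((x₁, t₁, 0) : ℝ × ℝ × (Fin N → ℝ)), u₁),
        (∀ k, p.1.1 + lam k p.2 * p.1.2.1 + ∑ m, p.1.2.2 m * μ m k p.2 = w k p.2) →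
          p.2 = V p.1 := by
  have hl : IsCommutingFlow lam U₁ lam := hyp.isCommutingFlow_lam.mono hw.isOpen hU₁
  let H : (ℝ × ℝ × (Fin N → ℝ)) × (Fin n → ℝ) → Fin n → ℝ := fun p k =>
    w k p.2 - (p.1.1 + lam k p.2 * p.1.2.1 + ∑ m, p.1.2.2 m * μ m k p.2)
  set O : Set ((ℝ × ℝ × (Fin N → ℝ)) × (Fin n → ℝ)) := Prod.snd ⁻¹' U₁ with hOdef
  have hO : IsOpen O := hw.isOpen.preimage continuous_snd
  have hsnd : ContDiffOn ℝ ∞ (Prod.snd : (ℝ × ℝ × (Fin N → ℝ)) × (Fin n → ℝ) → Fin n → ℝ) O :=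
    contDiffOn_snd
  have hH : ContDiffOn ℝ ∞ H O := by
    refine contDiffOn_pi.2 fun k => ?_
    have c1 : ∀ {f : (Fin n → ℝ) → ℝ}, ContDiffOn ℝ ∞ f U₁ →
        ContDiffOn ℝ ∞ (fun p : (ℝ × ℝ × (Fin N → ℝ)) × (Fin n → ℝ) => f p.2) O :=
      fun hf => hf.comp hsnd fun p hp => hp
    refine (c1 (hw.smooth k)).sub (ContDiffOn.add (ContDiffOn.add (by fun_prop)
      ((c1 (hl.smooth k)).mul (by fun_prop))) (ContDiffOn.sum fun m _ => ?_))
    exact ContDiffOn.mul (by fun_prop) (c1 ((hμ m).smooth k))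
  -- the derivative of `H`
  have hder : ∀ p ∈ O, ∀ e v k, fderiv ℝ H p (e, v) k =
      (∑ l, v l * (pd l (w k) p.2 - p.1.2.1 * pd l (lam k) p.2 - ∑ m, p.1.2.2 m * pd l (μ m k) p.2))
      - (e.1 + e.2.1 * lam k p.2 + ∑ m, e.2.2 m * μ m k p.2) := by
    intro p hp e v k
    have hHd := smooth_differentiableAt hO hH hp
    have c2 : ∀ {f : (Fin n → ℝ) → ℝ}, DifferentiableAt ℝ f p.2 →
        HasFDerivAt (fun p : (ℝ × ℝ × (Fin N → ℝ)) × (Fin n → ℝ) => f p.2)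
          ((fderiv ℝ f p.2).comp (ContinuousLinearMap.snd ℝ _ _)) p := fun hf =>
      hf.hasFDerivAt.comp p hasFDerivAt_snd
    let T : (ℝ × ℝ × (Fin N → ℝ)) × (Fin n → ℝ) →L[ℝ] ℝ × ℝ × (Fin N → ℝ) :=
      ContinuousLinearMap.fst ℝ _ _
    have hX : HasFDerivAt (fun p : (ℝ × ℝ × (Fin N → ℝ)) × (Fin n → ℝ) => p.1.1)
      ((ContinuousLinearMap.fst ℝ _ _).comp T) p := ((ContinuousLinearMap.fst ℝ _ _).comp T).hasFDerivAt
    have hT : HasFDerivAt (fun p : (ℝ × ℝ × (Fin N → ℝ)) × (Fin n → ℝ) => p.1.2.1)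
      ((ContinuousLinearMap.fst ℝ _ _).comp ((ContinuousLinearMap.snd ℝ _ _).comp T)) p :=
      ((ContinuousLinearMap.fst ℝ _ _).comp ((ContinuousLinearMap.snd ℝ _ _).comp T)).hasFDerivAt
    have hE : ∀ m, HasFDerivAt (fun p : (ℝ × ℝ × (Fin N → ℝ)) × (Fin n → ℝ) => p.1.2.2 m)
      ((ContinuousLinearMap.proj (R := ℝ) (φ := fun _ : Fin N => ℝ) m).comp
        ((ContinuousLinearMap.snd ℝ _ _).comp ((ContinuousLinearMap.snd ℝ _ _).comp T))) p :=
      fun m => ((ContinuousLinearMap.proj (R := ℝ) (φ := fun _ : Fin N => ℝ) m).comp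
        ((ContinuousLinearMap.snd ℝ _ _).comp
          ((ContinuousLinearMap.snd ℝ _ _).comp T))).hasFDerivAt
    have hk : HasFDerivAt (fun p => H p k) _ p := (c2 (hw.differentiableAt k hp)).fun_sub
      ((hX.fun_add ((c2 (hl.differentiableAt k hp)).mul hT)).fun_add
        (HasFDerivAt.fun_sum (u := Finset.univ) fun m _ =>
          (hE m).mul (c2 ((hμ m).differentiableAt k hp))))
    have h1 : fderiv ℝ H p (e, v) k = fderiv ℝ (fun p => H p k) p (e, v) := by
      rw [(hasFDerivAt_pi'.1 hHd.hasFDerivAt k).fderiv]; rfl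
    rw [h1, hk.fderiv]
    simp only [T, sub_apply, add_apply,
      smul_apply, ContinuousLinearMap.comp_apply, ContinuousLinearMap.coe_fst',
      ContinuousLinearMap.coe_snd', ContinuousLinearMap.proj_apply, sum_apply, smul_eq_mul,
      fderiv_eq_sum_pd]
    simp only [mul_sub, Finset.sum_sub_distrib, Finset.sum_add_distrib, Finset.mul_sum]
    rw [Finset.sum_comm (f := fun (l : Fin n) (m : Fin N) => v l * (p.1.2.2 m * pd l (μ m k) p.2))]
    have e1 : ∀ m l, p.1.2.2 m * (v l * pd l (μ m k) p.2) = v l * (p.1.2.2 m * pd l (μ m k) p.2) :=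
      fun m l => by ring
    have e2 : ∀ l, p.1.2.1 * (v l * pd l (lam k) p.2) = v l * (p.1.2.1 * pd l (lam k) p.2) :=
      fun l => by ring
    simp only [e1, e2, mul_comm (lam k p.2), mul_comm (μ _ k p.2)]
    ring
  -- on the zero set the matrix is diagonal
  have hdiag : ∀ p ∈ O, H p = 0 → ∀ (v : Fin n → ℝ) (k : Fin n), ∑ l, v l * (pd l (w k) p.2 - p.1.2.1 * pd l (lam k) p.2 -
      ∑ m, p.1.2.2 m * pd l (μ m k) p.2) = v k * (pd k (w k) p.2 - p.1.2.1 * pd k (lam k) p.2 -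
      ∑ m, p.1.2.2 m * pd k (μ m k) p.2) := by
    intro p hp hp0 v k
    refine Finset.sum_eq_single k (fun l _ hlk => ?_) (by simp)
    have e1 : ∀ m, p.1.2.2 m * pd l (μ m k) p.2 = a lam k l p.2 * (p.1.2.2 m * μ m l p.2) -
        a lam k l p.2 * (p.1.2.2 m * μ m k p.2) := fun m => by
      rw [(hμ m).eqn k l hlk.symm _ hp]; ring
    rw [hw.eqn k l hlk.symm _ hp, hl.eqn k l hlk.symm _ hp]
    simp only [e1, Finset.sum_sub_distrib, ← Finset.mul_sum]
    have h1 := congrFun hp0 k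
    have h2 := congrFun hp0 l
    simp only [H, Pi.zero_apply] at h1 h2
    linear_combination (v l * a lam k l p.2) * (h2 - h1)
  have h0O : (((x₁, t₁, 0) : ℝ × ℝ × (Fin N → ℝ)), u₁) ∈ O := hu₁
  have hH0 : H ((x₁, t₁, 0), u₁) = 0 := by
    ext k
    have := h₁ k
    simp only [H, Pi.zero_apply, zero_mul, Finset.sum_const_zero, add_zero]
    linarith
  obtain ⟨V, A, hA, h1A, hV, hV1, hVz, huniq⟩ := exists_smooth_implicit hO hH h0O hH0 (by
    intro v hv
    ext k
    have h1 := congrFun hv k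
    rw [hder _ h0O, hdiag _ h0O hH0] at h1
    simp only [Prod.fst_zero, Prod.snd_zero, Pi.zero_apply, zero_mul, Finset.sum_const_zero,
      add_zero, sub_zero] at h1
    exact (mul_eq_zero.1 h1).resolve_right (hne k))
  -- Differentiation of the implicit equation. As the matrix is diagonal, every derivative of V^k is
  -- a multiple of its x-derivative, with factor λ^k in t and μ_m^k in ε_m. Thus V solves the system
  -- and all the flows simultaneously.
  have hVder : ∀ y ∈ A, ∀ e k, fderiv ℝ V y e k * (pd k (w k) (V y) - y.2.1 * pd k (lam k) (V y) -
      ∑ m, y.2.2 m * pd k (μ m k) (V y)) =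
      e.1 + e.2.1 * lam k (V y) + ∑ m, e.2.2 m * μ m k (V y) := by
    intro y hy e k
    have hVd := smooth_differentiableAt hA hV hy
    have hHd := smooth_differentiableAt hO hH (hVz y hy).1
    have h1 : HasFDerivAt (fun y => H (y, V y)) _ y :=
      HasFDerivAt.comp (g := H) (f := fun y => (y, V y)) y hHd.hasFDerivAt ((hasFDerivAt_id y).prodMk hVd.hasFDerivAt)
    have h2 : HasFDerivAt (fun y => H (y, V y)) (0 : _ →L[ℝ] Fin n → ℝ) y := by
      refine (hasFDerivAt_const (0 : Fin n → ℝ) y).congr_of_eventuallyEq ?_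
      filter_upwards [hA.mem_nhds hy] with y' hy' using (hVz y' hy').2
    have h3 := congrFun (congrArg (fun L => L e) (h1.unique h2)) k
    simp only [ContinuousLinearMap.comp_apply, ContinuousLinearMap.prod_apply] at h3
    rw [hder _ (hVz y hy).1, hdiag _ (hVz y hy).1 (hVz y hy).2] at h3
    simp only [ContinuousLinearMap.id_apply, zero_apply, Pi.zero_apply] at h3
    linarith
  have hVx : ∀ y ∈ A, ∀ k, fderiv ℝ V y (1, 0, 0) k * (pd k (w k) (V y) -
      y.2.1 * pd k (lam k) (V y) - ∑ m, y.2.2 m * pd k (μ m k) (V y)) = 1 := by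
    intro y hy k
    rw [hVder y hy]
    simp
  refine ⟨V, A, hA, h1A, hV, hV1, fun y hy => (hVz y hy).1, ?_, ?_, hVx, ?_⟩
  · intro y hy k
    have := congrFun (hVz y hy).2 k
    simp only [H, Pi.zero_apply] at this
    linarith
  · intro y hy e k
    have h1 := hVder y hy e k
    have h2 := hVx y hy k
    rw [← h1]
    linear_combination -(fderiv ℝ V y e k) * h2
  · filter_upwards [huniq] with p hp hpk
    apply hp
    ext k
    simp only [H, Pi.zero_apply]
    linarith [hpk k]

/-! ### The structure of an extra Riemann invariant of order one -/

theorem eq_of_fderiv_apply_eq_zero {E : Type*} [NormedAddCommGroup E] [NormedSpace ℝ E]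
    {f : E → ℝ} {s : Set E} (hs : Convex ℝ s) (hf : ∀ x ∈ s, DifferentiableAt ℝ f x) {x y : E}
    (hx : x ∈ s) (hy : y ∈ s) (h : ∀ z ∈ s, fderiv ℝ f z (y - x) = 0) : f y = f x := by
  have hmem : ∀ σ ∈ Icc (0 : ℝ) 1, x + σ • (y - x) ∈ s := fun σ hσ =>
    hs.add_smul_sub_mem hx hy hσ
  have hd : ∀ σ ∈ Icc (0 : ℝ) 1, HasDerivAt (fun σ : ℝ => f (x + σ • (y - x))) 0 σ := by
    intro σ hσ
    have h1 : HasDerivAt (fun σ : ℝ => x + σ • (y - x)) (y - x) σ := by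
      have := ((hasDerivAt_id σ).smul_const (y - x)).const_add x
      rw [one_smul] at this
      exact this
    have h2 := (hf _ (hmem σ hσ)).hasFDerivAt.comp_hasDerivAt σ h1
    rwa [h _ (hmem σ hσ)] at h2
  have := constant_of_has_deriv_right_zero (f := fun σ : ℝ => f (x + σ • (y - x)))
    (a := 0) (b := 1) (fun σ hσ => (hd σ hσ).continuousAt.continuousWithinAt)
    (fun σ hσ => (hd σ ⟨hσ.1, hσ.2.le⟩).hasDerivWithinAt) 1 (by simp)
  simpa using this

/-- Vectors along u_x with zero i-th component belong to the Monge distribution, so on convex sets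
the invariant sees only the derivative u^i_x. -/
theorem IsRiemannInvariant.eq_of_mem_convex {i : Fin n} {Ω : Set (Jet n)} {J : Jet n → ℝ}
    (hJ : IsRiemannInvariant lam U i Ω J) {s : Set (Jet n)} (hs : Convex ℝ s) (hsΩ : s ⊆ Ω)
    {q q' : Jet n} (hq : q ∈ s) (hq' : q' ∈ s) (h1 : q.1 = q'.1) (h2 : q.2.1 = q'.2.1)
    (h3 : q.2.2.1 = q'.2.2.1) (h4 : q.2.2.2 i = q'.2.2.2 i) : J q' = J q := by
  refine eq_of_fderiv_apply_eq_zero hs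
    (fun x hx => smooth_differentiableAt hJ.isOpen hJ.smooth (hsΩ hx)) hq hq' fun z hz => ?_
  refine hJ.firstIntegral z (hsΩ hz) _ ⟨?_, ?_, fun k _ => ?_, ?_⟩ <;> simp [h1, h2, h3, h4]

/-- The coordinates `(x, t, u)` and `u_x` joined to a point of the jet space. -/
def mkJet (y : ℝ × ℝ × (Fin n → ℝ)) (p : Fin n → ℝ) : Jet n := (y.1, y.2.1, y.2.2, p)

/-- The coordinates `(x, t, u)` of a point of the jet space. -/
def baseJet (q : Jet n) : ℝ × ℝ × (Fin n → ℝ) := (q.1, q.2.1, q.2.2.1)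

theorem contDiff_mkJet : ContDiff ℝ ∞
    (fun y : (ℝ × ℝ × (Fin n → ℝ)) × (Fin n → ℝ) => mkJet y.1 y.2) := by
  unfold mkJet; fun_prop

theorem hasFDerivAt_mkJet {E : Type*} [NormedAddCommGroup E] [NormedSpace ℝ E]
    {f : E → ℝ × ℝ × (Fin n → ℝ)} {g : E → Fin n → ℝ} {f' g'} {x : E} (hf : HasFDerivAt f f' x)
    (hg : HasFDerivAt g g' x) : HasFDerivAt (fun x => mkJet (f x) (g x))
      ((((ContinuousLinearMap.fst ℝ _ _).comp f')).prod
        ((((ContinuousLinearMap.fst ℝ _ _).comp ((ContinuousLinearMap.snd ℝ _ _).comp f'))).prod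
        ((((ContinuousLinearMap.snd ℝ _ _).comp ((ContinuousLinearMap.snd ℝ _ _).comp f'))).prod
          g'))) x :=
  hf.fst.prodMk (hf.snd.fst.prodMk (hf.snd.snd.prodMk hg))

/-- The directions of the coordinates of `(x, t, u)`. -/
theorem fderiv_apply_base (L : ℝ × ℝ × (Fin n → ℝ) →L[ℝ] ℝ) (e : ℝ × ℝ × (Fin n → ℝ)) :
    L e = e.1 * L (1, 0, 0) + e.2.1 * L (0, 1, 0) + ∑ k, e.2.2 k * L (0, 0, Pi.single k 1) := by
  have h1 : e = e.1 • ((1, 0, 0) : ℝ × ℝ × (Fin n → ℝ)) + e.2.1 • (0, 1, 0) + (0, 0, e.2.2) := by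
    ext <;> simp
  have h2 := fderiv_apply_eq_sum (L.comp ((ContinuousLinearMap.inr ℝ ℝ _).comp
    (ContinuousLinearMap.inr ℝ ℝ (Fin n → ℝ)))) e.2.2
  simp only [ContinuousLinearMap.comp_apply, ContinuousLinearMap.inr_apply, smul_eq_mul] at h2
  conv_lhs => rw [h1]
  rw [map_add, map_add, map_smul, map_smul, h2]
  simp

/-- Solving a relation `J = φ(uⁱ)` for `uⁱ_x`. -/
theorem exists_solve_relation {i : Fin n} {Ω : Set (Jet n)} {J : Jet n → ℝ}
    (hJ : IsExtraRiemannInvariantOfOrderOne lam U i Ω J) {q₁ : Jet n} (hq₁ : q₁ ∈ Ω)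
    {φ : ℝ → ℝ} {S : Set ℝ} (hS : IsOpen S) (hφ : ContDiffOn ℝ ∞ φ S) (hqS : q₁.2.2.1 i ∈ S)
    (hJφ : J q₁ = φ (q₁.2.2.1 i)) :
    ∃ (Θ : ℝ × ℝ × (Fin n → ℝ) → ℝ) (A : Set (ℝ × ℝ × (Fin n → ℝ))) (r : ℝ), 0 < r ∧ IsOpen A ∧
      baseJet q₁ ∈ A ∧ ContDiffOn ℝ ∞ Θ A ∧ Θ (baseJet q₁) = q₁.2.2.2 i ∧
      (∀ᶠ q in 𝓝 q₁, J q = φ (q.2.2.1 i) ↔ q.2.2.2 i = Θ (baseJet q)) ∧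
      ∀ y ∈ A, y.2.2 ∈ U ∧ ∀ p ∈ Metric.ball q₁.2.2.2 r, p i = Θ y →
        mkJet y p ∈ Ω ∧ ∀ e : ℝ × ℝ × (Fin n → ℝ), e.2.2 i = 0 →
        fderiv ℝ J (mkJet y p) (mkJet e (fderiv ℝ Θ y e • Pi.single i 1)) = 0 := by
  obtain ⟨ρ, hρ, hρΩ⟩ := Metric.isOpen_iff.1 hJ.1.isOpen q₁ hq₁
  set y₁ := baseJet q₁ with hy₁
  set p₁ := q₁.2.2.2 with hp₁
  have hq₁e : mkJet y₁ p₁ = q₁ := rfl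
  have hJd : ∀ q ∈ Ω, DifferentiableAt ℝ J q := fun q hq =>
    smooth_differentiableAt hJ.1.isOpen hJ.1.smooth hq
  -- the set where everything takes place
  let upd : ℝ → Fin n → ℝ := fun s => p₁ + (s - p₁ i) • Pi.single i 1
  have hupd_i : ∀ s, upd s i = s := fun s => by simp [upd]
  have hupd1 : upd (p₁ i) = p₁ := by simp [upd]
  have hupd : ContDiff ℝ ∞ upd := by fun_prop
  -- All derivatives except the i-th are frozen at their values in `q₁`; near `q₁` the value of `J`
  -- does not depend on them.
  let Φ : (ℝ × ℝ × (Fin n → ℝ)) × ℝ → Jet n := fun z => mkJet z.1 (upd z.2)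
  have hΦ : ContDiff ℝ ∞ Φ := contDiff_mkJet.comp (contDiff_fst.prodMk (hupd.comp contDiff_snd))
  have hΦ1 : Φ (y₁, p₁ i) = q₁ := by simp only [Φ, hupd1]; exact hq₁e
  have hui : Continuous fun z : (ℝ × ℝ × (Fin n → ℝ)) × ℝ => z.1.2.2 i := by fun_prop
  let O : Set ((ℝ × ℝ × (Fin n → ℝ)) × ℝ) := Φ ⁻¹' Metric.ball q₁ ρ ∩ (fun z => z.1.2.2 i) ⁻¹' S
  have hO : IsOpen O := (Metric.isOpen_ball.preimage hΦ.continuous).inter (hS.preimage hui)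
  have h1O : (y₁, p₁ i) ∈ O := ⟨by rw [mem_preimage, hΦ1]; exact Metric.mem_ball_self hρ, hqS⟩
  let H : (ℝ × ℝ × (Fin n → ℝ)) × ℝ → ℝ := fun z => J (Φ z) - φ (z.1.2.2 i)
  have hH : ContDiffOn ℝ ∞ H O := by
    refine ContDiffOn.sub (hJ.1.smooth.comp hΦ.contDiffOn fun z hz => hρΩ hz.1) ?_
    exact hφ.comp (ContDiff.contDiffOn (by fun_prop)) fun z hz => hz.2
  have hH1 : H (y₁, p₁ i) = 0 := by simp only [H, hΦ1]; rw [hJφ]; exact sub_self _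
  obtain ⟨Θ, A, hA, h1A, hΘ, hΘ1, hΘz, huniq⟩ := exists_smooth_implicit hO hH h1O hH1 (by
    intro v hv
    have hφd : DifferentiableAt ℝ φ ((y₁, p₁ i).1.2.2 i) := smooth_differentiableAt hS hφ hqS
    have hud : HasDerivAt upd (Pi.single i 1) (p₁ i) := by
      have := (((hasDerivAt_id (p₁ i)).sub_const (p₁ i)).smul_const
        (Pi.single i 1 : Fin n → ℝ)).const_add p₁
      rw [one_smul] at this
      exact this
    have h1 : HasDerivAt (fun s => Φ (y₁, s)) (mkJet 0 (Pi.single i 1)) (p₁ i) :=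
      (hasDerivAt_const _ _).prodMk ((hasDerivAt_const _ _).prodMk
        ((hasDerivAt_const _ _).prodMk hud))
    have h2 : HasDerivAt (fun s => H (y₁, s)) (fderiv ℝ J q₁ (mkJet 0 (Pi.single i 1))) (p₁ i) := by
      have h3 := hJd q₁ hq₁
      rw [← hΦ1] at h3
      have := (h3.hasFDerivAt.comp_hasDerivAt (p₁ i) h1).sub_const (φ (y₁.2.2 i))
      rw [hΦ1] at this
      exact this
    have h4 : HasDerivAt (fun s : ℝ => (y₁, s)) (0, 1) (p₁ i) :=
      (hasDerivAt_const _ _).prodMk (hasDerivAt_id _)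
    have h5 := ((smooth_differentiableAt hO hH h1O).hasFDerivAt.comp_hasDerivAt (p₁ i) h4).unique h2
    have h6 : fderiv ℝ H (y₁, p₁ i) (0, v) = v * fderiv ℝ H (y₁, p₁ i) (0, 1) := by
      rw [show ((0, v) : (ℝ × ℝ × (Fin n → ℝ)) × ℝ) = v • (0, 1) by simp, map_smul, smul_eq_mul]
    rw [h6, h5] at hv
    exact (mul_eq_zero.1 hv).resolve_right (hJ.2 q₁ hq₁))
  have hconv : Convex ℝ (Metric.ball q₁ ρ) := convex_ball _ _
  have hball : ∀ y p, mkJet y p ∈ Metric.ball q₁ ρ ↔ y ∈ Metric.ball y₁ ρ ∧ p ∈ Metric.ball p₁ ρ := by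
    intro y p
    simp only [Metric.mem_ball, Prod.dist_eq, mkJet, max_lt_iff, hy₁, baseJet, hp₁]
    tauto
  have hJeq : ∀ y p p', mkJet y p ∈ Metric.ball q₁ ρ → mkJet y p' ∈ Metric.ball q₁ ρ → p i = p' i →
      J (mkJet y p') = J (mkJet y p) := fun y p p' h h' hpp =>
    hJ.1.eq_of_mem_convex hconv hρΩ h h' rfl rfl rfl hpp
  have hbc : Continuous fun q : Jet n => (baseJet q, q.2.2.2 i) := by unfold baseJet; fun_prop
  refine ⟨Θ, A ∩ Metric.ball y₁ ρ, ρ, hρ, hA.inter Metric.isOpen_ball,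
    ⟨h1A, Metric.mem_ball_self hρ⟩, hΘ.mono inter_subset_left, hΘ1, ?_, ?_⟩
  · have h1 := hbc.tendsto q₁
    have h1' : Tendsto (fun q : Jet n => (baseJet q, q.2.2.2 i)) (𝓝 q₁) (𝓝 (y₁, p₁ i)) := h1
    filter_upwards [h1'.eventually huniq, h1' (hO.mem_nhds h1O), Metric.ball_mem_nhds q₁ hρ,
      (continuous_fst.continuousAt.preimage_mem_nhds
        (hA.mem_nhds h1A) : Prod.fst ⁻¹' A ∈ 𝓝 (y₁, p₁ i)) |> (h1' ·)] with q hu hqO hqb hqA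
    have e1 : J (Φ (baseJet q, q.2.2.2 i)) = J q :=
      hJeq (baseJet q) q.2.2.2 _ hqb hqO.1 (hupd_i _).symm
    constructor
    · intro h
      apply hu
      simp only [H, e1, h]
      exact sub_self _
    · intro h
      have h2 := (hΘz _ hqA).2
      simp only [H] at h2
      rw [← h, e1] at h2
      exact sub_eq_zero.1 h2
  · rintro y ⟨hyA, hyb⟩
    have hyΩ : mkJet y p₁ ∈ Ω := hρΩ ((hball _ _).2 ⟨hyb, Metric.mem_ball_self hρ⟩)
    refine ⟨hJ.1.base _ hyΩ, fun p hp hpi => ?_⟩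
    have hqb : mkJet y p ∈ Metric.ball q₁ ρ := (hball _ _).2 ⟨hyb, hp⟩
    refine ⟨hρΩ hqb, fun e he => ?_⟩
    have hΘd : DifferentiableAt ℝ Θ y := smooth_differentiableAt hA hΘ hyA
    -- the curve in the level set
    let g : ℝ × ℝ × (Fin n → ℝ) → Fin n → ℝ := fun y' => p + (Θ y' - Θ y) • Pi.single i 1
    have hg : HasFDerivAt g ((fderiv ℝ Θ y).smulRight (Pi.single i 1 : Fin n → ℝ)) y :=
      ((hΘd.hasFDerivAt.sub_const (Θ y)).smul_const (Pi.single i 1 : Fin n → ℝ)).const_add p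
    have hgy : g y = p := by simp [g]
    have hΨ := hasFDerivAt_mkJet (hasFDerivAt_id y) hg
    have h2 := (hJd _ (hρΩ hqb)).hasFDerivAt
    rw [← hgy] at h2
    have h1 := HasFDerivAt.comp (g := J) (f := fun y' => mkJet y' (g y')) y h2 hΨ
    have hyS : y.2.2 i ∈ S := (hΘz y hyA).1.2
    have h3 : ∃ L : ℝ × ℝ × (Fin n → ℝ) →L[ℝ] ℝ, L e = 0 ∧
        HasFDerivAt (fun y' : ℝ × ℝ × (Fin n → ℝ) => φ (y'.2.2 i)) L y := by
      have h4 : HasFDerivAt (fun y' : ℝ × ℝ × (Fin n → ℝ) => y'.2.2 i)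
        ((ContinuousLinearMap.proj (R := ℝ) (φ := fun _ : Fin n => ℝ) i).comp
          ((ContinuousLinearMap.snd ℝ ℝ (Fin n → ℝ)).comp
            (ContinuousLinearMap.snd ℝ ℝ (ℝ × (Fin n → ℝ))))) y :=
        ((ContinuousLinearMap.proj (R := ℝ) (φ := fun _ : Fin n => ℝ) i).comp
          ((ContinuousLinearMap.snd ℝ ℝ (Fin n → ℝ)).comp
            (ContinuousLinearMap.snd ℝ ℝ (ℝ × (Fin n → ℝ))))).hasFDerivAt
      exact ⟨_, by simp [he], (smooth_differentiableAt hS hφ hyS).hasDerivAt.comp_hasFDerivAt y h4⟩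
    obtain ⟨L, hL0, hL⟩ := h3
    have h5 : (fun y' => J (mkJet y' (g y'))) =ᶠ[𝓝 y] fun y' => φ (y'.2.2 i) := by
      have hc : ContinuousAt (fun y' => mkJet y' (g y')) y := hΨ.continuousAt
      have hnear : ∀ᶠ y' in 𝓝 y, mkJet y' (g y') ∈ Metric.ball q₁ ρ := by
        refine hc.preimage_mem_nhds (Metric.isOpen_ball.mem_nhds ?_)
        rw [hgy]; exact hqb
      filter_upwards [hnear, hA.mem_nhds hyA] with y' hy' hy'A
      obtain ⟨hz1, hz2⟩ := hΘz y' hy'A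
      have e1 : J (Φ (y', Θ y')) = J (mkJet y' (g y')) :=
        hJeq y' _ _ hy' hz1.1 (by rw [hupd_i]; simp [g, hpi])
      simp only [H, e1] at hz2
      exact sub_eq_zero.1 hz2
    have h6 := congrArg (fun L => L e) (h1.unique (hL.congr_of_eventuallyEq h5))
    simp only [ContinuousLinearMap.comp_apply, ContinuousLinearMap.prod_apply,
      ContinuousLinearMap.coe_snd', ContinuousLinearMap.coe_fst',
      ContinuousLinearMap.id_apply, ContinuousLinearMap.smulRight_apply, hL0, hgy] at h6
    exact h6

/-- The system satisfied by `θ(x, t, u) = 1 / uⁱ_x` on a level of an extra Riemann invariant. -/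
structure IsTheta (lam : Fin n → (Fin n → ℝ) → ℝ) (U : Set (Fin n → ℝ)) (i j : Fin n)
    (A : Set (ℝ × ℝ × (Fin n → ℝ))) (θ : ℝ × ℝ × (Fin n → ℝ) → ℝ) : Prop where
  isOpen : IsOpen A
  smooth : ContDiffOn ℝ ∞ θ A
  base : ∀ y ∈ A, y.2.2 ∈ U
  ne_zero : ∀ y ∈ A, θ y ≠ 0
  dx : ∀ y ∈ A, fderiv ℝ θ y (1, 0, 0) = b lam i j y.2.2
  dt : ∀ y ∈ A, fderiv ℝ θ y (0, 1, 0) = lam i y.2.2 * b lam i j y.2.2 - pd i (lam i) y.2.2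
  du : ∀ y ∈ A, ∀ k, k ≠ i → fderiv ℝ θ y (0, 0, Pi.single k 1) = -(a lam i k y.2.2) * θ y

theorem fderiv_comp_snd_snd {f : (Fin n → ℝ) → ℝ} {y : ℝ × ℝ × (Fin n → ℝ)}
    (hf : DifferentiableAt ℝ f y.2.2) : HasFDerivAt (fun y : ℝ × ℝ × (Fin n → ℝ) => f y.2.2)
      ((fderiv ℝ f y.2.2).comp ((ContinuousLinearMap.snd ℝ ℝ (Fin n → ℝ)).comp
            (ContinuousLinearMap.snd ℝ ℝ (ℝ × (Fin n → ℝ))))) y :=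
  HasFDerivAt.comp (g := f) (f := fun y : ℝ × ℝ × (Fin n → ℝ) => y.2.2) y hf.hasFDerivAt
    ((ContinuousLinearMap.snd ℝ ℝ (Fin n → ℝ)).comp
            (ContinuousLinearMap.snd ℝ ℝ (ℝ × (Fin n → ℝ)))).hasFDerivAt

/-- The commutator of the equations for `θ` along `uᵏ` and along the characteristics determines
the derivative of `θ` in `x`. -/
theorem isTheta_of_characteristic (hyp : IsStrictlyHyperbolic lam U) {i j : Fin n} (hij : j ≠ i)
    (hlam : ∀ u ∈ U, pd j (lam i) u ≠ 0) {A : Set (ℝ × ℝ × (Fin n → ℝ))}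
    {θ : ℝ × ℝ × (Fin n → ℝ) → ℝ} (hA : IsOpen A) (hθ : ContDiffOn ℝ ∞ θ A)
    (hbase : ∀ y ∈ A, y.2.2 ∈ U) (hne : ∀ y ∈ A, θ y ≠ 0)
    (hchar : ∀ y ∈ A, fderiv ℝ θ y (0, 1, 0) - lam i y.2.2 * fderiv ℝ θ y (1, 0, 0) =
      -pd i (lam i) y.2.2)
    (hdu : ∀ y ∈ A, ∀ k, k ≠ i →
      fderiv ℝ θ y (0, 0, Pi.single k 1) = -(a lam i k y.2.2) * θ y) :
    IsTheta lam U i j A θ := by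
  have hdx : ∀ y ∈ A, fderiv ℝ θ y (1, 0, 0) = b lam i j y.2.2 := by
    intro y hy
    have hyU := hbase y hy
    set ej : ℝ × ℝ × (Fin n → ℝ) := (0, 0, Pi.single j 1) with hej
    have hs : ∀ v, ContDiffOn ℝ ∞ (fun y => fderiv ℝ θ y v) A := smooth_fderiv_apply hA hθ
    have hd : ∀ v, DifferentiableAt ℝ (fun y => fderiv ℝ θ y v) y := fun v =>
      smooth_differentiableAt hA (hs v) hy
    -- The coefficient a_{ij} depends on u alone, so each of θ_x and θ_t satisfies the same linear
    -- equation in u^j as θ itself.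
    have hcomm : ∀ v : ℝ × ℝ × (Fin n → ℝ), v.2.2 = 0 → fderiv ℝ (fun y => fderiv ℝ θ y v) y ej =
        -(a lam i j y.2.2) * fderiv ℝ θ y v := by
      intro v hv
      rw [fderiv_fderiv_comm hA hθ hy v ej]
      have h1 : (fun y => fderiv ℝ θ y ej) =ᶠ[𝓝 y] fun y => -(a lam i j y.2.2) * θ y := by
        filter_upwards [hA.mem_nhds hy] with y' hy' using hdu y' hy' j hij
      have h2 := fderiv_comp_snd_snd (y := y)
        (smooth_differentiableAt hyp.isOpen (hyp.smooth_a i j) hyU)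
      rw [h1.fderiv_eq, (h2.fun_neg.fun_mul (smooth_differentiableAt hA hθ hy).hasFDerivAt).fderiv]
      simp [hv]
    have hl := fderiv_comp_snd_snd (y := y)
      (smooth_differentiableAt hyp.isOpen (hyp.smooth i) hyU)
    have hli := fderiv_comp_snd_snd (y := y)
      (smooth_differentiableAt hyp.isOpen (smooth_pd hyp.isOpen (hyp.smooth i) i) hyU)
    -- The characteristic equation is differentiated in u^j. What remains is ∂_j λ^i · θ_x = a_{ij}
    -- ∂_i λ^i + ∂_i ∂_j λ^i, and ∂_j λ^i ≠ 0 gives θ_x = b_{ij}.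
    have h3 : (fun y => fderiv ℝ θ y (0, 1, 0) - lam i y.2.2 * fderiv ℝ θ y (1, 0, 0)) =ᶠ[𝓝 y]
        fun y => -pd i (lam i) y.2.2 := by
      filter_upwards [hA.mem_nhds hy] with y' hy' using hchar y' hy'
    have h4 := congrArg (fun L : ℝ × ℝ × (Fin n → ℝ) →L[ℝ] ℝ => L ej) h3.fderiv_eq
    rw [((hd _).hasFDerivAt.fun_sub (hl.fun_mul (hd _).hasFDerivAt)).fderiv, hli.fun_neg.fderiv] at h4
    simp only [sub_apply, add_apply, smul_apply, neg_apply, ContinuousLinearMap.comp_apply,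
      ContinuousLinearMap.coe_snd', smul_eq_mul, hej] at h4
    rw [← hej, hcomm _ rfl, hcomm _ rfl] at h4
    change _ - (_ + _ * pd j (lam i) y.2.2) = -pd j (pd i (lam i)) y.2.2 at h4
    have h5 := hchar y hy
    have hne1 := hlam _ hyU
    have hne2 : lam j y.2.2 - lam i y.2.2 ≠ 0 := sub_ne_zero.2 (hyp.distinct j i hij _ hyU)
    have h6 : fderiv ℝ θ y (1, 0, 0) * pd j (lam i) y.2.2 =
        a lam i j y.2.2 * pd i (lam i) y.2.2 + pd j (pd i (lam i)) y.2.2 := by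
      linear_combination (-1 : ℝ) * h4 - a lam i j y.2.2 * h5
    simp only [b]
    rw [eq_comm, div_add_div _ _ hne1 hne2, div_eq_iff (mul_ne_zero hne1 hne2)]
    simp only [a] at h6
    field_simp at h6
    linear_combination -h6
  exact ⟨hA, hθ, hbase, hne, hdx, fun y hy => by
    have := hchar y hy; rw [hdx y hy] at this; linarith, hdu⟩

/-- The relation `J = φ(uⁱ)` in solved form. -/
theorem exists_theta (hyp : IsStrictlyHyperbolic lam U) {i j : Fin n} (hij : j ≠ i)
    (hlam : ∀ u ∈ U, pd j (lam i) u ≠ 0) {Ω : Set (Jet n)} {J : Jet n → ℝ}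
    (hJ : IsExtraRiemannInvariantOfOrderOne lam U i Ω J) {q₁ : Jet n} (hq₁ : q₁ ∈ Ω)
    (hp : q₁.2.2.2 i ≠ 0) {φ : ℝ → ℝ} {S : Set ℝ} (hS : IsOpen S) (hφ : ContDiffOn ℝ ∞ φ S)
    (hqS : q₁.2.2.1 i ∈ S) (hJφ : J q₁ = φ (q₁.2.2.1 i)) :
    ∃ (θ : ℝ × ℝ × (Fin n → ℝ) → ℝ) (A : Set (ℝ × ℝ × (Fin n → ℝ))), baseJet q₁ ∈ A ∧
      IsTheta lam U i j A θ ∧ θ (baseJet q₁) = (q₁.2.2.2 i)⁻¹ ∧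
      (∀ᶠ q in 𝓝 q₁, J q = φ (q.2.2.1 i) ↔ (q.2.2.2 i)⁻¹ = θ (baseJet q)) ∧
      ∀ e : ℝ × ℝ × (Fin n → ℝ), e.2.2 i = 0 →
        fderiv ℝ J q₁ (mkJet e ((-(q₁.2.2.2 i) ^ 2 * fderiv ℝ θ (baseJet q₁) e) •
          Pi.single i 1)) = 0 := by
  obtain ⟨Θ, A, r, hr, hA, h1A, hΘ, hΘ1, hiff, hmain⟩ :=
    exists_solve_relation hJ hq₁ hS hφ hqS hJφ
  set y₁ := baseJet q₁ with hy₁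
  set p₁ := q₁.2.2.2 with hp₁
  set A' : Set (ℝ × ℝ × (Fin n → ℝ)) := A ∩ Θ ⁻¹' ({0}ᶜ ∩ Metric.ball (p₁ i) r) with hA'
  have hA'o : IsOpen A' :=
    hΘ.continuousOn.isOpen_inter_preimage hA (isOpen_compl_singleton.inter Metric.isOpen_ball)
  have h1A' : y₁ ∈ A' := ⟨h1A, by
    rw [mem_preimage, hΘ1]; exact ⟨hp, Metric.mem_ball_self hr⟩⟩
  have hΘne : ∀ y ∈ A', Θ y ≠ 0 := fun y hy => hy.2.1
  have hΘd : ∀ y ∈ A', DifferentiableAt ℝ Θ y := fun y hy => smooth_differentiableAt hA hΘ hy.1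
  have hchar : ∀ y ∈ A', ∀ p ∈ Metric.ball p₁ r, p i = Θ y →
      fderiv ℝ Θ y (-lam i y.2.2, 1, fun k => (lam k y.2.2 - lam i y.2.2) * p k) =
        (∑ k, p k * pd k (lam i) y.2.2) * Θ y := by
    intro y hy p hpb hpi
    obtain ⟨hqΩ, hq⟩ := (hmain y hy.1).2 p hpb hpi
    set e : ℝ × ℝ × (Fin n → ℝ) := (-lam i y.2.2, 1, fun k => (lam k y.2.2 - lam i y.2.2) * p k)
      with he
    have h1 := hq e (by simp [he])
    have h2 := hJ.1.firstIntegral _ hqΩ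
      (mkJet e (((∑ k, p k * pd k (lam i) y.2.2) * Θ y) • Pi.single i 1)) (by
        refine ⟨?_, ?_, ?_, ?_⟩
        · simp [mkJet, he]
        · simp [mkJet, he]
        · intro k _; simp only [mkJet, he]; ring
        · simp [mkJet, he, hpi])
    -- A vector tangent to the level and a Monge vector with the same (x, t, u)-part both annihilate
    -- the differential of `J`. Their difference points along u^i_x, where the derivative of `J` is
    -- not zero.
    have h3 : fderiv ℝ J (mkJet y p) ((fderiv ℝ Θ y e - (∑ k, p k * pd k (lam i) y.2.2) * Θ y) •
        (0, 0, 0, Pi.single i 1)) = 0 := by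
      have h4 : (fderiv ℝ Θ y e - (∑ k, p k * pd k (lam i) y.2.2) * Θ y) •
          ((0, 0, 0, Pi.single i 1) : Jet n) = mkJet e (fderiv ℝ Θ y e • Pi.single i 1) -
            mkJet e (((∑ k, p k * pd k (lam i) y.2.2) * Θ y) • Pi.single i 1) := by
        simp [mkJet, sub_smul]
      rw [h4, map_sub, h1, h2, sub_zero]
    rw [map_smul, smul_eq_mul] at h3
    exact sub_eq_zero.1 ((mul_eq_zero.1 h3).resolve_right (hJ.2 _ hqΩ))
  -- the components of this equation
  have hyU : ∀ y ∈ A', y.2.2 ∈ U := fun y hy => (hmain y hy.1).1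
  -- One free derivative u^k_x is varied by `s`. The characteristic equation is affine in it, so the
  -- values s = 0 and s = r / 2 separate the equation for ∂_k Θ from the rest.
  let P : ℝ × ℝ × (Fin n → ℝ) → Fin n → ℝ → Fin n → ℝ := fun y k s =>
    p₁ + (Θ y - p₁ i) • Pi.single i 1 + s • Pi.single k 1
  have hPb : ∀ y ∈ A', ∀ k, k ≠ i → ∀ s, |s| < r → P y k s ∈ Metric.ball p₁ r := by
    intro y hy k hk s hs
    rw [Metric.mem_ball, dist_pi_lt_iff hr]
    intro m
    rw [Real.dist_eq]
    have h2 : |Θ y - p₁ i| < r := by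
      have := hy.2.2; rwa [Metric.mem_ball, Real.dist_eq] at this
    by_cases hmi : m = i
    · subst hmi; simpa [P, hk.symm] using h2
    · by_cases hmk : m = k
      · subst hmk; simpa [P, hmi] using hs
      · simpa [P, hmi, hmk] using hr
  have hPi : ∀ y k, k ≠ i → ∀ s, P y k s i = Θ y := fun y k hk s => by
    simp [P, Pi.single_eq_of_ne hk.symm]
  have hexp : ∀ y ∈ A', ∀ k, k ≠ i → ∀ s, |s| < r →
      -lam i y.2.2 * fderiv ℝ Θ y (1, 0, 0) + fderiv ℝ Θ y (0, 1, 0) +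
        ∑ m, (lam m y.2.2 - lam i y.2.2) * P y k s m * fderiv ℝ Θ y (0, 0, Pi.single m 1) =
      (∑ m, P y k s m * pd m (lam i) y.2.2) * Θ y := by
    intro y hy k hk s hs
    have h1 := fderiv_apply_base (fderiv ℝ Θ y)
      (-lam i y.2.2, 1, fun m => (lam m y.2.2 - lam i y.2.2) * P y k s m)
    rw [hchar y hy _ (hPb y hy k hk s hs) (hPi y k hk s), one_mul] at h1
    exact h1.symm
  have hduΘ : ∀ y ∈ A', ∀ k, k ≠ i → fderiv ℝ Θ y (0, 0, Pi.single k 1) = a lam i k y.2.2 * Θ y := by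
    intro y hy k hk
    have h1 := hexp y hy k hk 0 (by simpa using hr)
    have h2 := hexp y hy k hk (r / 2) (by rw [abs_of_pos (by positivity)]; linarith)
    have e1 : ∀ m, P y k (r / 2) m = P y k 0 m + if m = k then r / 2 else 0 := by
      intro m
      by_cases hmk : m = k
      · subst hmk; simp [P]
      · simp [P, hmk]
    simp only [e1, mul_add, add_mul, Finset.sum_add_distrib, mul_ite, ite_mul, mul_zero, zero_mul,
      Finset.sum_ite_eq', Finset.mem_univ, if_true] at h2
    rw [hyp.pd_lam hk.symm (hyU y hy)] at h2
    have hne : lam k y.2.2 - lam i y.2.2 ≠ 0 := sub_ne_zero.2 (hyp.distinct k i hk _ (hyU y hy))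
    have hr2 : r / 2 ≠ 0 := by positivity
    apply mul_left_cancel₀ (mul_ne_zero hne hr2)
    linear_combination h2 - h1
  -- With the derivatives ∂_m Θ, m ≠ i, inserted, all summands with m ≠ i cancel and only the term
  -- with ∂_i λ^i survives.
  have hdtΘ : ∀ y ∈ A', fderiv ℝ Θ y (0, 1, 0) - lam i y.2.2 * fderiv ℝ Θ y (1, 0, 0) =
      pd i (lam i) y.2.2 * Θ y ^ 2 := by
    intro y hy
    have h1 := hexp y hy j hij 0 (by simpa using hr)
    have h2 : ∀ m, (lam m y.2.2 - lam i y.2.2) * P y j 0 m * fderiv ℝ Θ y (0, 0, Pi.single m 1) =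
        P y j 0 m * pd m (lam i) y.2.2 * Θ y -
          if m = i then P y j 0 i * pd i (lam i) y.2.2 * Θ y else 0 := by
      intro m
      by_cases hmi : m = i
      · subst hmi; simp
      · rw [hduΘ y hy m hmi, hyp.pd_lam (Ne.symm hmi) (hyU y hy), if_neg hmi]; ring
    simp only [h2, Finset.sum_sub_distrib, Finset.sum_ite_eq', Finset.mem_univ, if_true,
      ← Finset.sum_mul, hPi y j hij] at h1
    linear_combination h1
  -- passage to the inverse
  have hinv : ∀ y ∈ A', ∀ e, fderiv ℝ (fun y => (Θ y)⁻¹) y e = -fderiv ℝ Θ y e / Θ y ^ 2 := by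
    intro y hy e
    have h1 : HasFDerivAt (fun y => (Θ y)⁻¹) _ y :=
      (hasDerivAt_inv (hΘne y hy)).comp_hasFDerivAt y (hΘd y hy).hasFDerivAt
    rw [h1.fderiv]
    simp; ring
  refine ⟨fun y => (Θ y)⁻¹, A', h1A', isTheta_of_characteristic hyp hij hlam hA'o
    ((hΘ.mono inter_subset_left).inv hΘne) hyU (fun y hy => inv_ne_zero (hΘne y hy)) ?_ ?_, ?_, ?_,
    ?_⟩
  · intro y hy
    rw [hinv y hy, hinv y hy]
    have := hdtΘ y hy
    have hn := hΘne y hy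
    field_simp
    linear_combination -this
  · intro y hy k hk
    rw [hinv y hy, hduΘ y hy k hk]
    have hn := hΘne y hy
    field_simp
  · simp only [hΘ1]
  · filter_upwards [hiff] with q hq
    rw [hq, inv_inj]
  · intro e he
    rw [hinv y₁ h1A', hΘ1]
    have h1 := ((hmain y₁ h1A).2 p₁ (Metric.mem_ball_self hr) hΘ1.symm).2 e he
    have h2 : -p₁ i ^ 2 * (-fderiv ℝ Θ y₁ e / p₁ i ^ 2) = fderiv ℝ Θ y₁ e := by
      field_simp
    rw [h2]
    exact h1

/-- The derivative of an extra Riemann invariant vanishes on the vectors in which the component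
along `uⁱ_x` is the one prescribed by the level sets. -/
theorem fderiv_eq_zero_of_level (hyp : IsStrictlyHyperbolic lam U) {i j : Fin n} (hij : j ≠ i)
    (hlam : ∀ u ∈ U, pd j (lam i) u ≠ 0) {Ω : Set (Jet n)} {J : Jet n → ℝ}
    (hJ : IsExtraRiemannInvariantOfOrderOne lam U i Ω J) {q : Jet n} (hq : q ∈ Ω)
    (hp : q.2.2.2 i ≠ 0) {X : Jet n} (hX : X.2.2.1 i = 0)
    (hXp : X.2.2.2 i = -(q.2.2.2 i) ^ 2 * (b lam i j q.2.2.1 * X.1 +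
      (lam i q.2.2.1 * b lam i j q.2.2.1 - pd i (lam i) q.2.2.1) * X.2.1) +
      q.2.2.2 i * ∑ k, a lam i k q.2.2.1 * X.2.2.1 k) :
    fderiv ℝ J q X = 0 := by
  obtain ⟨θ, A, hqA, hθ, hθq, -, hmain⟩ := exists_theta hyp hij hlam hJ hq hp (φ := fun _ => J q)
    isOpen_univ contDiffOn_const (mem_univ _) rfl
  have h1 := hmain (baseJet X) hX
  have h2 : fderiv ℝ θ (baseJet q) (baseJet X) = b lam i j q.2.2.1 * X.1 +
      (lam i q.2.2.1 * b lam i j q.2.2.1 - pd i (lam i) q.2.2.1) * X.2.1 -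
      (∑ k, a lam i k q.2.2.1 * X.2.2.1 k) / q.2.2.2 i := by
    rw [fderiv_apply_base, hθ.dx _ hqA, hθ.dt _ hqA]
    have h3 : ∀ k, (baseJet X).2.2 k * fderiv ℝ θ (baseJet q) (0, 0, Pi.single k 1) =
        -(a lam i k q.2.2.1 * X.2.2.1 k) * (q.2.2.2 i)⁻¹ := by
      intro k
      by_cases hk : k = i
      · subst hk; simp [baseJet, hX]
      · rw [hθ.du _ hqA k hk, hθq]; simp only [baseJet]; ring
    simp only [h3, ← Finset.sum_mul, Finset.sum_neg_distrib]
    simp only [baseJet]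
    ring
  have h4 : -(q.2.2.2 i) ^ 2 * fderiv ℝ θ (baseJet q) (baseJet X) = X.2.2.2 i := by
    rw [h2, hXp]; field_simp; ring
  rw [h4] at h1
  have h5 := hJ.1.firstIntegral q hq (0, 0, 0, X.2.2.2 - X.2.2.2 i • Pi.single i 1)
    (by refine ⟨?_, ?_, fun k _ => ?_, ?_⟩ <;> simp)
  have h6 : X = mkJet (baseJet X) (X.2.2.2 i • Pi.single i 1) +
      (0, 0, 0, X.2.2.2 - X.2.2.2 i • Pi.single i 1) := by
    simp [mkJet, baseJet]
  have h7 := congrArg (fderiv ℝ J q) h6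
  rwa [map_add, h1, h5, add_zero] at h7

/-! ### Homogeneous linear equations along curves -/

/-- An integrating factor makes exp(-C) f constant, so a zero at any parameter spreads to the whole
interval, in both directions. -/
theorem eq_zero_of_hasDerivWithinAt_mul {f c : ℝ → ℝ} (hc : ContinuousOn c (Icc 0 1))
    (hf : ∀ s ∈ Icc (0 : ℝ) 1, HasDerivWithinAt f (c s * f s) (Icc 0 1) s) {s₁ : ℝ}
    (hs₁ : s₁ ∈ Icc (0 : ℝ) 1) (h₁ : f s₁ = 0) : ∀ s ∈ Icc (0 : ℝ) 1, f s = 0 := by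
  obtain ⟨c', hc', hcc⟩ : ∃ c' : ℝ → ℝ, Continuous c' ∧ ∀ s ∈ Icc (0 : ℝ) 1, c' s = c s := by
    refine ⟨IccExtend zero_le_one ((Icc (0 : ℝ) 1).domRestrict c),
      (continuousOn_iff_continuous_domRestrict.1 hc).Icc_extend', fun s hs => ?_⟩
    rw [IccExtend_of_mem _ _ hs]; rfl
  set C := fun s => ∫ x in (0 : ℝ)..s, c' x with hC
  have hC' : ∀ s, HasDerivAt C (c' s) s := fun s =>
    intervalIntegral.integral_hasDerivAt_right (hc'.intervalIntegrable _ _)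
      (hc'.stronglyMeasurableAtFilter _ _) hc'.continuousAt
  have h2 : ∀ s ∈ Icc (0 : ℝ) 1,
      HasDerivWithinAt (fun s => Real.exp (-C s) * f s) 0 (Icc 0 1) s := by
    intro s hs
    have := ((hC' s).fun_neg.exp.hasDerivWithinAt (s := Icc 0 1)).fun_mul (hf s hs)
    rw [hcc s hs] at this
    convert! this using 1
    ring
  have h3 := constant_of_derivWithin_zero (fun s hs => (h2 s hs).differentiableWithinAt)
    (fun s hs => (h2 s ⟨hs.1, hs.2.le⟩).derivWithin
      (uniqueDiffOn_Icc zero_lt_one s ⟨hs.1, hs.2.le⟩))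
  have h4 := h3 s₁ hs₁
  rw [h₁, mul_zero] at h4
  intro s hs
  have h5 := h3 s hs
  rw [← h4] at h5
  exact (mul_eq_zero.1 h5).resolve_left (Real.exp_ne_zero _)

theorem eq_zero_of_fderiv_apply_eq_mul {E : Type*} [NormedAddCommGroup E] [NormedSpace ℝ E]
    {f c : E → ℝ} {s : Set E} (hs : Convex ℝ s) (hf : ∀ x ∈ s, DifferentiableAt ℝ f x)
    (hc : ContinuousOn c s) {x y : E} (hx : x ∈ s) (hy : y ∈ s)
    (h : ∀ z ∈ s, fderiv ℝ f z (y - x) = c z * f z) (hfx : f x = 0) : f y = 0 := by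
  have hmem : ∀ σ ∈ Icc (0 : ℝ) 1, x + σ • (y - x) ∈ s := fun σ hσ =>
    hs.add_smul_sub_mem hx hy hσ
  have hd : ∀ σ ∈ Icc (0 : ℝ) 1, HasDerivWithinAt (fun σ : ℝ => f (x + σ • (y - x)))
      (c (x + σ • (y - x)) * f (x + σ • (y - x))) (Icc 0 1) σ := by
    intro σ hσ
    have h1 : HasDerivAt (fun σ : ℝ => x + σ • (y - x)) (y - x) σ := by
      have := ((hasDerivAt_id σ).smul_const (y - x)).const_add x
      rw [one_smul] at this
      exact this
    have h2 := (hf _ (hmem σ hσ)).hasFDerivAt.comp_hasDerivAt σ h1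
    rw [h _ (hmem σ hσ)] at h2
    exact h2.hasDerivWithinAt
  have := eq_zero_of_hasDerivWithinAt_mul (c := fun σ => c (x + σ • (y - x)))
    (hc.comp (by fun_prop) hmem) hd (s₁ := 0) (by simp) (by simpa using hfx) 1 (by simp)
  simpa using this

/-! ### The classes of commuting flows cut by the equation in the `i`-th direction -/

theorem IsStrictlyHyperbolic.smooth_b (hyp : IsStrictlyHyperbolic lam U) {i j : Fin n} (hij : j ≠ i)
    (hlam : ∀ u ∈ U, pd j (lam i) u ≠ 0) : ContDiffOn ℝ ∞ (b lam i j) U := by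
  have h1 := smooth_pd hyp.isOpen (hyp.smooth i) i
  exact ((smooth_pd hyp.isOpen h1 j).div (smooth_pd hyp.isOpen (hyp.smooth i) j) hlam).add
    (h1.div ((hyp.smooth j).sub (hyp.smooth i)) fun u hu =>
      sub_ne_zero.2 (hyp.distinct j i hij u hu))

theorem IsCommutingFlow.pd_pd (hyp : IsStrictlyHyperbolic lam U) {U' : Set (Fin n → ℝ)}
    (hU' : U' ⊆ U) {w : Fin n → (Fin n → ℝ) → ℝ} (hw : IsCommutingFlow lam U' w) {u : Fin n → ℝ}
    (hu : u ∈ U') {i k : Fin n} (hk : k ≠ i) :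
    pd k (pd i (w i)) u = (pd i (a lam i k) u - a lam i k u * a lam k i u) * (w k u - w i u) -
      a lam i k u * pd i (w i) u := by
  have h1 : pd k (w i) =ᶠ[𝓝 u] fun u => a lam i k u * (w k u - w i u) := by
    filter_upwards [hw.isOpen.mem_nhds hu] with x hx using hw.eqn i k hk.symm x hx
  rw [pd_comm hw.isOpen (hw.smooth i) hu, pd_congr h1,
    pd_mul (smooth_differentiableAt hyp.isOpen (hyp.smooth_a i k) (hU' hu))
      ((hw.differentiableAt k hu).fun_sub (hw.differentiableAt i hu)),
    pd_sub (hw.differentiableAt k hu) (hw.differentiableAt i hu), hw.eqn k i hk u hu]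
  ring

/-- The compatibility conditions of the equation `∂ᵢ wⁱ = bᵢⱼ wⁱ + ρ` with the system for commuting
flows. -/
structure IsCompatible (lam : Fin n → (Fin n → ℝ) → ℝ) (U : Set (Fin n → ℝ)) (i j : Fin n)
    (B : Set (Fin n → ℝ)) (ρ : (Fin n → ℝ) → ℝ) : Prop where
  isOpen : IsOpen B
  subset : B ⊆ U
  smooth : ContDiffOn ℝ ∞ ρ B
  pd_b : ∀ u ∈ B, ∀ k, k ≠ i → pd k (b lam i j) u = -(a lam i k u) * b lam i j u
  pd_rho : ∀ u ∈ B, ∀ k, k ≠ i → pd k ρ u = -(a lam i k u) * ρ u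
  pd_a : ∀ u ∈ B, ∀ k, k ≠ i →
    pd i (a lam i k) u = a lam i k u * a lam k i u + b lam i j u * a lam i k u

theorem IsCompatible.zero {i j : Fin n} {B : Set (Fin n → ℝ)} {ρ : (Fin n → ℝ) → ℝ}
    (h : IsCompatible lam U i j B ρ) : IsCompatible lam U i j B (fun _ => 0) :=
  ⟨h.isOpen, h.subset, contDiffOn_const, h.pd_b, fun u _ k _ => by rw [pd_const, mul_zero], h.pd_a⟩

/-- The derivatives θ_x and θ_t depend on u only, so θ is affine in (x, t) and ρ(u) is what remains.
Commuting ∂_k with ∂_x and ∂_t shows that the two coefficients obey the same equation in u^k as θ,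
and therefore so does ρ. -/
theorem IsTheta.exists_isCompatible (hyp : IsStrictlyHyperbolic lam U) {i j : Fin n} (hij : j ≠ i)
    (hlam : ∀ u ∈ U, pd j (lam i) u ≠ 0) {x₀ t₀ r : ℝ} {u₀ : Fin n → ℝ}
    {θ : ℝ × ℝ × (Fin n → ℝ) → ℝ} (hr : 0 < r)
    (hθ : IsTheta lam U i j (Metric.ball (x₀, t₀, u₀) r) θ) :
    ∃ ρ, IsCompatible lam U i j (Metric.ball u₀ r) ρ ∧ ∀ y ∈ Metric.ball (x₀, t₀, u₀) r,
      θ y = b lam i j y.2.2 * (y.1 + lam i y.2.2 * y.2.1) - pd i (lam i) y.2.2 * y.2.1 + ρ y.2.2 := by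
  set c : ℝ × ℝ × (Fin n → ℝ) → ℝ := fun y =>
    b lam i j y.2.2 * (y.1 + lam i y.2.2 * y.2.1) - pd i (lam i) y.2.2 * y.2.1 with hc
  have hball : ∀ x t u, (x, t, u) ∈ Metric.ball (x₀, t₀, u₀) r ↔
      x ∈ Metric.ball x₀ r ∧ t ∈ Metric.ball t₀ r ∧ u ∈ Metric.ball u₀ r := by
    intro x t u
    simp only [Metric.mem_ball, Prod.dist_eq, max_lt_iff]
  have hmem : ∀ u ∈ Metric.ball u₀ r, (x₀, t₀, u) ∈ Metric.ball (x₀, t₀, u₀) r := fun u hu =>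
    (hball _ _ _).2 ⟨Metric.mem_ball_self hr, Metric.mem_ball_self hr, hu⟩
  have hBU : Metric.ball u₀ r ⊆ U := fun u hu => hθ.base _ (hmem u hu)
  have hbs := hyp.smooth_b hij hlam
  have hls := smooth_pd hyp.isOpen (hyp.smooth i) i
  have hι : ContDiff ℝ ∞ (fun u : Fin n → ℝ => (x₀, t₀, u)) := by fun_prop
  have hslice : ∀ {f : ℝ × ℝ × (Fin n → ℝ) → ℝ}, ContDiffOn ℝ ∞ f (Metric.ball (x₀, t₀, u₀) r) →
      ∀ u ∈ Metric.ball u₀ r, ∀ k, pd k (fun u => f (x₀, t₀, u)) u =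
        fderiv ℝ f (x₀, t₀, u) (0, 0, Pi.single k 1) := by
    intro f hf u hu k
    have h1 := (hasFDerivAt_const x₀ u).prodMk ((hasFDerivAt_const t₀ u).prodMk
      (hasFDerivAt_id (𝕜 := ℝ) u))
    have h2 := HasFDerivAt.comp (g := f) (f := fun u : Fin n → ℝ => (x₀, t₀, u)) u
      (smooth_differentiableAt hθ.isOpen hf (hmem u hu)).hasFDerivAt h1
    have h3 : fderiv ℝ (fun u => f (x₀, t₀, u)) u = _ := h2.fderiv
    rw [pd, h3]
    simp
  -- the derivatives of the coefficients
  have hcross : ∀ (v : ℝ × ℝ × (Fin n → ℝ)) (f : (Fin n → ℝ) → ℝ), v.2.2 = 0 →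
      (∀ y ∈ Metric.ball (x₀, t₀, u₀) r, fderiv ℝ θ y v = f y.2.2) →
      ∀ u ∈ Metric.ball u₀ r, ∀ k, k ≠ i → pd k f u = -(a lam i k u) * f u := by
    intro v f hv hf u hu k hk
    have hy := hmem u hu
    have h0 : pd k f u = pd k (fun u => fderiv ℝ θ (x₀, t₀, u) v) u := by
      refine pd_congr ?_
      filter_upwards [Metric.isOpen_ball.mem_nhds hu] with u' hu' using (hf _ (hmem u' hu')).symm
    rw [h0, hslice (smooth_fderiv_apply hθ.isOpen hθ.smooth v) u hu,
      fderiv_fderiv_comm hθ.isOpen hθ.smooth hy]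
    have h1 : (fun y => fderiv ℝ θ y (0, 0, Pi.single k 1)) =ᶠ[𝓝 (x₀, t₀, u)]
        fun y => -(a lam i k y.2.2) * θ y := by
      filter_upwards [hθ.isOpen.mem_nhds hy] with y' hy' using hθ.du y' hy' k hk
    have h2 := fderiv_comp_snd_snd (y := (x₀, t₀, u))
      (smooth_differentiableAt hyp.isOpen (hyp.smooth_a i k) (hBU hu))
    rw [h1.fderiv_eq, (h2.fun_neg.fun_mul
      (smooth_differentiableAt hθ.isOpen hθ.smooth hy).hasFDerivAt).fderiv]
    simp [hv, hf _ hy]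
  have hpb := hcross (1, 0, 0) (b lam i j) rfl hθ.dx
  have hpl := hcross (0, 1, 0) (fun u => lam i u * b lam i j u - pd i (lam i) u) rfl hθ.dt
  have hdb : ∀ u ∈ Metric.ball u₀ r, DifferentiableAt ℝ (b lam i j) u := fun u hu =>
    smooth_differentiableAt hyp.isOpen hbs (hBU hu)
  have hdl : ∀ u ∈ Metric.ball u₀ r, DifferentiableAt ℝ (lam i) u := fun u hu =>
    smooth_differentiableAt hyp.isOpen (hyp.smooth i) (hBU hu)
  have hdli : ∀ u ∈ Metric.ball u₀ r, DifferentiableAt ℝ (pd i (lam i)) u := fun u hu =>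
    smooth_differentiableAt hyp.isOpen hls (hBU hu)
  let ρ : (Fin n → ℝ) → ℝ := fun u => θ (x₀, t₀, u) -
    (x₀ * b lam i j u + t₀ * (lam i u * b lam i j u - pd i (lam i) u))
  have hθs : ContDiffOn ℝ ∞ (fun u => θ (x₀, t₀, u)) (Metric.ball u₀ r) :=
    hθ.smooth.comp hι.contDiffOn hmem
  refine ⟨ρ, ⟨Metric.isOpen_ball, hBU, ?_, hpb, ?_, ?_⟩, ?_⟩
  · exact hθs.sub (((contDiffOn_const.mul (hbs.mono hBU))).add (contDiffOn_const.mul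
      ((((hyp.smooth i).mono hBU).mul (hbs.mono hBU)).sub (hls.mono hBU))))
  · intro u hu k hk
    have d1 := smooth_differentiableAt Metric.isOpen_ball hθs hu
    have d2 := (hdb u hu).const_mul x₀
    have d3 := (((hdl u hu).fun_mul (hdb u hu)).fun_sub (hdli u hu))
    have d4 := d3.const_mul t₀
    rw [pd_sub d1 (d2.fun_add d4), pd_add d2 d4, pd_const_mul (hdb u hu), pd_const_mul d3,
      hpb u hu k hk, hpl u hu k hk, hslice hθ.smooth u hu, hθ.du _ (hmem u hu) k hk]
    ring
  · intro u hu k hk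
    -- The derivative of λ^i b_{ij} - ∂_i λ^i contains ∂_k ∂_i λ^i, which is expressed through ∂_i
    -- a_{ik} because λ is itself a commuting flow. Cancelling λ^k - λ^i leaves the condition on
    -- a_{ik}.
    have h1 := hpl u hu k hk
    rw [pd_sub ((hdl u hu).fun_mul (hdb u hu)) (hdli u hu), pd_mul (hdl u hu) (hdb u hu),
      hpb u hu k hk, hyp.pd_lam hk.symm (hBU hu),
      hyp.isCommutingFlow_lam.pd_pd hyp Subset.rfl (hBU hu) hk] at h1
    have hne : lam k u - lam i u ≠ 0 := sub_ne_zero.2 (hyp.distinct k i hk u (hBU hu))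
    apply mul_right_cancel₀ hne
    linear_combination -h1
  · rintro ⟨x, t, u⟩ hy
    have hu : u ∈ Metric.ball u₀ r := ((hball _ _ _).1 hy).2.2
    let L : ℝ × ℝ × (Fin n → ℝ) → ℝ := fun y => b lam i j u * y.1 +
      (lam i u * b lam i j u - pd i (lam i) u) * y.2.1
    have hL : ∀ y, HasFDerivAt L (b lam i j u • ContinuousLinearMap.fst ℝ ℝ (ℝ × (Fin n → ℝ)) +
        (lam i u * b lam i j u - pd i (lam i) u) • (ContinuousLinearMap.fst ℝ ℝ (Fin n → ℝ)).comp
          (ContinuousLinearMap.snd ℝ ℝ (ℝ × (Fin n → ℝ)))) y := fun y =>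
      (hasFDerivAt_fst.const_mul _).fun_add (hasFDerivAt_snd.fst.const_mul _)
    have hconv : Convex ℝ (Metric.ball (x₀, t₀, u₀) r ∩ {y | y.2.2 = u}) := by
      refine (convex_ball _ _).inter ?_
      intro y hy z hz α β _ _ hαβ
      rw [mem_ofPred_eq] at hy hz ⊢
      simp only [Prod.snd_add, Prod.smul_snd, hy, hz]
      rw [← add_smul, hαβ, one_smul]
    have hθd : ∀ y ∈ Metric.ball (x₀, t₀, u₀) r, DifferentiableAt ℝ θ y := fun y hy =>
      smooth_differentiableAt hθ.isOpen hθ.smooth hy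
    have h1 := eq_of_fderiv_apply_eq_zero (f := fun y => θ y - L y) hconv
      (fun y hy => (hθd y hy.1).fun_sub (hL y).differentiableAt) (x := (x₀, t₀, u))
      (y := (x, t, u)) ⟨hmem u hu, rfl⟩ ⟨hy, rfl⟩ (by
        rintro z ⟨hz, hzu⟩
        rw [mem_ofPred_eq] at hzu
        rw [((hθd z hz).hasFDerivAt.fun_sub (hL z)).fderiv, sub_apply, fderiv_apply_base,
          hθ.dx z hz, hθ.dt z hz, hzu]
        simp
        ring)
    simp only [L] at h1
    simp only [ρ]
    linarith

/-- The commuting flows with `∂ᵢ wⁱ = bᵢⱼ wⁱ + ρ`. -/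
def InClass (lam : Fin n → (Fin n → ℝ) → ℝ) (i j : Fin n) (ρ : (Fin n → ℝ) → ℝ)
    (U' : Set (Fin n → ℝ)) (w : Fin n → (Fin n → ℝ) → ℝ) : Prop :=
  IsCommutingFlow lam U' w ∧ ∀ u ∈ U', pd i (w i) u = b lam i j u * w i u + ρ u

/-- The three compatibility conditions are what makes the inhomogeneous terms cancel. The defect of
the i-th equation then satisfies a homogeneous linear equation in each direction k ≠ i, and a zero
of it spreads inside a hypersurface u^i = const. -/
theorem IsCompatible.pd_defect (hyp : IsStrictlyHyperbolic lam U) {i j : Fin n} (hij : j ≠ i)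
    (hlam : ∀ u ∈ U, pd j (lam i) u ≠ 0) {B : Set (Fin n → ℝ)} {ρ : (Fin n → ℝ) → ℝ}
    (h : IsCompatible lam U i j B ρ) {U' : Set (Fin n → ℝ)} (hU' : U' ⊆ B)
    {w : Fin n → (Fin n → ℝ) → ℝ} (hw : IsCommutingFlow lam U' w) {u : Fin n → ℝ} (hu : u ∈ U')
    {k : Fin n} (hk : k ≠ i) :
    pd k (fun u => pd i (w i) u - (b lam i j u * w i u + ρ u)) u =
      -(a lam i k u) * (pd i (w i) u - (b lam i j u * w i u + ρ u)) := by
  have d1 := smooth_differentiableAt hw.isOpen (smooth_pd hw.isOpen (hw.smooth i) i) hu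
  have d2 := smooth_differentiableAt hyp.isOpen (hyp.smooth_b hij hlam) (h.subset (hU' hu))
  have d3 := hw.differentiableAt i hu
  have d4 := smooth_differentiableAt h.isOpen h.smooth (hU' hu)
  rw [pd_sub d1 ((d2.fun_mul d3).fun_add d4), pd_add (d2.fun_mul d3) d4, pd_mul d2 d3,
    hw.pd_pd hyp (hU'.trans h.subset) hu hk, h.pd_b u (hU' hu) k hk, h.pd_rho u (hU' hu) k hk,
    h.pd_a u (hU' hu) k hk, hw.eqn i k hk.symm u hu]
  ring

/-- The equation `∂ᵢ wⁱ = bᵢⱼ wⁱ + ρ` holds near a point if it holds on a curve transversal to the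
hypersurfaces `uⁱ = const`. -/
theorem IsCompatible.eventually_defect (hyp : IsStrictlyHyperbolic lam U) {i j : Fin n}
    (hij : j ≠ i) (hlam : ∀ u ∈ U, pd j (lam i) u ≠ 0) {B : Set (Fin n → ℝ)}
    {ρ : (Fin n → ℝ) → ℝ} (h : IsCompatible lam U i j B ρ) {U' : Set (Fin n → ℝ)} (hU' : U' ⊆ B)
    {w : Fin n → (Fin n → ℝ) → ℝ} (hw : IsCommutingFlow lam U' w) {γ : ℝ → Fin n → ℝ} {s₀ : ℝ}
    (hγ : ContinuousAt γ s₀) (hγ0 : γ s₀ ∈ U')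
    (hγi : map (fun s => γ s i) (𝓝 s₀) = 𝓝 (γ s₀ i))
    (hg : ∀ᶠ s in 𝓝 s₀, pd i (w i) (γ s) = b lam i j (γ s) * w i (γ s) + ρ (γ s)) :
    ∀ᶠ u in 𝓝 (γ s₀), pd i (w i) u = b lam i j u * w i u + ρ u := by
  obtain ⟨δ, hδ, hδU⟩ := Metric.isOpen_iff.1 hw.isOpen _ hγ0
  have h1 : ∀ᶠ s in 𝓝 s₀, γ s ∈ Metric.ball (γ s₀) δ ∧
      pd i (w i) (γ s) = b lam i j (γ s) * w i (γ s) + ρ (γ s) :=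
    (hγ.eventually (Metric.ball_mem_nhds _ hδ)).and hg
  have h2 : ∀ᶠ c in 𝓝 (γ s₀ i), ∃ s, γ s i = c ∧ γ s ∈ Metric.ball (γ s₀) δ ∧
      pd i (w i) (γ s) = b lam i j (γ s) * w i (γ s) + ρ (γ s) := by
    rw [← hγi, eventually_map]
    filter_upwards [h1] with s hs using ⟨s, rfl, hs⟩
  have h3 : ∀ᶠ u in 𝓝 (γ s₀), ∃ s, γ s i = u i ∧ γ s ∈ Metric.ball (γ s₀) δ ∧
      pd i (w i) (γ s) = b lam i j (γ s) * w i (γ s) + ρ (γ s) :=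
    (continuous_apply i).continuousAt.eventually h2
  filter_upwards [h3, Metric.ball_mem_nhds _ hδ] with u ⟨s, hsi, hsb, hs⟩ hub
  have hsm : ContDiffOn ℝ ∞ (fun u => pd i (w i) u - (b lam i j u * w i u + ρ u)) U' :=
    (smooth_pd hw.isOpen (hw.smooth i) i).sub ((((hyp.smooth_b hij hlam).mono
      (hU'.trans h.subset)).mul (hw.smooth i)).add (h.smooth.mono hU'))
  -- The segment from the point of the curve to `u` lies in one hypersurface u^i = const, so the
  -- derivative of the defect along it involves only the directions k ≠ i.
  refine sub_eq_zero.1 (eq_zero_of_fderiv_apply_eq_mul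
    (f := fun u => pd i (w i) u - (b lam i j u * w i u + ρ u))
    (c := fun z => ∑ k, -((u - γ s) k * a lam i k z)) (convex_ball (γ s₀) δ)
    (fun x hx => smooth_differentiableAt hw.isOpen hsm (hδU hx)) ?_ hsb hub ?_ (sub_eq_zero.2 hs))
  · refine continuousOn_finsetSum _ fun k _ => (continuousOn_const.mul ?_).neg
    exact (hyp.smooth_a i k).continuousOn.mono (hδU.trans (hU'.trans h.subset))
  · intro z hz
    rw [fderiv_eq_sum_pd, Finset.sum_mul]
    refine Finset.sum_congr rfl fun k _ => ?_
    by_cases hk : k = i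
    · subst hk; simp [hsi]
    · rw [h.pd_defect hyp hij hlam hU' hw (hδU hz) hk]; ring

/-- A commuting flow of the class of `ρ` with prescribed values at a point, and with prescribed
derivatives `∂ₖ wᵏ`, `k ≠ i`. -/
theorem IsCompatible.exists_inClass (hyp : IsStrictlyHyperbolic lam U)
    (semi : IsSemihamiltonian lam U) {i j : Fin n} (hij : j ≠ i)
    (hlam : ∀ u ∈ U, pd j (lam i) u ≠ 0) {B : Set (Fin n → ℝ)} {ρ : (Fin n → ℝ) → ℝ}
    (h : IsCompatible lam U i j B ρ) {u₁ : Fin n → ℝ} (hu₁ : u₁ ∈ B) (w₁ d : Fin n → ℝ) :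
    ∃ (U' : Set (Fin n → ℝ)) (w : Fin n → (Fin n → ℝ) → ℝ), u₁ ∈ U' ∧ U' ⊆ B ∧
      InClass lam i j ρ U' w ∧ (∀ k, w k u₁ = w₁ k) ∧ ∀ k, k ≠ i → pd k (w k) u₁ = d k := by
  -- The line in the direction (1, …, 1) is transversal to all coordinate hyperplanes.
  let γ : ℝ → Fin n → ℝ := fun s => u₁ + s • (fun _ => 1)
  have hγ : ContDiff ℝ ∞ γ := by fun_prop
  have hγ0 : γ 0 = u₁ := by simp [γ]
  have hγd : ∀ s, HasDerivAt γ (fun _ => 1) s := fun s => by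
    have := ((hasDerivAt_id s).smul_const (fun _ : Fin n => (1 : ℝ))).const_add u₁
    rw [one_smul] at this
    exact this
  -- On this line the derivative of w^k is ∂_k w^k + ∑_l a_{kl} (w^l - w^k), so this slope produces
  -- ∂_k w^k = d^k.
  let c : Fin n → ℝ := fun k => d k + ∑ l, a lam k l u₁ * (w₁ l - w₁ k)
  let h0 : Fin n → ℝ → ℝ := fun k s => w₁ k + c k * s
  have hh0 : ∀ k, ContDiff ℝ ∞ (h0 k) := fun k => by fun_prop
  have hP : IsOpen (γ ⁻¹' B) := h.isOpen.preimage hγ.continuous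
  have h0P : (0 : ℝ) ∈ γ ⁻¹' B := by rw [mem_preimage, hγ0]; exact hu₁
  have hcomp : ∀ {f : (Fin n → ℝ) → ℝ}, ContDiffOn ℝ ∞ f U →
      ContDiffOn ℝ ∞ (fun s => f (γ s)) (γ ⁻¹' B) := fun hf =>
    hf.comp hγ.contDiffOn fun s hs => h.subset hs
  obtain ⟨α, hα, hαe⟩ := exists_contDiff_eventuallyEq hP (f := fun s => b lam i j (γ s) -
    ∑ l, a lam i l (γ s)) ((hcomp (hyp.smooth_b hij hlam)).sub
      (ContDiffOn.sum fun l _ => hcomp (hyp.smooth_a i l))) h0P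
  obtain ⟨β, hβ, hβe⟩ := exists_contDiff_eventuallyEq hP (f := fun s =>
    ∑ l, a lam i l (γ s) * h0 l s + ρ (γ s)) ((ContDiffOn.sum fun l _ =>
      (hcomp (hyp.smooth_a i l)).mul (hh0 l).contDiffOn).add
        (h.smooth.comp hγ.contDiffOn fun s hs => hs)) h0P
  -- The i-th component of the data cannot be chosen freely: it solves the linear equation that
  -- expresses ∂_i w^i = b_{ij} w^i + ρ along the line.
  obtain ⟨hi, hhi, hi0, hid⟩ := exists_linear_ode hα hβ (w₁ i)
  let hh : Fin n → ℝ → ℝ := fun k => if k = i then hi else h0 k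
  have hhs : ∀ k, ContDiff ℝ ∞ (hh k) := fun k => by
    by_cases hk : k = i
    · simp only [hh, if_pos hk]; exact hhi
    · simp only [hh, if_neg hk]; exact hh0 k
  have hhi' : hh i = hi := if_pos rfl
  have hhk : ∀ k, k ≠ i → hh k = h0 k := fun k hk => if_neg hk
  have hh00 : ∀ k, hh k 0 = w₁ k := fun k => by
    by_cases hk : k = i
    · subst hk; rw [hhi', hi0]
    · rw [hhk k hk]; simp [h0]
  obtain ⟨U₁, w, h0U, hU₁, hw, hwh⟩ := exists_commutingFlow hyp semi hγ
    (by rw [hγ0]; exact h.subset hu₁) (fun k => by rw [(hγd 0).deriv]; simp) hhs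
  rw [hγ0] at h0U
  have hw' := hw.mono (hw.isOpen.inter h.isOpen) inter_subset_left
  have hder : ∀ᶠ s in 𝓝 (0 : ℝ), ∀ k,
      deriv (hh k) s = pd k (w k) (γ s) + ∑ l, a lam k l (γ s) * (hh l s - hh k s) := by
    have hm : ∀ᶠ s in 𝓝 (0 : ℝ), γ s ∈ U₁ := hγ.continuous.continuousAt.preimage_mem_nhds
      (hw.isOpen.mem_nhds (by rwa [hγ0]))
    filter_upwards [hwh.eventually_nhds, hm] with s hs hsU k
    have h1 : hh k =ᶠ[𝓝 s] fun s => w k (γ s) := by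
      filter_upwards [hs] with s' hs' using (hs' k).symm
    rw [h1.deriv_eq, (hasDerivAt_comp_curve (hw.differentiableAt k hsU) (hγd s)).deriv,
      Finset.sum_eq_add_sum_sdiff_singleton_of_mem (Finset.mem_univ k),
      Finset.sum_eq_add_sum_sdiff_singleton_of_mem (Finset.mem_univ k) (f := fun l =>
        a lam k l (γ s) * (hh l s - hh k s)), a_self, one_mul, zero_mul, zero_add]
    congr 1
    refine Finset.sum_congr rfl fun l hl => ?_
    have hlk : l ≠ k := by simpa using hl
    rw [one_mul, hw.eqn k l hlk.symm _ hsU, hs.self_of_nhds, hs.self_of_nhds]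
  have hdef := h.eventually_defect hyp hij hlam inter_subset_right hw' (γ := γ) (s₀ := 0)
    hγ.continuous.continuousAt (by rw [hγ0]; exact ⟨h0U, hu₁⟩) (by
      have h1 : HasStrictDerivAt (fun s => γ s i) 1 0 := by
        have h2 := (hasStrictDerivAt_id (0 : ℝ)).const_add (u₁ i)
        have h3 : (fun s => γ s i) = fun s => u₁ i + id s := by ext s; simp [γ]
        rw [h3]
        exact h2
      exact h1.map_nhds_eq one_ne_zero) (by
      filter_upwards [hder, hwh, hαe, hβe] with s h1 h2 h3 h4
      have h5 := h1 i
      rw [hhi', (hid s).deriv, h3, h4] at h5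
      rw [h2 i, hhi']
      have h6 : ∑ l, a lam i l (γ s) * (hh l s - hi s) =
          ∑ l, a lam i l (γ s) * h0 l s - (∑ l, a lam i l (γ s)) * hi s := by
        rw [Finset.sum_mul, ← Finset.sum_sub_distrib]
        refine Finset.sum_congr rfl fun l _ => ?_
        by_cases hl : l = i
        · subst hl; simp [a_self]
        · rw [hhk l hl]; ring
      rw [h6] at h5
      linarith)
  rw [hγ0] at hdef
  obtain ⟨U', hU', hU'o, h1U'⟩ := eventually_nhds_iff.1 (hdef.and
    ((hw'.isOpen.mem_nhds ⟨h0U, hu₁⟩ : ∀ᶠ u in 𝓝 u₁, u ∈ U₁ ∩ B)))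
  refine ⟨U', w, h1U', fun u hu => (hU' u hu).2.2, ⟨hw'.mono hU'o fun u hu => (hU' u hu).2,
    fun u hu => (hU' u hu).1⟩, fun k => ?_, fun k hk => ?_⟩
  · have := hwh.self_of_nhds k
    rwa [hγ0, hh00] at this
  · have h1 := hder.self_of_nhds k
    have h2 : HasDerivAt (h0 k) (c k) 0 := by
      have := ((hasDerivAt_id (0 : ℝ)).const_mul (c k)).const_add (w₁ k)
      rwa [mul_one] at this
    rw [hhk k hk, h2.deriv, ← hhk k hk, hγ0] at h1
    simp only [hh00, c] at h1
    linarith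

/-- The derivative of a solution in hodograph form. -/
theorem IsHodograph.eventually_dx_mul (hyp : IsStrictlyHyperbolic lam U) {U' : Set (Fin n → ℝ)}
    (hU' : U' ⊆ U) {w : Fin n → (Fin n → ℝ) → ℝ} (hw : IsCommutingFlow lam U' w) {z : ℝ × ℝ}
    {v : ℝ × ℝ → Fin n → ℝ} (hv : IsHodograph lam w z v)
    (hvd : ∀ᶠ y in 𝓝 z, DifferentiableAt ℝ v y) (hz : v z ∈ U') :
    ∀ᶠ y in 𝓝 z, ∀ k, dx v y k * (pd k (w k) (v y) - y.2 * pd k (lam k) (v y)) = 1 := by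
  have hm : ∀ᶠ y in 𝓝 z, v y ∈ U' := hv.1.preimage_mem_nhds (hw.isOpen.mem_nhds hz)
  filter_upwards [hv.2.eventually_nhds, hvd, hm] with y hy hyd hyU k
  have hl := hyp.isCommutingFlow_lam.mono hw.isOpen hU'
  have h1 : (fun y : ℝ × ℝ => y.1 + lam k (v y) * y.2) =ᶠ[𝓝 y] fun y => w k (v y) := by
    filter_upwards [hy] with y' hy' using hy' k
  have d1 : DifferentiableAt ℝ (fun y => lam k (v y)) y :=
    (hl.differentiableAt k hyU).comp y hyd
  have h2 := congrArg (fun L : ℝ × ℝ →L[ℝ] ℝ => L (1, 0)) h1.fderiv_eq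
  rw [(hasFDerivAt_fst.fun_add (d1.hasFDerivAt.fun_mul hasFDerivAt_snd)).fderiv] at h2
  simp only [add_apply, smul_apply, ContinuousLinearMap.coe_fst', ContinuousLinearMap.coe_snd',
    smul_eq_mul, mul_zero, zero_add, fderiv_comp_apply (hl.differentiableAt k hyU) hyd,
    fderiv_comp_apply (hw.differentiableAt k hyU) hyd] at h2
  -- The terms with l ≠ k contain the difference of the k-th and l-th hodograph equations and
  -- vanish.
  have h3 : ∑ l, fderiv ℝ v y (1, 0) l * pd l (w k) (v y) - y.2 *
      ∑ l, fderiv ℝ v y (1, 0) l * pd l (lam k) (v y) =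
      dx v y k * (pd k (w k) (v y) - y.2 * pd k (lam k) (v y)) := by
    rw [Finset.mul_sum, ← Finset.sum_sub_distrib, Finset.sum_eq_single k]
    · simp only [dx]; ring
    · intro l _ hlk
      rw [hw.eqn k l hlk.symm _ hyU, hl.eqn k l hlk.symm _ hyU]
      have e1 := hy.self_of_nhds k
      have e2 := hy.self_of_nhds l
      linear_combination fderiv ℝ v y (1, 0) l * a lam k l (v y) * (e1 - e2)
    · simp
  linarith

/-- A solution satisfies the relation `1 / uⁱ_x = θ` if and only if its hodograph representation
is by a commuting flow of the class of `ρ`. -/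
theorem IsCompatible.relation_iff (hyp : IsStrictlyHyperbolic lam U) {i j : Fin n} (hij : j ≠ i)
    (hlam : ∀ u ∈ U, pd j (lam i) u ≠ 0) {B : Set (Fin n → ℝ)} {ρ : (Fin n → ℝ) → ℝ}
    (h : IsCompatible lam U i j B ρ) {Y : Set (ℝ × ℝ × (Fin n → ℝ))} (hY : IsOpen Y)
    {θ : ℝ × ℝ × (Fin n → ℝ) → ℝ} (hθ : ∀ y ∈ Y, θ y =
      b lam i j y.2.2 * (y.1 + lam i y.2.2 * y.2.1) - pd i (lam i) y.2.2 * y.2.1 + ρ y.2.2)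
    {U' : Set (Fin n → ℝ)} (hU' : U' ⊆ B) {w : Fin n → (Fin n → ℝ) → ℝ}
    (hw : IsCommutingFlow lam U' w) {W : Set (ℝ × ℝ)} {z : ℝ × ℝ} {v : ℝ × ℝ → Fin n → ℝ}
    (hvW : IsSolution lam U W v) (hzW : z ∈ W) (hv : IsHodograph lam w z v) (hz : v z ∈ U')
    (hzY : (z.1, z.2, v z) ∈ Y) (hp : dx v z i ≠ 0) :
    (∀ᶠ y in 𝓝 z, (dx v y i)⁻¹ = θ (y.1, y.2, v y)) ↔
      ∀ᶠ u in 𝓝 (v z), pd i (w i) u = b lam i j u * w i u + ρ u := by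
  have hvd : ∀ᶠ y in 𝓝 z, DifferentiableAt ℝ v y := by
    filter_upwards [hvW.isOpen.mem_nhds hzW] with y hy using hvW.differentiableAt hy
  have hYe : ∀ᶠ y : ℝ × ℝ in 𝓝 z, (y.1, y.2, v y) ∈ Y := by
    have hc : ContinuousAt (fun y : ℝ × ℝ => (y.1, y.2, v y)) z :=
      continuousAt_fst.prodMk (continuousAt_snd.prodMk hv.1)
    exact hc.preimage_mem_nhds (hY.mem_nhds hzY)
  -- Here 1/v^i_x = ∂_i w^i - t ∂_i λ^i, and x + λ^i t is replaced by w^i in the formula for θ; the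
  -- terms with t cancel.
  have hpt : ∀ᶠ y in 𝓝 z, ((dx v y i)⁻¹ = θ (y.1, y.2, v y) ↔
      pd i (w i) (v y) = b lam i j (v y) * w i (v y) + ρ (v y)) := by
    filter_upwards [hv.eventually_dx_mul hyp (hU'.trans h.subset) hw hvd hz, hv.2, hYe]
      with y h1 h2 h3
    rw [hθ _ h3, inv_eq_of_mul_eq_one_right (h1 i), ← h2 i]
    constructor <;> intro h4 <;> linarith
  rw [eventually_congr hpt]
  constructor
  -- The solution covers at most a surface in u-space. The curve t = const on it has u^i as a local
  -- parameter, and the equation spreads from this curve to a neighbourhood.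
  · intro hg
    have hι : ContDiff ℝ ∞ (fun s : ℝ => z + s • ((1 : ℝ), (0 : ℝ))) := by fun_prop
    have hι0 : z + (0 : ℝ) • ((1 : ℝ), (0 : ℝ)) = z := by simp
    have hιc := hι.continuous.tendsto 0
    rw [hι0] at hιc
    have hvc : ContDiffAt ℝ ∞ v (z + (0 : ℝ) • ((1 : ℝ), (0 : ℝ))) := by
      rw [hι0]; exact hvW.smooth.contDiffAt (hvW.isOpen.mem_nhds hzW)
    have hγs : ContDiffAt ℝ ∞ (fun s : ℝ => v (z + s • ((1 : ℝ), (0 : ℝ)))) 0 :=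
      hvc.comp (0 : ℝ) hι.contDiffAt
    have hγi : ContDiffAt ℝ ∞ (fun s : ℝ => v (z + s • ((1 : ℝ), (0 : ℝ))) i) 0 :=
      contDiffAt_pi.1 hγs i
    have hd : HasDerivAt (fun s : ℝ => v (z + s • ((1 : ℝ), (0 : ℝ))) i) (dx v z i) 0 := by
      have h1 : HasDerivAt (fun s : ℝ => z + s • ((1 : ℝ), (0 : ℝ))) (1, 0) 0 := by
        have := ((hasDerivAt_id (0 : ℝ)).smul_const ((1 : ℝ), (0 : ℝ))).const_add z
        rwa [one_smul] at this
      have h2 := (hvc.differentiableAt (by simp)).hasFDerivAt.comp_hasDerivAt 0 h1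
      rw [hι0] at h2
      exact hasDerivAt_pi.1 h2 i
    have hs := hγi.hasStrictDerivAt' hd (by simp)
    have := h.eventually_defect hyp hij hlam hU' hw (γ := fun s : ℝ => v (z + s • ((1 : ℝ), (0 : ℝ))))
      (s₀ := 0) hγs.continuousAt (by rw [hι0]; exact hz) (hs.map_nhds_eq hp)
      (hιc.eventually hg)
    rwa [hι0] at this
  · intro hg
    exact hv.1.eventually hg

/-! ### Steps along the flows of the subalgebra -/

theorem InSubalgebra.const_mul {i j : Fin n} {U' : Set (Fin n → ℝ)}
    {μ : Fin n → (Fin n → ℝ) → ℝ} (hμ : InSubalgebra lam i j U' μ) (c : ℝ) :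
    InSubalgebra lam i j U' (fun k u => c * μ k u) :=
  ⟨hμ.1.const_mul c, fun u hu => by
    rw [pd_const_mul (hμ.1.differentiableAt i hu), hμ.2 u hu]; ring⟩

theorem InSubalgebra.sum {i j : Fin n} {U' : Set (Fin n → ℝ)} {ι : Type*} [Fintype ι]
    {μ : ι → Fin n → (Fin n → ℝ) → ℝ} (hU : IsOpen U') (hμ : ∀ m, InSubalgebra lam i j U' (μ m)) :
    InSubalgebra lam i j U' (fun k u => ∑ m, μ m k u) :=
  ⟨IsCommutingFlow.sum hU fun m => (hμ m).1, fun u hu => by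
    rw [pd_sum fun m _ => (hμ m).1.differentiableAt i hu, Finset.mul_sum]
    exact Finset.sum_congr rfl fun m _ => (hμ m).2 u hu⟩

/-- Time reversal τ ↦ 1 - τ, with -μ in place of μ. Hence orbits are equivalence classes and paths
can be run backwards. -/
theorem FlowStep.symm {i j : Fin n} {Ω : Set (Jet n)} {A B : PointedFun n}
    (h : FlowStep lam U i j Ω A B) : FlowStep lam U i j Ω B A := by
  obtain ⟨U', μ, D, V, ξ, t, hU', hμ, hV, hξ, hA, hAV, hB, hBV⟩ := h
  let R : ℝ × ℝ × ℝ → ℝ × ℝ × ℝ := fun q => (q.1, q.2.1, 1 - q.2.2)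
  have hR : ContDiff ℝ ∞ R := by fun_prop
  let R' : ℝ × ℝ × ℝ →L[ℝ] ℝ × ℝ × ℝ := (ContinuousLinearMap.fst ℝ ℝ (ℝ × ℝ)).prod
    (((ContinuousLinearMap.fst ℝ ℝ ℝ).comp (ContinuousLinearMap.snd ℝ ℝ (ℝ × ℝ))).prod
      (-((ContinuousLinearMap.snd ℝ ℝ ℝ).comp (ContinuousLinearMap.snd ℝ ℝ (ℝ × ℝ)))))
  have hR' : ∀ q, HasFDerivAt R R' q := fun q =>
    hasFDerivAt_fst.prodMk (hasFDerivAt_snd.fst.prodMk (hasFDerivAt_snd.snd.const_sub 1))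
  have hfd : ∀ q, R q ∈ D → ∀ e, fderiv ℝ (fun q => V (R q)) q e = fderiv ℝ V (R q) (R' e) := by
    intro q hq e
    have h1 : HasFDerivAt (fun q => V (R q)) _ q := HasFDerivAt.comp (g := V) (f := R) q
      (smooth_differentiableAt hV.isOpen hV.smooth hq).hasFDerivAt (hR' q)
    rw [h1.fderiv]; rfl
  have hcom : IsCommonSolution lam (fun k u => (-1) * μ k u) U' (R ⁻¹' D) (fun q => V (R q)) := by
    refine ⟨hV.isOpen.preimage hR.continuous, fun q hq => hV.mapsTo hq,
      hV.smooth.comp hR.contDiffOn fun q hq => hq, fun q hq k => ?_, fun q hq k => ?_⟩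
    · rw [hfd q hq, hfd q hq]
      simpa [R'] using hV.eqn_t _ hq k
    · have h1 : R' (0, 0, 1) = -(0, 0, 1) := by simp [R']
      have h2 : R' (1, 0, 0) = (1, 0, 0) := by simp [R']
      rw [hfd q hq, hfd q hq, h1, h2, map_neg, Pi.neg_apply, hV.eqn_flow _ hq k]
      ring
  have hI : ∀ τ ∈ Icc (0 : ℝ) 1, 1 - τ ∈ Icc (0 : ℝ) 1 := fun τ hτ =>
    ⟨by linarith [hτ.2], by linarith [hτ.1]⟩
  refine ⟨U', fun k u => (-1) * μ k u, R ⁻¹' D, fun q => V (R q), fun τ => ξ (1 - τ), t, hU',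
    hμ.const_mul _, hcom, fun τ hτ => ?_, ?_, ?_, ?_, ?_⟩
  · obtain ⟨h1, h2, h3⟩ := hξ (1 - τ) (hI τ hτ)
    refine ⟨h1, ?_, ?_⟩
    · have h4 : HasDerivWithinAt (fun τ : ℝ => 1 - τ) (-1) (Icc 0 1) τ :=
        ((hasDerivAt_id τ).const_sub 1).hasDerivWithinAt
      have h5 := HasDerivWithinAt.comp τ h2 h4 hI
      convert! h5 using 1
      simp [R]
    · rw [hfd _ h1]
      simpa [R, R'] using h3
  · simpa using hB
  · simpa [R] using hBV
  · simpa using hA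
  · simpa [R] using hAV

/-- The hodograph family over the parameters τ ε, 0 ≤ τ ≤ 1, is a common solution of the system and
of the flow ∑ ε_m μ_m; it joins the data w to w - ∑ ε_m μ_m in time one. Smallness of the parameters
keeps the jets in the open set `Ω`. -/
theorem eventually_flowStep (hyp : IsStrictlyHyperbolic lam U) {i j : Fin n} {Ω : Set (Jet n)}
    (hΩ : IsOpen Ω) {N : ℕ} {U₁ : Set (Fin n → ℝ)} (hU₁ : U₁ ⊆ U)
    {w : Fin n → (Fin n → ℝ) → ℝ} (hw : IsCommutingFlow lam U₁ w)
    {μ : Fin N → Fin n → (Fin n → ℝ) → ℝ} (hμ : ∀ m, InSubalgebra lam i j U₁ (μ m))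
    {x₁ t₁ : ℝ} {u₁ p₁ : Fin n → ℝ} (hu₁ : u₁ ∈ U₁) (h₁ : ∀ k, x₁ + lam k u₁ * t₁ = w k u₁)
    (hp₁ : ∀ k, p₁ k * (pd k (w k) u₁ - t₁ * pd k (lam k) u₁) = 1)
    (hq₁ : ((x₁, t₁, u₁, p₁) : Jet n) ∈ Ω) :
    ∀ᶠ y in 𝓝 ((x₁, u₁, 0) : ℝ × (Fin n → ℝ) × (Fin N → ℝ)), y.2.1 i = u₁ i →
      (∀ k, y.1 + lam k y.2.1 * t₁ + ∑ m, y.2.2 m * μ m k y.2.1 = w k y.2.1) →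
      ∀ v v', IsHodograph lam w (x₁, t₁) v → v (x₁, t₁) = u₁ →
        IsHodograph lam (fun k u => w k u - ∑ m, y.2.2 m * μ m k u) (y.1, t₁) v' →
        v' (y.1, t₁) = y.2.1 → FlowStep lam U i j Ω ((x₁, t₁), v) ((y.1, t₁), v') := by
  obtain ⟨V, A, hA, h1A, hV, hV1, hVm, hVh, hVd, hVx, huniq⟩ := exists_hodograph_family hyp hU₁ hw
    (fun m => (hμ m).1) hu₁ h₁ fun k h0 => by simpa [h0] using hp₁ k
  have hVdiff : ∀ y ∈ A, DifferentiableAt ℝ V y := fun y hy => smooth_differentiableAt hA hV hy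
  have hVx0 : ∀ y ∈ A, ∀ k, fderiv ℝ V y (1, 0, 0) k ≠ 0 := fun y hy k h0 => by
    simpa [h0] using hVx y hy k
  have hp₁V : fderiv ℝ V (x₁, t₁, 0) (1, 0, 0) = p₁ := by
    ext k
    have h2 := hVx _ h1A k
    simp only [hV1, Pi.zero_apply, zero_mul, Finset.sum_const_zero, sub_zero] at h2
    have hne : pd k (w k) u₁ - t₁ * pd k (lam k) u₁ ≠ 0 := fun h0 => by simpa [h0] using hp₁ k
    exact mul_right_cancel₀ hne (h2.trans (hp₁ k).symm)
  -- the motion of the base point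
  let κ : (Fin N → ℝ) × ℝ → ℝ × ℝ × (Fin N → ℝ) := fun y => (y.2, t₁, y.1)
  have hκ : ContDiff ℝ ∞ κ := by fun_prop
  have hκ' : ∀ y, HasFDerivAt κ ((ContinuousLinearMap.snd ℝ (Fin N → ℝ) ℝ).prod
      ((0 : (Fin N → ℝ) × ℝ →L[ℝ] ℝ).prod (ContinuousLinearMap.fst ℝ (Fin N → ℝ) ℝ))) y := fun y =>
    hasFDerivAt_snd.prodMk ((hasFDerivAt_const _ _).prodMk hasFDerivAt_fst)
  have hVκ : ∀ y, κ y ∈ A → HasFDerivAt (fun y => V (κ y)) ((fderiv ℝ V (κ y)).comp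
      ((ContinuousLinearMap.snd ℝ (Fin N → ℝ) ℝ).prod ((0 : (Fin N → ℝ) × ℝ →L[ℝ] ℝ).prod
        (ContinuousLinearMap.fst ℝ (Fin N → ℝ) ℝ)))) y := fun y hy =>
    HasFDerivAt.comp (g := V) (f := κ) y (hVdiff _ hy).hasFDerivAt (hκ' y)
  have hVκi : ∀ y, κ y ∈ A → ∀ e, fderiv ℝ (fun y => V (κ y) i - u₁ i) y e =
      fderiv ℝ V (κ y) (e.2, 0, e.1) i := by
    intro y hy e
    have h2 := (hasFDerivAt_pi'.1 (hVκ y hy) i).sub_const (u₁ i)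
    rw [h2.fderiv]; rfl
  have hO : IsOpen (κ ⁻¹' A) := hA.preimage hκ.continuous
  -- The base point is defined by keeping V^i at the value u₁^i. It is the unique solution near x₁
  -- because V^i_x ≠ 0.
  obtain ⟨X, AX, hAX, h0AX, hX, hX0, hXz, hXu⟩ := exists_smooth_implicit
    (H := fun y => V (κ y) i - u₁ i) (y₀ := (0 : Fin N → ℝ)) (e₀ := x₁) hO
    (((contDiffOn_pi.1 hV i).comp hκ.contDiffOn fun y hy => hy).sub contDiffOn_const) h1A
    (by simp [κ, hV1]) (by
      intro s hs
      rw [hVκi _ h1A] at hs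
      have h2 := hVd _ h1A (s, 0, 0) i
      simp only [κ] at hs
      rw [hs] at h2
      have h3 := hVx0 _ h1A i
      simpa [h3, eq_comm] using h2)
  -- Differentiating V^i = const gives the required law dx/dτ = -μ^i for the base point.
  have hXd : ∀ η ∈ AX, ∀ e, fderiv ℝ X η e = -∑ m, e m * μ m i (V (X η, t₁, η)) := by
    intro η hη e
    have hηA : κ (η, X η) ∈ A := (hXz η hη).1
    have h2 : HasFDerivAt (fun η => (η, X η)) ((ContinuousLinearMap.id ℝ (Fin N → ℝ)).prod
        (fderiv ℝ X η)) η :=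
      (hasFDerivAt_id η).prodMk (smooth_differentiableAt hAX hX hη).hasFDerivAt
    have h3 : HasFDerivAt (fun η => V (κ (η, X η))) _ η := HasFDerivAt.comp
      (g := fun y => V (κ y)) (f := fun η => (η, X η)) η (hVκ _ hηA) h2
    have h4 : (fun η => V (κ (η, X η)) i) =ᶠ[𝓝 η] fun _ => u₁ i := by
      filter_upwards [hAX.mem_nhds hη] with η' hη' using sub_eq_zero.1 (hXz η' hη').2
    have h5 := congrArg (fun L : (Fin N → ℝ) →L[ℝ] ℝ => L e)
      (((hasFDerivAt_pi'.1 h3 i).congr_of_eventuallyEq h4.symm).unique (hasFDerivAt_const _ _))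
    have h6 : fderiv ℝ V (κ (η, X η)) (fderiv ℝ X η e, 0, e) i = 0 := h5
    rw [hVd _ hηA] at h6
    have h7 := (mul_eq_zero.1 h6).resolve_right (hVx0 _ hηA i)
    simp only [zero_mul, add_zero] at h7
    exact eq_neg_of_add_eq_zero_left h7
  -- the parameters for which the motion takes place in `Ω`
  have hXc : ContinuousAt X 0 := (smooth_differentiableAt hAX hX h0AX).continuousAt
  have hYc : ContinuousAt (fun η => (X η, t₁, η)) 0 :=
    hXc.prodMk (continuousAt_const.prodMk continuousAt_id)
  have hVc : ContinuousAt (fun η => V (X η, t₁, η)) 0 :=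
    ContinuousAt.comp (g := V) (f := fun η => (X η, t₁, η))
      (by rw [hX0]; exact (hVdiff _ h1A).continuousAt) hYc
  have hVxc : ContinuousAt (fun η => fderiv ℝ V (X η, t₁, η) (1, 0, 0)) 0 :=
    ContinuousAt.comp (g := fun y => fderiv ℝ V y (1, 0, 0)) (f := fun η => (X η, t₁, η))
      (by rw [hX0]; exact (smooth_differentiableAt hA (smooth_fderiv_apply hA hV _)
        h1A).continuousAt) hYc
  have hJc : ContinuousAt (fun η => ((X η, t₁, V (X η, t₁, η),
      fderiv ℝ V (X η, t₁, η) (1, 0, 0)) : Jet n)) 0 :=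
    hXc.prodMk (continuousAt_const.prodMk (hVc.prodMk hVxc))
  have hJΩ : ∀ᶠ η in 𝓝 (0 : Fin N → ℝ), η ∈ AX ∧ ((X η, t₁, V (X η, t₁, η),
      fderiv ℝ V (X η, t₁, η) (1, 0, 0)) : Jet n) ∈ Ω := by
    have h2 : ∀ᶠ η in 𝓝 (0 : Fin N → ℝ), η ∈ AX := hAX.mem_nhds h0AX
    refine h2.and (hJc.preimage_mem_nhds (hΩ.mem_nhds ?_))
    rw [hX0, hV1, hp₁V]; exact hq₁
  obtain ⟨δ, hδ, hball⟩ := Metric.eventually_nhds_iff_ball.1 hJΩ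
  have c1 : Tendsto (fun y : ℝ × (Fin n → ℝ) × (Fin N → ℝ) => ((y.1, t₁, y.2.2), y.2.1))
      (𝓝 (x₁, u₁, 0)) (𝓝 ((x₁, t₁, 0), u₁)) :=
    (by fun_prop : Continuous fun y : ℝ × (Fin n → ℝ) × (Fin N → ℝ) =>
      ((y.1, t₁, y.2.2), y.2.1)).tendsto _
  have c2 : Tendsto (fun y : ℝ × (Fin n → ℝ) × (Fin N → ℝ) => (y.2.2, y.1))
      (𝓝 (x₁, u₁, 0)) (𝓝 (0, x₁)) :=
    (by fun_prop : Continuous fun y : ℝ × (Fin n → ℝ) × (Fin N → ℝ) => (y.2.2, y.1)).tendsto _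
  have c3 : Tendsto (fun y : ℝ × (Fin n → ℝ) × (Fin N → ℝ) => y.2.2) (𝓝 (x₁, u₁, 0)) (𝓝 0) :=
    (by fun_prop : Continuous fun y : ℝ × (Fin n → ℝ) × (Fin N → ℝ) => y.2.2).tendsto _
  filter_upwards [c1.eventually huniq.eventually_nhds, c2.eventually hXu,
    c3.eventually (Metric.ball_mem_nhds 0 hδ)]
    with ⟨x, u, ε⟩ hu1 hXu1 hε hui hh v v' hv hv1 hv' hv'1
  simp only at hu1 hXu1 hε hui hh hv' hv'1 ⊢
  have hVu : u = V (x, t₁, ε) := hu1.self_of_nhds hh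
  have hxX : x = X ε := hXu1 (by simp only [κ]; rw [← hVu, hui, sub_self])
  have hmem : ∀ τ ∈ Icc (0 : ℝ) 1, τ • ε ∈ Metric.ball (0 : Fin N → ℝ) δ := by
    intro τ hτ
    rw [dist_zero_right] at hε
    rw [mem_ball_zero_iff, norm_smul, Real.norm_of_nonneg hτ.1]
    exact (mul_le_of_le_one_left (norm_nonneg _) hτ.2).trans_lt hε
  let σ : ℝ × ℝ × ℝ → ℝ × ℝ × (Fin N → ℝ) := fun q => (q.1, q.2.1, q.2.2 • ε)
  have hσ : ContDiff ℝ ∞ σ := by fun_prop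
  have hfd : ∀ q, σ q ∈ A → ∀ e, fderiv ℝ (fun q => V (σ q)) q e =
      fderiv ℝ V (σ q) (e.1, e.2.1, e.2.2 • ε) := by
    intro q hq e
    have h2 : HasFDerivAt σ ((ContinuousLinearMap.fst ℝ ℝ (ℝ × ℝ)).prod
        (((ContinuousLinearMap.fst ℝ ℝ ℝ).comp (ContinuousLinearMap.snd ℝ ℝ (ℝ × ℝ))).prod
          (((ContinuousLinearMap.snd ℝ ℝ ℝ).comp
            (ContinuousLinearMap.snd ℝ ℝ (ℝ × ℝ))).smulRight ε))) q :=
      hasFDerivAt_fst.prodMk (hasFDerivAt_snd.fst.prodMk (hasFDerivAt_snd.snd.smul_const ε))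
    have h1 : HasFDerivAt (fun q => V (σ q)) _ q := HasFDerivAt.comp (g := V) (f := σ) q
      (hVdiff _ hq).hasFDerivAt h2
    rw [h1.fderiv]; rfl
  refine ⟨U₁, fun k u => ∑ m, ε m * μ m k u, σ ⁻¹' A, fun q => V (σ q), fun τ => X (τ • ε), t₁,
    hU₁, InSubalgebra.sum hw.isOpen fun m => (hμ m).const_mul (ε m),
    ⟨hA.preimage hσ.continuous, fun q hq => hVm hq, hV.comp hσ.contDiffOn fun q hq => hq,
      fun q hq k => ?_, fun q hq k => ?_⟩, fun τ hτ => ?_, ?_, ?_, ?_, ?_⟩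
  · rw [hfd q hq, hfd q hq, hVd _ hq]
    simp
  · rw [hfd q hq, hfd q hq, hVd _ hq]
    simp
  · obtain ⟨hτX, hτΩ⟩ := hball _ (hmem τ hτ)
    have hτA : σ (X (τ • ε), t₁, τ) ∈ A := (hXz _ hτX).1
    refine ⟨hτA, ?_, ?_⟩
    · have h2 : HasDerivAt (fun τ : ℝ => τ • ε) ε τ := by
        have := (hasDerivAt_id τ).smul_const ε
        rwa [one_smul] at this
      have h3 := (smooth_differentiableAt hAX hX hτX).hasFDerivAt.comp_hasDerivAt τ h2
      rw [hXd _ hτX] at h3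
      exact h3.hasDerivWithinAt
    · rw [hfd _ hτA, zero_smul]
      exact hτΩ
  · simp [hX0]
  · have hc : Tendsto (fun y : ℝ × ℝ => (((y.1, y.2, (0 : Fin N → ℝ)), v y))) (𝓝 (x₁, t₁))
        (𝓝 ((x₁, t₁, 0), u₁)) := by
      have h2 : ContinuousAt (fun y : ℝ × ℝ => (((y.1, y.2, (0 : Fin N → ℝ)), v y))) (x₁, t₁) :=
        (by fun_prop : Continuous fun y : ℝ × ℝ => (y.1, y.2, (0 : Fin N → ℝ))).continuousAt.prodMk
          hv.1
      rw [← hv1]; exact h2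
    filter_upwards [hc.eventually huniq, hv.2] with y h2 h3
    have := h2 (by simpa using h3)
    simpa [σ] using this
  · simp [hxX]
  · have hc : Tendsto (fun y : ℝ × ℝ => (((y.1, y.2, ε), v' y))) (𝓝 (x, t₁))
        (𝓝 ((x, t₁, ε), u)) := by
      have h2 : ContinuousAt (fun y : ℝ × ℝ => (((y.1, y.2, ε), v' y))) (x, t₁) :=
        (by fun_prop : Continuous fun y : ℝ × ℝ => (y.1, y.2, ε)).continuousAt.prodMk hv'.1
      rw [← hv'1]; exact h2
    filter_upwards [hc.eventually hu1, hv'.2] with y h2 h3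
    have := h2 (fun k => by rw [h3 k]; simp)
    simpa [σ] using this

theorem exists_isHodograph (hyp : IsStrictlyHyperbolic lam U) {U₁ : Set (Fin n → ℝ)} (hU₁ : U₁ ⊆ U)
    {w : Fin n → (Fin n → ℝ) → ℝ} (hw : IsCommutingFlow lam U₁ w) {x₁ t₁ : ℝ} {u₁ p₁ : Fin n → ℝ}
    (hu₁ : u₁ ∈ U₁) (h₁ : ∀ k, x₁ + lam k u₁ * t₁ = w k u₁)
    (hp₁ : ∀ k, p₁ k * (pd k (w k) u₁ - t₁ * pd k (lam k) u₁) = 1) :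
    ∃ v, IsHodograph lam w (x₁, t₁) v ∧ v (x₁, t₁) = u₁ := by
  obtain ⟨V, A, hA, h1A, hV, hV1, -, hVh, -⟩ := exists_hodograph_family hyp hU₁ hw
    (N := 0) (μ := fun m => m.elim0) (fun m => m.elim0) hu₁ h₁
    fun k h0 => by simpa [h0] using hp₁ k
  have hc : Continuous (fun y : ℝ × ℝ => (y.1, y.2, (0 : Fin 0 → ℝ))) := by fun_prop
  refine ⟨fun y => V (y.1, y.2, 0), ⟨?_, ?_⟩, hV1⟩
  · exact ContinuousAt.comp (g := V) (f := fun y : ℝ × ℝ => (y.1, y.2, (0 : Fin 0 → ℝ)))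
      (smooth_differentiableAt hA hV h1A).continuousAt hc.continuousAt
  · filter_upwards [hc.continuousAt.preimage_mem_nhds (hA.mem_nhds h1A)] with y hy k
    simpa using hVh _ hy k

/-! ### Transitivity of the flows on the solutions of a class -/

theorem reflTransGen_flowStep_symm {i j : Fin n} {Ω : Set (Jet n)} {A B : PointedFun n}
    (h : Relation.ReflTransGen (FlowStep lam U i j Ω) A B) :
    Relation.ReflTransGen (FlowStep lam U i j Ω) B A := by
  have : Std.Symm (FlowStep lam U i j Ω) := ⟨fun _ _ h => h.symm⟩
  exact symm_of _ h

/-- A weighted harmonic mean of two positive numbers lies between them. It occurs because convex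
combinations of hodograph data combine the reciprocals 1/u^k_x linearly. -/
theorem inv_convexComb_mem_of_pos {x y m M τ : ℝ} (hx : 0 < x) (hy : 0 < y)
    (hxI : x ∈ Ioo m M) (hyI : y ∈ Ioo m M) (hτ : τ ∈ Icc (0 : ℝ) 1) :
    (1 - τ) * x⁻¹ + τ * y⁻¹ ≠ 0 ∧ ((1 - τ) * x⁻¹ + τ * y⁻¹)⁻¹ ∈ Ioo m M := by
  have h1 : (1 - τ) * x⁻¹ + τ * y⁻¹ = ((1 - τ) * y + τ * x) / (x * y) := by
    field_simp
  have h2 : 0 < (1 - τ) * y + τ * x := by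
    rcases lt_or_eq_of_le hτ.1 with h | h
    · have := mul_nonneg (sub_nonneg.2 hτ.2) hy.le
      have := mul_pos h hx
      linarith
    · rw [← h]; simpa using hy
  have h3 : 0 ≤ (1 - τ) * y := mul_nonneg (sub_nonneg.2 hτ.2) hy.le
  have h4 : 0 ≤ τ * x := mul_nonneg hτ.1 hx.le
  -- For an endpoint c of the interval, the first factor is the numerator of the harmonic mean minus
  -- c; it has the sign of x - c.
  have key : ∀ c : ℝ, x - c ≠ 0 → 0 < (x - c) * (y - c) →
      0 < ((1 - τ) * y * (x - c) + τ * x * (y - c)) * (x - c) := by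
    intro c hc hcc
    rcases lt_or_eq_of_le hτ.1 with h | h
    · have e1 : 0 ≤ (1 - τ) * y * (x - c) ^ 2 := mul_nonneg h3 (sq_nonneg _)
      have e2 : 0 < τ * x * ((x - c) * (y - c)) := mul_pos (mul_pos h hx) hcc
      linarith
    · rw [← h]
      have : 0 < y * (x - c) ^ 2 := mul_pos hy (by positivity)
      linarith
  have k1 := key m (by linarith [hxI.1]) (mul_pos (sub_pos.2 hxI.1) (sub_pos.2 hyI.1))
  have k2 := key M (by linarith [hxI.2]) (mul_pos_of_neg_of_neg (sub_neg.2 hxI.2) (sub_neg.2 hyI.2))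
  have k1' := (pos_iff_pos_of_mul_pos k1).2 (sub_pos.2 hxI.1)
  have k2' := (neg_iff_neg_of_mul_pos k2).2 (sub_neg.2 hxI.2)
  rw [h1, inv_div]
  refine ⟨(div_pos h2 (mul_pos hx hy)).ne', ?_, ?_⟩
  · rw [lt_div_iff₀ h2]; linarith
  · rw [div_lt_iff₀ h2]; linarith

theorem inv_convexComb_mem {x y m M τ : ℝ} (h0 : (0 : ℝ) ∉ Ioo m M) (hx : x ∈ Ioo m M)
    (hy : y ∈ Ioo m M) (hτ : τ ∈ Icc (0 : ℝ) 1) :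
    (1 - τ) * x⁻¹ + τ * y⁻¹ ≠ 0 ∧ ((1 - τ) * x⁻¹ + τ * y⁻¹)⁻¹ ∈ Ioo m M := by
  by_cases hm : 0 ≤ m
  · exact inv_convexComb_mem_of_pos (hm.trans_lt hx.1) (hm.trans_lt hy.1) hx hy hτ
  · have hM : M ≤ 0 := by
      by_contra hM
      exact h0 ⟨not_le.1 hm, not_le.1 hM⟩
    have h1 := inv_convexComb_mem_of_pos (x := -x) (y := -y) (m := -M) (M := -m)
      (by linarith [hx.2]) (by linarith [hy.2]) ⟨by linarith [hx.2], by linarith [hx.1]⟩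
      ⟨by linarith [hy.2], by linarith [hy.1]⟩ hτ
    have h2 : (1 - τ) * (-x)⁻¹ + τ * (-y)⁻¹ = -((1 - τ) * x⁻¹ + τ * y⁻¹) := by
      rw [inv_neg, inv_neg]; ring
    rw [h2, inv_neg] at h1
    exact ⟨fun h => h1.1 (by rw [h, neg_zero]), by linarith [h1.2.2], by linarith [h1.2.1]⟩

theorem InClass.mono {i j : Fin n} {ρ : (Fin n → ℝ) → ℝ} {U₁ U₂ : Set (Fin n → ℝ)}
    {w : Fin n → (Fin n → ℝ) → ℝ} (h : InClass lam i j ρ U₁ w) (ho : IsOpen U₂) (hs : U₂ ⊆ U₁) :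
    InClass lam i j ρ U₂ w :=
  ⟨h.1.mono ho hs, fun u hu => h.2 u (hs hu)⟩

theorem InClass.sub {i j : Fin n} {ρ σ : (Fin n → ℝ) → ℝ} {U₁ : Set (Fin n → ℝ)}
    {w w' : Fin n → (Fin n → ℝ) → ℝ} (h : InClass lam i j ρ U₁ w)
    (h' : InClass lam i j σ U₁ w') :
    InClass lam i j (fun u => ρ u - σ u) U₁ (fun k u => w k u - w' k u) :=
  ⟨h.1.sub h'.1, fun u hu => by
    rw [pd_sub (h.1.differentiableAt i hu) (h'.1.differentiableAt i hu), h.2 u hu, h'.2 u hu]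
    ring⟩

theorem inClass_zero_iff {i j : Fin n} {U₁ : Set (Fin n → ℝ)} {μ : Fin n → (Fin n → ℝ) → ℝ} :
    InClass lam i j (fun _ => 0) U₁ μ ↔ InSubalgebra lam i j U₁ μ := by
  simp only [InClass, InSubalgebra, add_zero]

theorem InClass.sub_subalgebra {i j : Fin n} {ρ : (Fin n → ℝ) → ℝ} {U₁ : Set (Fin n → ℝ)}
    {w μ : Fin n → (Fin n → ℝ) → ℝ} (h : InClass lam i j ρ U₁ w)
    (h' : InSubalgebra lam i j U₁ μ) : InClass lam i j ρ U₁ (fun k u => w k u - μ k u) := by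
  have := h.sub (inClass_zero_iff.2 h')
  simpa using this

/-- The germ of `v` is the solution with the jet `q` in hodograph form, for a commuting flow of the
class of `ρ`. -/
def IsClassGerm (lam : Fin n → (Fin n → ℝ) → ℝ) (i j : Fin n) (B : Set (Fin n → ℝ))
    (ρ : (Fin n → ℝ) → ℝ) (q : Jet n) (v : ℝ × ℝ → Fin n → ℝ) : Prop :=
  ∃ (U' : Set (Fin n → ℝ)) (w : Fin n → (Fin n → ℝ) → ℝ), q.2.2.1 ∈ U' ∧ U' ⊆ B ∧
    InClass lam i j ρ U' w ∧ IsHodograph lam w (q.1, q.2.1) v ∧ v (q.1, q.2.1) = q.2.2.1 ∧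
    ∀ k, q.2.2.2 k * (pd k (w k) q.2.2.1 - q.2.1 * pd k (lam k) q.2.2.1) = 1

theorem IsHodograph.eq {w : Fin n → (Fin n → ℝ) → ℝ} {x t : ℝ} {u : Fin n → ℝ}
    {v : ℝ × ℝ → Fin n → ℝ} (h : IsHodograph lam w (x, t) v) (hv : v (x, t) = u) (k : Fin n) :
    x + lam k u * t = w k u := by
  have := h.2.self_of_nhds k
  rwa [hv] at this

/-- The neighbourhood in the jet space in which the orbits are described. -/
structure IsOrbitChart (lam : Fin n → (Fin n → ℝ) → ℝ) (U : Set (Fin n → ℝ)) (i j : Fin n)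
    (Ω : Set (Jet n)) (y₀ : ℝ × ℝ × (Fin n → ℝ)) (p₀ : Fin n → ℝ) (δ r : ℝ)
    (θ : ℝ × ℝ × (Fin n → ℝ) → ℝ) (ρ : (Fin n → ℝ) → ℝ) : Prop where
  isOpen : IsOpen Ω
  pos : 0 < r
  compat : IsCompatible lam U i j (Metric.ball y₀.2.2 δ) ρ
  theta : ∀ y ∈ Metric.ball y₀ δ, θ y =
    b lam i j y.2.2 * (y.1 + lam i y.2.2 * y.2.1) - pd i (lam i) y.2.2 * y.2.1 + ρ y.2.2
  inv_mem : ∀ y ∈ Metric.ball y₀ δ, (θ y)⁻¹ ∈ Metric.ball (p₀ i) r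
  ne_zero : ∀ p ∈ Metric.ball p₀ r, ∀ k, p k ≠ 0
  subset : ∀ y ∈ Metric.ball y₀ δ, ∀ p ∈ Metric.ball p₀ r, mkJet y p ∈ Ω

theorem IsOrbitChart.zero_notMem {i j : Fin n} {Ω : Set (Jet n)} {y₀ : ℝ × ℝ × (Fin n → ℝ)}
    {p₀ : Fin n → ℝ} {δ r : ℝ} {θ : ℝ × ℝ × (Fin n → ℝ) → ℝ} {ρ : (Fin n → ℝ) → ℝ}
    (h : IsOrbitChart lam U i j Ω y₀ p₀ δ r θ ρ) (k : Fin n) :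
    (0 : ℝ) ∉ Metric.ball (p₀ k) r := by
  intro h0
  refine h.ne_zero (Function.update p₀ k 0) ?_ k (Function.update_self ..)
  rw [Metric.mem_ball, dist_pi_lt_iff h.pos]
  intro m
  by_cases hm : m = k
  · subst hm; rwa [Function.update_self]
  · rw [Function.update_of_ne hm, dist_self]; exact h.pos

theorem mem_ball_pi_iff {p p₀ : Fin n → ℝ} {r : ℝ} (hr : 0 < r) :
    p ∈ Metric.ball p₀ r ↔ ∀ k, p k ∈ Metric.ball (p₀ k) r := by
  simp only [Metric.mem_ball, dist_pi_lt_iff hr]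

/-- Two germs of the same class with the same value at the same base point are connected. -/
theorem IsOrbitChart.connected_of_base_eq (hyp : IsStrictlyHyperbolic lam U) {i j : Fin n}
    {Ω : Set (Jet n)} {y₀ : ℝ × ℝ × (Fin n → ℝ)} {p₀ : Fin n → ℝ} {δ r : ℝ}
    {θ : ℝ × ℝ × (Fin n → ℝ) → ℝ} {ρ : (Fin n → ℝ) → ℝ}
    (h : IsOrbitChart lam U i j Ω y₀ p₀ δ r θ ρ) {y : ℝ × ℝ × (Fin n → ℝ)}
    (hy : y ∈ Metric.ball y₀ δ) {p p' : Fin n → ℝ} (hp : p ∈ Metric.ball p₀ r)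
    (hp' : p' ∈ Metric.ball p₀ r) {v v' : ℝ × ℝ → Fin n → ℝ}
    (hv : IsClassGerm lam i j (Metric.ball y₀.2.2 δ) ρ (mkJet y p) v)
    (hv' : IsClassGerm lam i j (Metric.ball y₀.2.2 δ) ρ (mkJet y p') v') :
    Relation.ReflTransGen (FlowStep lam U i j Ω) ((y.1, y.2.1), v) ((y.1, y.2.1), v') := by
  obtain ⟨x, t, u⟩ := y
  obtain ⟨U₀, w₀, hu0, hU₀, hw0, hh0, hv0, hd0⟩ := hv
  obtain ⟨U₁, w₁, hu1, hU₁, hw1, hh1, hv1, hd1⟩ := hv'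
  simp only [mkJet] at hu0 hh0 hv0 hd0 hu1 hh1 hv1 hd1 ⊢
  have hUo : IsOpen (U₀ ∩ U₁) := hw0.1.isOpen.inter hw1.1.isOpen
  have hUU : U₀ ∩ U₁ ⊆ U := fun u hu => h.compat.subset (hU₀ hu.1)
  have hw0' := hw0.mono hUo inter_subset_left
  have hw1' := hw1.mono hUo inter_subset_right
  have huU : u ∈ U₀ ∩ U₁ := ⟨hu0, hu1⟩
  let μ : Fin n → (Fin n → ℝ) → ℝ := fun k u => w₀ k u - w₁ k u
  have hμ : InSubalgebra lam i j (U₀ ∩ U₁) μ := by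
    rw [← inClass_zero_iff]
    have := hw0'.sub hw1'
    simpa using this
  -- The straight path between the two data. The difference μ vanishes at `u`, so every member of
  -- the path passes through the same point (x, t, u).
  let w : ℝ → Fin n → (Fin n → ℝ) → ℝ := fun τ k u => w₀ k u - τ * μ k u
  have hw : ∀ τ, IsCommutingFlow lam (U₀ ∩ U₁) (w τ) := fun τ => hw0'.1.sub (hμ.1.const_mul τ)
  have hμ0 : ∀ k, μ k u = 0 := fun k => by
    simp only [μ]; rw [← hh0.eq hv0, ← hh1.eq hv1, sub_self]
  have hwu : ∀ τ k, x + lam k u * t = w τ k u := fun τ k => by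
    simp only [w]; rw [hμ0, mul_zero, sub_zero, hh0.eq hv0]
  -- The derivatives u^k_x along the path are harmonic means of the end values, hence remain in the
  -- ball, which avoids zero.
  let P : ℝ → Fin n → ℝ := fun τ k => ((1 - τ) * (p k)⁻¹ + τ * (p' k)⁻¹)⁻¹
  have hcomb : ∀ τ ∈ Icc (0 : ℝ) 1, ∀ k, (1 - τ) * (p k)⁻¹ + τ * (p' k)⁻¹ ≠ 0 ∧
      P τ k ∈ Metric.ball (p₀ k) r := by
    intro τ hτ k
    have h0 := h.zero_notMem k
    have h1 := (mem_ball_pi_iff h.pos).1 hp k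
    have h2 := (mem_ball_pi_iff h.pos).1 hp' k
    rw [Real.ball_eq_Ioo] at h0 h1 h2 ⊢
    exact inv_convexComb_mem h0 h1 h2 hτ
  have hPb : ∀ τ ∈ Icc (0 : ℝ) 1, P τ ∈ Metric.ball p₀ r := fun τ hτ =>
    (mem_ball_pi_iff h.pos).2 fun k => (hcomb τ hτ k).2
  have hPd : ∀ τ ∈ Icc (0 : ℝ) 1, ∀ k,
      P τ k * (pd k (w τ k) u - t * pd k (lam k) u) = 1 := by
    intro τ hτ k
    have e0 := inv_eq_of_mul_eq_one_right (hd0 k)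
    have e1 := inv_eq_of_mul_eq_one_right (hd1 k)
    have d0 := hw0'.1.differentiableAt k huU
    have d1 := hw1'.1.differentiableAt k huU
    have e2 : pd k (w τ k) u - t * pd k (lam k) u = (1 - τ) * (p k)⁻¹ + τ * (p' k)⁻¹ := by
      simp only [w, μ]
      rw [pd_sub d0 ((d0.fun_sub d1).const_mul τ), pd_const_mul (d0.fun_sub d1), pd_sub d0 d1,
        e0, e1]
      ring
    rw [e2]
    exact inv_mul_cancel₀ (hcomb τ hτ k).1
  -- `eventually_flowStep` supplies only short steps; preconnectedness of [0, 1] chains them. The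
  -- claim is made for all representatives of the germs, so that intermediate germs can be chosen
  -- freely.
  have key := (isPreconnected_Icc (a := (0 : ℝ)) (b := 1)).induction₂
    (fun τ τ' => ∀ v v', IsHodograph lam (w τ) (x, t) v → v (x, t) = u →
      IsHodograph lam (w τ') (x, t) v' → v' (x, t) = u →
      Relation.ReflTransGen (FlowStep lam U i j Ω) ((x, t), v) ((x, t), v'))
    (fun τ hτ => by
      have h1 := eventually_flowStep hyp h.isOpen hUU (hw τ) (N := 1) (μ := fun _ => μ)
        (fun _ => hμ) huU (hwu τ) (hPd τ hτ) (h.subset _ hy _ (hPb τ hτ))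
      have h2 : Tendsto (fun τ' : ℝ => (x, u, fun _ : Fin 1 => τ' - τ)) (𝓝 τ) (𝓝 (x, u, 0)) := by
        have h3 : Continuous (fun τ' : ℝ => (x, u, fun _ : Fin 1 => τ' - τ)) := by fun_prop
        have := h3.tendsto τ
        simp only [sub_self] at this
        exact this
      filter_upwards [(h2.eventually h1).filter_mono nhdsWithin_le_nhds] with τ' h3 v v' hv hvu
        hv' hvu'
      refine Relation.ReflTransGen.single (h3 rfl (fun k => ?_) v v' hv hvu ?_ hvu')
      · simp [hμ0, hwu τ k]
      · have : (fun k u => w τ k u - ∑ m : Fin 1, (τ' - τ) * μ k u) = w τ' := by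
          funext k u; simp [w]; ring
        rw [this]; exact hv')
    (fun τ₁ τ₂ τ₃ _ h2 _ h12 h23 v v' hv hvu hv' hvu' => by
      obtain ⟨v₂, hv₂, hv₂u⟩ := exists_isHodograph hyp hUU (hw τ₂) huU (hwu τ₂) (hPd τ₂ h2)
      exact (h12 v v₂ hv hvu hv₂ hv₂u).trans (h23 v₂ v' hv₂ hv₂u hv' hvu'))
    (fun τ₁ τ₂ _ _ h12 v v' hv hvu hv' hvu' =>
      reflTransGen_flowStep_symm (h12 v' v hv' hvu' hv hvu))
    (left_mem_Icc.2 zero_le_one) (right_mem_Icc.2 zero_le_one)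
  have e0 : w 0 = w₀ := by funext k u; simp [w]
  have e1 : w 1 = w₁ := by funext k u; simp [w, μ]
  rw [e0, e1] at key
  exact key v v' hh0 hv0 hh1 hv1

/-- The free derivatives ∂_k w^k are chosen so that u^k_x = p₀^k for k ≠ i. The class forces u^i_x =
1/θ, and `inv_mem` of the chart puts this value in the ball. -/
theorem IsOrbitChart.exists_inClass (hyp : IsStrictlyHyperbolic lam U)
    (semi : IsSemihamiltonian lam U) {i j : Fin n} (hij : j ≠ i)
    (hlam : ∀ u ∈ U, pd j (lam i) u ≠ 0) {Ω : Set (Jet n)} {y₀ : ℝ × ℝ × (Fin n → ℝ)}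
    {p₀ : Fin n → ℝ} {δ r : ℝ} {θ : ℝ × ℝ × (Fin n → ℝ) → ℝ} {ρ : (Fin n → ℝ) → ℝ}
    (h : IsOrbitChart lam U i j Ω y₀ p₀ δ r θ ρ) {x t : ℝ} {u : Fin n → ℝ}
    (hy : (x, t, u) ∈ Metric.ball y₀ δ) :
    ∃ (U' : Set (Fin n → ℝ)) (w : Fin n → (Fin n → ℝ) → ℝ) (p : Fin n → ℝ),
      p ∈ Metric.ball p₀ r ∧ u ∈ U' ∧ U' ⊆ Metric.ball y₀.2.2 δ ∧ InClass lam i j ρ U' w ∧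
      (∀ k, x + lam k u * t = w k u) ∧
      ∀ k, p k * (pd k (w k) u - t * pd k (lam k) u) = 1 := by
  have hu : u ∈ Metric.ball y₀.2.2 δ := by
    simp only [Metric.mem_ball, Prod.dist_eq, max_lt_iff] at hy ⊢
    exact hy.2.2
  have hp₀ : ∀ k, p₀ k ≠ 0 := h.ne_zero p₀ (Metric.mem_ball_self h.pos)
  obtain ⟨U', w, huU', hU', hw, hwu, hwd⟩ := h.compat.exists_inClass hyp semi hij hlam hu
    (fun k => x + lam k u * t) (fun k => (p₀ k)⁻¹ + t * pd k (lam k) u)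
  refine ⟨U', w, fun k => if k = i then (θ (x, t, u))⁻¹ else p₀ k, ?_, huU', hU', hw,
    fun k => (hwu k).symm, fun k => ?_⟩
  · refine (mem_ball_pi_iff h.pos).2 fun k => ?_
    by_cases hk : k = i
    · subst hk; simpa using h.inv_mem _ hy
    · simpa [hk] using h.pos
  · beta_reduce
    by_cases hk : k = i
    · subst hk
      have hθ0 : θ (x, t, u) ≠ 0 := by
        intro h0
        have h1 := h.inv_mem _ hy
        rw [h0, inv_zero] at h1
        exact h.zero_notMem k h1
      have h1 := h.theta _ hy
      simp only at h1
      rw [if_pos rfl, hw.2 u huU', hwu k]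
      field_simp
      linarith
    · rw [if_neg hk, hwd k hk, add_sub_cancel_right, mul_inv_cancel₀ (hp₀ k)]

/-- Near a point, the germs of the class are reached from a given one by the flows of the subalgebra. -/
theorem IsOrbitChart.eventually_connected (hyp : IsStrictlyHyperbolic lam U)
    (semi : IsSemihamiltonian lam U) {i j : Fin n} (hij : j ≠ i)
    (hlam : ∀ u ∈ U, pd j (lam i) u ≠ 0) {Ω : Set (Jet n)} {y₀ : ℝ × ℝ × (Fin n → ℝ)}
    {p₀ : Fin n → ℝ} {δ r : ℝ} {θ : ℝ × ℝ × (Fin n → ℝ) → ℝ} {ρ : (Fin n → ℝ) → ℝ}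
    (h : IsOrbitChart lam U i j Ω y₀ p₀ δ r θ ρ) {x t : ℝ} {u : Fin n → ℝ}
    (hy : (x, t, u) ∈ Metric.ball y₀ δ) :
    ∃ p ∈ Metric.ball p₀ r, ∃ v, IsClassGerm lam i j (Metric.ball y₀.2.2 δ) ρ (mkJet (x, t, u) p) v ∧
      ∀ᶠ c in 𝓝 (x, u), c.2 i = u i → ∃ p' ∈ Metric.ball p₀ r, ∃ v',
        IsClassGerm lam i j (Metric.ball y₀.2.2 δ) ρ (mkJet (c.1, t, c.2) p') v' ∧
        FlowStep lam U i j Ω ((x, t), v) ((c.1, t), v') := by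
  obtain ⟨U₀, w, p, hp, huU₀, hU₀, hw₀, hwu, hwp⟩ := h.exists_inClass hyp semi hij hlam hy
  -- Elements of the subalgebra whose values at `u` are the basis vectors, so that the parameters
  -- ε_m move the values of the data at `u` independently.
  choose Um μ huUm hUm hμm hμu hμd using fun m : Fin n =>
    h.compat.zero.exists_inClass hyp semi hij hlam (hU₀ huU₀) (Pi.single m 1) 0
  set U₁ : Set (Fin n → ℝ) := U₀ ∩ ⋂ m, Um m with hU₁
  have hU₁o : IsOpen U₁ := hw₀.1.isOpen.inter (isOpen_iInter_of_finite fun m => (hμm m).1.isOpen)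
  have huU₁ : u ∈ U₁ := ⟨huU₀, mem_iInter.2 huUm⟩
  have hU₁B : U₁ ⊆ Metric.ball y₀.2.2 δ := inter_subset_left.trans hU₀
  have hU₁U : U₁ ⊆ U := hU₁B.trans h.compat.subset
  have hw := hw₀.mono hU₁o inter_subset_left
  have hμ : ∀ m, InSubalgebra lam i j U₁ (μ m) := fun m => inClass_zero_iff.1
    ((hμm m).mono hU₁o (inter_subset_right.trans (iInter_subset _ m)))
  obtain ⟨v, hv, hvu⟩ := exists_isHodograph hyp hU₁U hw.1 huU₁ hwu hwp
  have hl := hyp.isCommutingFlow_lam.mono hU₁o hU₁U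
  -- the parameters of the flow
  let H : (ℝ × (Fin n → ℝ)) × (Fin n → ℝ) → Fin n → ℝ := fun y k =>
    y.1.1 + lam k y.1.2 * t + ∑ m, y.2 m * μ m k y.1.2 - w k y.1.2
  set O : Set ((ℝ × (Fin n → ℝ)) × (Fin n → ℝ)) := {y | y.1.2 ∈ U₁} with hO
  have hOo : IsOpen O := hU₁o.preimage (by fun_prop)
  have hsm : ∀ {f : (Fin n → ℝ) → ℝ}, ContDiffOn ℝ ∞ f U₁ →
      ContDiffOn ℝ ∞ (fun y : (ℝ × (Fin n → ℝ)) × (Fin n → ℝ) => f y.1.2) O := fun hf =>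
    hf.comp (ContDiff.contDiffOn (by fun_prop)) fun y hy => hy
  have hH : ContDiffOn ℝ ∞ H O := by
    refine contDiffOn_pi.2 fun k => ContDiffOn.sub (ContDiffOn.add (ContDiffOn.add
      (ContDiff.contDiffOn (by fun_prop)) ((hsm (hl.smooth k)).mul contDiffOn_const))
      (ContDiffOn.sum fun m _ => ContDiffOn.mul (ContDiff.contDiffOn (by fun_prop))
        (hsm ((hμ m).1.smooth k)))) (hsm (hw.1.smooth k))
  -- At the point itself H is the identity in the parameters; this is the nondegeneracy needed to
  -- solve for ε as a function of the new base point and value.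
  have hHu : ∀ e k, H ((x, u), e) k = e k := by
    intro e k
    simp only [H, hμu, hwu k]
    simp [Pi.single_apply]
  obtain ⟨ε, A, hA, h1A, hε, hε0, hεz, -⟩ := exists_smooth_implicit (y₀ := (x, u))
    (e₀ := (0 : Fin n → ℝ)) hOo hH huU₁ (by ext k; rw [hHu]) (by
      intro e he
      have h1 : HasFDerivAt (fun e : Fin n → ℝ => ((x, u), e)) (ContinuousLinearMap.inr ℝ
          (ℝ × (Fin n → ℝ)) (Fin n → ℝ)) 0 := (hasFDerivAt_const _ _).prodMk (hasFDerivAt_id _)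
      have h2 := HasFDerivAt.comp (g := H) (f := fun e : Fin n → ℝ => ((x, u), e)) 0
        (smooth_differentiableAt hOo hH huU₁).hasFDerivAt h1
      have h3 : H ∘ (fun e : Fin n → ℝ => ((x, u), e)) = id := by
        funext e k; exact hHu e k
      rw [h3] at h2
      have h4 := congrArg (fun L : (Fin n → ℝ) →L[ℝ] (Fin n → ℝ) => L e)
        (h2.unique (hasFDerivAt_id 0))
      exact h4.symm.trans he)
  have hεc : ContinuousAt ε (x, u) := (smooth_differentiableAt hA hε h1A).continuousAt
  have hstep := eventually_flowStep hyp h.isOpen hU₁U hw.1 hμ huU₁ hwu hwp (h.subset _ hy _ hp)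
  have hc1 : Tendsto (fun c : ℝ × (Fin n → ℝ) => (c.1, c.2, ε c)) (𝓝 (x, u)) (𝓝 (x, u, 0)) := by
    have h1 : ContinuousAt (fun c : ℝ × (Fin n → ℝ) => (c.1, c.2, ε c)) (x, u) :=
      continuousAt_fst.prodMk (continuousAt_snd.prodMk hεc)
    rw [← hε0]; exact h1
  -- the derivatives of the new solution
  let D : Fin n → ℝ × (Fin n → ℝ) → ℝ := fun k c =>
    pd k (w k) c.2 - ∑ m, ε c m * pd k (μ m k) c.2 - t * pd k (lam k) c.2
  have hDu : ∀ k, D k (x, u) = pd k (w k) u - t * pd k (lam k) u := fun k => by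
    simp [D, hε0]
  have hpd : ∀ {f : (Fin n → ℝ) → ℝ} k, ContDiffOn ℝ ∞ f U₁ →
      ContinuousAt (fun c : ℝ × (Fin n → ℝ) => pd k f c.2) (x, u) := fun {f} k hf =>
    ContinuousAt.comp (g := pd k f) (f := fun c : ℝ × (Fin n → ℝ) => c.2) (x := (x, u))
      (smooth_differentiableAt hU₁o (smooth_pd hU₁o hf k) huU₁).continuousAt continuousAt_snd
  have hDc : ∀ k, ContinuousAt (D k) (x, u) := fun k => by
    refine ((hpd k (hw.1.smooth k)).sub (tendsto_finsetSum _ fun m _ =>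
      ContinuousAt.mul ?_ (hpd k ((hμ m).1.smooth k)))).sub
        (continuousAt_const.mul (hpd k (hl.smooth k)))
    exact (continuous_apply m).continuousAt.comp hεc
  have hD0 : ∀ k, D k (x, u) ≠ 0 := fun k h0 => by
    have := hwp k; rw [← hDu, h0] at this; simp at this
  have hDe : ∀ᶠ c in 𝓝 (x, u), ∀ k, D k c ≠ 0 ∧ (D k c)⁻¹ ∈ Metric.ball (p₀ k) r := by
    rw [eventually_all]
    intro k
    refine ((hDc k).eventually_ne (hD0 k)).and
      (((hDc k).inv₀ (hD0 k)).preimage_mem_nhds (Metric.isOpen_ball.mem_nhds ?_))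
    have h1 : (D k (x, u))⁻¹ = p k := by
      rw [hDu]; exact inv_eq_of_mul_eq_one_left (hwp k)
    rw [Pi.inv_apply, h1]
    exact (mem_ball_pi_iff h.pos).1 hp k
  refine ⟨p, hp, v, ⟨U₁, w, huU₁, hU₁B, hw, hv, hvu, hwp⟩, ?_⟩
  filter_upwards [hc1.eventually hstep, hDe, hA.mem_nhds h1A] with c h1 h2 h3 hci
  obtain ⟨hcU, hcz⟩ := hεz c h3
  have hw' : InClass lam i j ρ U₁ (fun k u => w k u - ∑ m, ε c m * μ m k u) :=
    hw.sub_subalgebra (InSubalgebra.sum hU₁o fun m => (hμ m).const_mul (ε c m))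
  have heq : ∀ k, c.1 + lam k c.2 * t + ∑ m, ε c m * μ m k c.2 = w k c.2 := fun k =>
    sub_eq_zero.1 (congrFun hcz k)
  have hder : ∀ k, (D k c)⁻¹ * (pd k (fun u => w k u - ∑ m, ε c m * μ m k u) c.2 -
      t * pd k (lam k) c.2) = 1 := by
    intro k
    have hd : ∀ m, DifferentiableAt ℝ (μ m k) c.2 := fun m => (hμ m).1.differentiableAt k hcU
    rw [pd_sub (hw.1.differentiableAt k hcU) (DifferentiableAt.fun_sum fun m _ =>
      (hd m).const_mul (ε c m)), pd_sum fun m _ => (hd m).const_mul (ε c m)]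
    simp only [pd_const_mul (hd _)]
    exact inv_mul_cancel₀ (h2 k).1
  have heq' : ∀ k, c.1 + lam k c.2 * t = w k c.2 - ∑ m, ε c m * μ m k c.2 := fun k => by
    linarith [heq k]
  obtain ⟨v', hv', hvu'⟩ := exists_isHodograph hyp hU₁U hw'.1 hcU heq' hder
  exact ⟨fun k => (D k c)⁻¹, (mem_ball_pi_iff h.pos).2 fun k => (h2 k).2, v',
    ⟨U₁, _, hcU, hU₁B, hw', hv', hvu', hder⟩, h1 hci heq v v' hv hvu hv' hvu'⟩

/-- Any two germs of the class with the same `t` and `uⁱ` at the base points are connected. -/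
theorem IsOrbitChart.connected (hyp : IsStrictlyHyperbolic lam U)
    (semi : IsSemihamiltonian lam U) {i j : Fin n} (hij : j ≠ i)
    (hlam : ∀ u ∈ U, pd j (lam i) u ≠ 0) {Ω : Set (Jet n)} {y₀ : ℝ × ℝ × (Fin n → ℝ)}
    {p₀ : Fin n → ℝ} {δ r : ℝ} {θ : ℝ × ℝ × (Fin n → ℝ) → ℝ} {ρ : (Fin n → ℝ) → ℝ}
    (h : IsOrbitChart lam U i j Ω y₀ p₀ δ r θ ρ) {x x' t : ℝ} {u u' : Fin n → ℝ}
    (hy : (x, t, u) ∈ Metric.ball y₀ δ) (hy' : (x', t, u') ∈ Metric.ball y₀ δ) (hi : u' i = u i)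
    {p p' : Fin n → ℝ} (hp : p ∈ Metric.ball p₀ r) (hp' : p' ∈ Metric.ball p₀ r)
    {v v' : ℝ × ℝ → Fin n → ℝ}
    (hv : IsClassGerm lam i j (Metric.ball y₀.2.2 δ) ρ (mkJet (x, t, u) p) v)
    (hv' : IsClassGerm lam i j (Metric.ball y₀.2.2 δ) ρ (mkJet (x', t, u') p') v') :
    Relation.ReflTransGen (FlowStep lam U i j Ω) ((x, t), v) ((x', t), v') := by
  -- The possible pairs of x and u at a base point with t and u^i fixed. It is a slice of a ball,
  -- hence convex and preconnected.
  set C : Set (ℝ × (Fin n → ℝ)) := {c | (c.1, t, c.2) ∈ Metric.ball y₀ δ ∧ c.2 i = u i} with hC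
  have hCc : Convex ℝ C := by
    intro c hc d hd α β hα hβ hαβ
    refine ⟨?_, ?_⟩
    · have h1 := convex_ball y₀ δ hc.1 hd.1 hα hβ hαβ
      have h2 : α * t + β * t = t := by rw [← add_mul, hαβ, one_mul]
      simpa [h2] using h1
    · simp only [Prod.snd_add, Prod.smul_snd, Pi.add_apply, Pi.smul_apply, smul_eq_mul, hc.2, hd.2]
      rw [← add_mul, hαβ, one_mul]
  refine (hCc.isPreconnected).induction₂ (fun c c' : ℝ × (Fin n → ℝ) =>
    ∀ p ∈ Metric.ball p₀ r, ∀ p' ∈ Metric.ball p₀ r, ∀ v v',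
      IsClassGerm lam i j (Metric.ball y₀.2.2 δ) ρ (mkJet (c.1, t, c.2) p) v →
      IsClassGerm lam i j (Metric.ball y₀.2.2 δ) ρ (mkJet (c'.1, t, c'.2) p') v' →
      Relation.ReflTransGen (FlowStep lam U i j Ω) ((c.1, t), v) ((c'.1, t), v')) ?_ ?_ ?_
    (x := (x, u)) (y := (x', u')) ⟨hy, rfl⟩ ⟨hy', hi⟩ p hp p' hp' v v' hv hv'
  · rintro ⟨c, w⟩ hc
    obtain ⟨q, hq, f, hf, hfe⟩ := h.eventually_connected hyp semi hij hlam hc.1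
    filter_upwards [hfe.filter_mono nhdsWithin_le_nhds, self_mem_nhdsWithin] with c' h1 hc' p hp p'
      hp' v v' hv hv'
    -- The short step joins specially chosen germs; on both sides it is completed by a path between
    -- germs with equal base point and value.
    obtain ⟨q', hq', f', hf', hstep⟩ := h1 (hc'.2.trans hc.2.symm)
    exact ((h.connected_of_base_eq hyp hc.1 hp hq hv hf).tail hstep).trans
      (h.connected_of_base_eq hyp hc'.1 hq' hp' hf' hv')
  · intro c₁ c₂ c₃ _ hc₂ _ h12 h23 p hp p' hp' v v' hv hv'
    obtain ⟨q, hq, f, hf, -⟩ := h.eventually_connected hyp semi hij hlam hc₂.1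
    exact (h12 p hp q hq v f hv hf).trans (h23 q hq p' hp' f v' hf hv')
  · intro c₁ c₂ _ _ h12 p hp p' hp' v v' hv hv'
    exact reflTransGen_flowStep_symm (h12 p' hp' p hp v' v hv' hv)

/-! ### The relation is kept by the flows of the subalgebra -/

/-- The jet of the function `V(·, ·, τ)` at `(x, t)`, as a function of `(x, t, τ)`. -/
def flowJet (V : ℝ × ℝ × ℝ → Fin n → ℝ) (q : ℝ × ℝ × ℝ) : Jet n :=
  (q.1, q.2.1, V q, fderiv ℝ V q (1, 0, 0))

theorem eventually_jet_eq {D : Set (ℝ × ℝ × ℝ)} (hD : IsOpen D) {V : ℝ × ℝ × ℝ → Fin n → ℝ}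
    (hV : ContDiffOn ℝ ∞ V D) {τ : ℝ} {z₀ : ℝ × ℝ} (h0 : (z₀.1, z₀.2, τ) ∈ D)
    {v : ℝ × ℝ → Fin n → ℝ} (hv : ∀ᶠ z in 𝓝 z₀, v z = V (z.1, z.2, τ)) :
    ∀ᶠ z in 𝓝 z₀, jet v z = flowJet V (z.1, z.2, τ) := by
  have hc : Continuous fun z : ℝ × ℝ => (z.1, z.2, τ) := by fun_prop
  filter_upwards [hv.eventually_nhds, hc.continuousAt.preimage_mem_nhds (hD.mem_nhds h0)]
    with z hz hzD
  have h1 : HasFDerivAt (fun z : ℝ × ℝ => (z.1, z.2, τ)) ((ContinuousLinearMap.fst ℝ ℝ ℝ).prod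
      ((ContinuousLinearMap.snd ℝ ℝ ℝ).prod (0 : ℝ × ℝ →L[ℝ] ℝ))) z :=
    hasFDerivAt_fst.prodMk (hasFDerivAt_snd.prodMk (hasFDerivAt_const _ _))
  have h2 : HasFDerivAt (fun z : ℝ × ℝ => V (z.1, z.2, τ)) _ z :=
    HasFDerivAt.comp (g := V) (f := fun z : ℝ × ℝ => (z.1, z.2, τ)) z
      (smooth_differentiableAt hD hV hzD).hasFDerivAt h1
  have h3 : fderiv ℝ v z (1, 0) = fderiv ℝ V (z.1, z.2, τ) (1, 0, 0) := by
    rw [EventuallyEq.fderiv_eq (f₁ := v) (f := fun z : ℝ × ℝ => V (z.1, z.2, τ)) hz, h2.fderiv]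
    simp
  simp only [jet, flowJet, dx, h3, hz.self_of_nhds]

/-! ### Derivatives along a flow with moving base point -/

section Flow

variable {i j : Fin n} {U' : Set (Fin n → ℝ)} {μ : Fin n → (Fin n → ℝ) → ℝ}
  {D : Set (ℝ × ℝ × ℝ)} {V : ℝ × ℝ × ℝ → Fin n → ℝ}

/-- The summand -μ^i D_x in the generator cancels the change of the i-th component: for k = i the
right side is zero, so u^i is kept at the base point. -/
theorem IsCommonSolution.fderiv_flow (hV : IsCommonSolution lam μ U' D V) {q : ℝ × ℝ × ℝ}
    (hq : q ∈ D) (k : Fin n) : fderiv ℝ V q (-μ i (V q), 0, 1) k =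
      (μ k (V q) - μ i (V q)) * fderiv ℝ V q (1, 0, 0) k := by
  have h1 : ((-μ i (V q), 0, 1) : ℝ × ℝ × ℝ) = (-μ i (V q)) • (1, 0, 0) + (0, 0, 1) := by simp
  rw [h1, map_add, map_smul, Pi.add_apply, Pi.smul_apply, hV.eqn_flow q hq, smul_eq_mul]
  ring

/-- The second derivative V^i_xx drops out for the same choice of the motion. What remains is linear
and homogeneous in V^i_x, so V^i_x cannot vanish unless it vanishes along the whole motion. -/
theorem IsCommonSolution.fderiv_flow_dx (hμ : IsCommutingFlow lam U' μ)
    (hV : IsCommonSolution lam μ U' D V) {q : ℝ × ℝ × ℝ} (hq : q ∈ D) :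
    fderiv ℝ (fun q => fderiv ℝ V q (1, 0, 0)) q (-μ i (V q), 0, 1) i =
      (∑ k, fderiv ℝ V q (1, 0, 0) k * pd k (μ i) (V q)) * fderiv ℝ V q (1, 0, 0) i := by
  have hVd := smooth_differentiableAt hV.isOpen hV.smooth hq
  have hVxs := smooth_fderiv_apply hV.isOpen hV.smooth (1, 0, 0)
  have hVx := smooth_differentiableAt hV.isOpen hVxs hq
  have hVτ := smooth_differentiableAt hV.isOpen
    (smooth_fderiv_apply hV.isOpen hV.smooth (0, 0, 1)) hq
  have hVxi : DifferentiableAt ℝ (fun q => fderiv ℝ V q (1, 0, 0) i) q :=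
    differentiableAt_pi.1 hVx i
  have hμd := hμ.differentiableAt i (hV.mapsTo hq)
  have hpi : ∀ {f : ℝ × ℝ × ℝ → Fin n → ℝ} (_ : DifferentiableAt ℝ f q) e,
      fderiv ℝ f q e i = fderiv ℝ (fun q => f q i) q e := by
    intro f hf e
    rw [(hasFDerivAt_pi'.1 hf.hasFDerivAt i).fderiv]; rfl
  have h1 : ((-μ i (V q), 0, 1) : ℝ × ℝ × ℝ) = (-μ i (V q)) • (1, 0, 0) + (0, 0, 1) := by simp
  have h2 : (fun q => fderiv ℝ V q (0, 0, 1) i) =ᶠ[𝓝 q]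
      fun q => μ i (V q) * fderiv ℝ V q (1, 0, 0) i := by
    filter_upwards [hV.isOpen.mem_nhds hq] with q' hq' using hV.eqn_flow q' hq' i
  have hμV : DifferentiableAt ℝ (fun q => μ i (V q)) q := hμd.comp q hVd
  rw [h1, map_add, map_smul, Pi.add_apply, Pi.smul_apply, smul_eq_mul,
    fderiv_fderiv_comm hV.isOpen hV.smooth hq (1, 0, 0) (0, 0, 1), hpi hVτ, h2.fderiv_eq,
    (hμV.hasFDerivAt.fun_mul hVxi.hasFDerivAt).fderiv, hpi hVx]
  simp only [add_apply, smul_apply, smul_eq_mul, fderiv_comp_apply hμd hVd]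
  ring

theorem hasFDerivAt_flowJet (hD : IsOpen D) (hV : ContDiffOn ℝ ∞ V D) {q : ℝ × ℝ × ℝ}
    (hq : q ∈ D) : HasFDerivAt (flowJet V) ((ContinuousLinearMap.fst ℝ ℝ (ℝ × ℝ)).prod
      (((ContinuousLinearMap.fst ℝ ℝ ℝ).comp (ContinuousLinearMap.snd ℝ ℝ (ℝ × ℝ))).prod
        ((fderiv ℝ V q).prod (fderiv ℝ (fun q => fderiv ℝ V q (1, 0, 0)) q)))) q :=
  hasFDerivAt_fst.prodMk (hasFDerivAt_snd.fst.prodMk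
    ((smooth_differentiableAt hD hV hq).hasFDerivAt.prodMk
      (smooth_differentiableAt hD (smooth_fderiv_apply hD hV _) hq).hasFDerivAt))

/-- The flows of the subalgebra, with the motion of the base point, keep the invariant. -/
theorem IsCommonSolution.fderiv_invariant (hyp : IsStrictlyHyperbolic lam U) (hij : j ≠ i)
    (hlam : ∀ u ∈ U, pd j (lam i) u ≠ 0) {Ω : Set (Jet n)} {J : Jet n → ℝ}
    (hJ : IsExtraRiemannInvariantOfOrderOne lam U i Ω J) (hμ : InSubalgebra lam i j U' μ)
    (hV : IsCommonSolution lam μ U' D V) {q : ℝ × ℝ × ℝ} (hq : q ∈ D) (hqΩ : flowJet V q ∈ Ω)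
    (hne : fderiv ℝ V q (1, 0, 0) i ≠ 0) :
    fderiv ℝ (fun q => J (flowJet V q)) q (-μ i (V q), 0, 1) = 0 := by
  have h1 : HasFDerivAt (fun q => J (flowJet V q)) _ q :=
    HasFDerivAt.comp (g := J) (f := flowJet V) q
      (smooth_differentiableAt hJ.1.isOpen hJ.1.smooth hqΩ).hasFDerivAt
      (hasFDerivAt_flowJet hV.isOpen hV.smooth hq)
  rw [h1.fderiv]
  refine fderiv_eq_zero_of_level hyp hij hlam hJ hqΩ hne
    (X := (-μ i (V q), 0, fderiv ℝ V q (-μ i (V q), 0, 1),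
      fderiv ℝ (fun q => fderiv ℝ V q (1, 0, 0)) q (-μ i (V q), 0, 1))) ?_ ?_
  · simp only [hV.fderiv_flow hq, sub_self, zero_mul]
  · simp only [hV.fderiv_flow hq, hV.fderiv_flow_dx hμ.1 hq, flowJet]
    -- The subalgebra equation is used for the summand k = i only. It produces the coefficient
    -- b_{ij} that the level sets of `J` require.
    have h2 : ∑ k, fderiv ℝ V q (1, 0, 0) k * pd k (μ i) (V q) =
        fderiv ℝ V q (1, 0, 0) i * (b lam i j (V q) * μ i (V q)) +
          ∑ k, a lam i k (V q) * ((μ k (V q) - μ i (V q)) * fderiv ℝ V q (1, 0, 0) k) := by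
      have h3 : ∀ k, fderiv ℝ V q (1, 0, 0) k * pd k (μ i) (V q) =
          (if k = i then fderiv ℝ V q (1, 0, 0) i * (b lam i j (V q) * μ i (V q)) else 0) +
          a lam i k (V q) * ((μ k (V q) - μ i (V q)) * fderiv ℝ V q (1, 0, 0) k) := by
        intro k
        by_cases hk : k = i
        · subst hk; rw [if_pos rfl, hμ.2 _ (hV.mapsTo hq)]; ring
        · rw [if_neg hk, hμ.1.eqn i k (Ne.symm hk) _ (hV.mapsTo hq)]; ring
      simp only [h3, Finset.sum_add_distrib, Finset.sum_ite_eq', Finset.mem_univ, if_true]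
    rw [h2]
    ring

/-- Near a point where `Vⁱ_x ≠ 0`, the invariant is a function of `Vⁱ` and `t`. -/
theorem IsCommonSolution.exists_level (hyp : IsStrictlyHyperbolic lam U) (hij : j ≠ i)
    (hlam : ∀ u ∈ U, pd j (lam i) u ≠ 0) {Ω : Set (Jet n)} {J : Jet n → ℝ}
    (hJ : IsExtraRiemannInvariantOfOrderOne lam U i Ω J) (hμ : InSubalgebra lam i j U' μ)
    (hV : IsCommonSolution lam μ U' D V) {q₀ : ℝ × ℝ × ℝ} (hq₀ : q₀ ∈ D)
    (hqΩ : flowJet V q₀ ∈ Ω) (hne : fderiv ℝ V q₀ (1, 0, 0) i ≠ 0) :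
    ∃ e : OpenPartialHomeomorph (ℝ × ℝ × ℝ) (ℝ × ℝ × ℝ), q₀ ∈ e.source ∧
      (∀ q, e q = (V q i, q.2)) ∧ ∃ ε > 0, Metric.ball (e q₀) ε ⊆ e.target ∧
      ∀ y ∈ Metric.ball (e q₀) ε, ∀ y' ∈ Metric.ball (e q₀) ε, y'.1 = y.1 → y'.2.1 = y.2.1 →
        J (flowJet V (e.symm y')) = J (flowJet V (e.symm y)) := by
  have hVd : ∀ q ∈ D, DifferentiableAt ℝ V q := fun q hq =>
    smooth_differentiableAt hV.isOpen hV.smooth hq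
  have hVxs := smooth_fderiv_apply hV.isOpen hV.smooth (1, 0, 0)
  have hJs : ContDiffOn ℝ ∞ (flowJet V) D := contDiffOn_fst.prodMk
    ((ContDiff.contDiffOn (by fun_prop)).prodMk (hV.smooth.prodMk hVxs))
  set O : Set (ℝ × ℝ × ℝ) := (D ∩ flowJet V ⁻¹' Ω) ∩
    (D ∩ (fun q => fderiv ℝ V q (1, 0, 0)) ⁻¹' {p | p i ≠ 0}) with hO
  have hOo : IsOpen O := (hJs.continuousOn.isOpen_inter_preimage hV.isOpen hJ.1.isOpen).inter
    (hVxs.continuousOn.isOpen_inter_preimage hV.isOpen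
      (isOpen_compl_singleton.preimage (continuous_apply i)))
  have h0O : q₀ ∈ O := ⟨⟨hq₀, hqΩ⟩, hq₀, hne⟩
  have hOD : O ⊆ D := fun q hq => hq.1.1
  -- In the coordinates (V^i, t, τ) the motion of the base point becomes translation in τ.
  let Ψ : ℝ × ℝ × ℝ → ℝ × ℝ × ℝ := fun q => (V q i, q.2)
  have hΨ : ContDiffOn ℝ ∞ Ψ O :=
    ((contDiffOn_pi.1 hV.smooth i).mono hOD).prodMk (ContDiff.contDiffOn (by fun_prop))
  have hΨd : ∀ q ∈ O, ∀ e, fderiv ℝ Ψ q e = (fderiv ℝ V q e i, e.2) := by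
    intro q hq e
    have h1 : HasFDerivAt Ψ _ q :=
      (hasFDerivAt_pi'.1 (hVd q (hOD hq)).hasFDerivAt i).prodMk hasFDerivAt_snd
    rw [h1.fderiv]; rfl
  obtain ⟨e, h0e, heO, heq, hes⟩ := exists_smooth_local_inverse hOo hΨ h0O (by
    rintro ⟨x, t, τ⟩ hv
    rw [hΨd q₀ h0O, Prod.mk_eq_zero] at hv
    obtain ⟨h1, h2⟩ := hv
    simp only at h2
    rw [Prod.mk_eq_zero] at h2
    obtain ⟨rfl, rfl⟩ := h2
    have h3 : ((x, 0, 0) : ℝ × ℝ × ℝ) = x • (1, 0, 0) := by simp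
    rw [h3, map_smul, Pi.smul_apply, smul_eq_mul] at h1
    rw [(mul_eq_zero.1 h1).resolve_right hne]
    rfl)
  obtain ⟨ε, hε, hball⟩ := Metric.isOpen_iff.1 e.open_target _ (e.map_source h0e)
  refine ⟨e, h0e, heq, ε, hε, hball, fun y hy y' hy' h1 h2 => ?_⟩
  have hsd : ∀ y ∈ e.target, DifferentiableAt ℝ e.symm y := fun y hy =>
    smooth_differentiableAt e.open_target hes hy
  have hsO : ∀ y ∈ e.target, e.symm y ∈ O := fun y hy => heO (e.map_target hy)
  have hFd : ∀ q ∈ O, HasFDerivAt (fun q => J (flowJet V q))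
      (fderiv ℝ (fun q => J (flowJet V q)) q) q := fun q hq =>
    ((smooth_differentiableAt hJ.1.isOpen hJ.1.smooth hq.1.2).comp q
      (hasFDerivAt_flowJet hV.isOpen hV.smooth (hOD hq)).differentiableAt).hasFDerivAt
  have hcomp : ∀ y ∈ e.target, HasFDerivAt (fun y => J (flowJet V (e.symm y)))
      ((fderiv ℝ (fun q => J (flowJet V q)) (e.symm y)).comp (fderiv ℝ e.symm y)) y := fun y hy =>
    HasFDerivAt.comp (g := fun q => J (flowJet V q)) (f := e.symm) y (hFd _ (hsO y hy))
      (hsd y hy).hasFDerivAt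
  -- the flow is straightened
  have hsym : ∀ y ∈ e.target, fderiv ℝ e.symm y (0, 0, 1) = (-μ i (V (e.symm y)), 0, 1) := by
    intro y hy
    have hq := hsO y hy
    have h3 : HasFDerivAt (fun y => Ψ (e.symm y)) ((fderiv ℝ Ψ (e.symm y)).comp
        (fderiv ℝ e.symm y)) y := HasFDerivAt.comp (g := Ψ) (f := e.symm) y
      (smooth_differentiableAt hOo hΨ hq).hasFDerivAt (hsd y hy).hasFDerivAt
    have h4 : (fun y => Ψ (e.symm y)) =ᶠ[𝓝 y] id := by
      filter_upwards [e.open_target.mem_nhds hy] with y' hy'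
      have := e.right_inv hy'
      rwa [heq] at this
    have h5 := congrArg (fun L : ℝ × ℝ × ℝ →L[ℝ] ℝ × ℝ × ℝ => L (0, 0, 1))
      ((h3.congr_of_eventuallyEq h4.symm).unique (hasFDerivAt_id y))
    simp only [ContinuousLinearMap.comp_apply, ContinuousLinearMap.id_apply] at h5
    rw [hΨd _ hq] at h5
    obtain ⟨h6, h7⟩ := Prod.mk.inj h5
    set f := fderiv ℝ e.symm y (0, 0, 1) with hf
    have h8 : f = (f.1 + μ i (V (e.symm y))) • (1, 0, 0) + (-μ i (V (e.symm y)), 0, 1) := by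
      rw [← Prod.mk.eta (p := f), h7]; simp
    rw [h8, map_add, map_smul, Pi.add_apply, Pi.smul_apply, hV.fderiv_flow (hOD hq), sub_self,
      zero_mul, add_zero, smul_eq_mul] at h6
    have h9 := (mul_eq_zero.1 h6).resolve_right hq.2.2
    rw [h8, h9, zero_smul, zero_add]
  refine eq_of_fderiv_apply_eq_zero (f := fun y => J (flowJet V (e.symm y)))
    (convex_ball (e q₀) ε) (fun z hz => (hcomp z (hball hz)).differentiableAt) hy hy'
    fun z hz => ?_
  have h3 : y' - y = (y'.2.2 - y.2.2) • (0, 0, 1) := by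
    ext <;> simp [h1, h2]
  rw [(hcomp z (hball hz)).fderiv, h3, map_smul, ContinuousLinearMap.comp_apply, hsym z (hball hz),
    hV.fderiv_invariant hyp hij hlam hJ hμ (hOD (hsO z (hball hz))) (hsO z (hball hz)).1.2
      (hsO z (hball hz)).2.2, smul_zero]

end Flow

/-- A flow of the subalgebra keeps the relation `J = φ(uⁱ)`. -/
theorem FlowStep.relation (hyp : IsStrictlyHyperbolic lam U) {i j : Fin n} (hij : j ≠ i)
    (hlam : ∀ u ∈ U, pd j (lam i) u ≠ 0) {Ω : Set (Jet n)} {J : Jet n → ℝ}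
    (hJ : IsExtraRiemannInvariantOfOrderOne lam U i Ω J) {φ : ℝ → ℝ} {A B : PointedFun n}
    (h : FlowStep lam U i j Ω A B) (hA : dx A.2 A.1 i ≠ 0)
    (hrel : ∀ᶠ z in 𝓝 A.1, J (jet A.2 z) = φ (A.2 z i)) :
    dx B.2 B.1 i ≠ 0 ∧ ∀ᶠ z in 𝓝 B.1, J (jet B.2 z) = φ (B.2 z i) := by
  obtain ⟨U', μ, D, V, ξ, t, hU', hμ, hV, hξ, hA1, hAV, hB1, hBV⟩ := h
  have hmem0 : (0 : ℝ) ∈ Icc (0 : ℝ) 1 := left_mem_Icc.2 zero_le_one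
  have hmem1 : (1 : ℝ) ∈ Icc (0 : ℝ) 1 := right_mem_Icc.2 zero_le_one
  let c : ℝ → ℝ × ℝ × ℝ := fun τ => (ξ τ, t, τ)
  have hcD : ∀ τ ∈ Icc (0 : ℝ) 1, c τ ∈ D := fun τ hτ => (hξ τ hτ).1
  have hcΩ : ∀ τ ∈ Icc (0 : ℝ) 1, flowJet V (c τ) ∈ Ω := fun τ hτ => (hξ τ hτ).2.2
  have hc' : ∀ τ ∈ Icc (0 : ℝ) 1,
      HasDerivWithinAt c (-μ i (V (c τ)), 0, 1) (Icc 0 1) τ := fun τ hτ =>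
    (hξ τ hτ).2.1.prodMk ((hasDerivWithinAt_const _ _ _).prodMk (hasDerivWithinAt_id _ _))
  have hcc : ContinuousOn c (Icc 0 1) := fun τ hτ => (hc' τ hτ).continuousWithinAt
  have hVd : ∀ q ∈ D, DifferentiableAt ℝ V q := fun q hq =>
    smooth_differentiableAt hV.isOpen hV.smooth hq
  have hVxs := smooth_fderiv_apply hV.isOpen hV.smooth (1, 0, 0)
  have hAjet := eventually_jet_eq hV.isOpen hV.smooth (τ := 0) (z₀ := A.1)
    (by rw [hA1]; exact hcD 0 hmem0) hAV
  have hBjet := eventually_jet_eq hV.isOpen hV.smooth (τ := 1) (z₀ := B.1)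
    (by rw [hB1]; exact hcD 1 hmem1) hBV
  have hA0 : dx A.2 A.1 = fderiv ℝ V (c 0) (1, 0, 0) := by
    have := congrArg (fun q : Jet n => q.2.2.2) hAjet.self_of_nhds
    simp only [jet, flowJet] at this
    rw [this, hA1]
  have hB0 : dx B.2 B.1 = fderiv ℝ V (c 1) (1, 0, 0) := by
    have := congrArg (fun q : Jet n => q.2.2.2) hBjet.self_of_nhds
    simp only [jet, flowJet] at this
    rw [this, hB1]
  -- `Vⁱ` is constant along the motion
  have hVi : ∀ τ ∈ Icc (0 : ℝ) 1, V (c τ) i = V (c 0) i := by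
    have h1 : ∀ τ ∈ Icc (0 : ℝ) 1, HasDerivWithinAt (fun τ => V (c τ) i) 0 (Icc 0 1) τ := by
      intro τ hτ
      have h2 := (hVd _ (hcD τ hτ)).hasFDerivAt.comp_hasDerivWithinAt τ (hc' τ hτ)
      have h3 := hasDerivWithinAt_pi.1 h2 i
      rwa [hV.fderiv_flow (hcD τ hτ), sub_self, zero_mul] at h3
    exact constant_of_derivWithin_zero (fun τ hτ => (h1 τ hτ).differentiableWithinAt)
      (fun τ hτ => (h1 τ ⟨hτ.1, hτ.2.le⟩).derivWithin
        (uniqueDiffOn_Icc zero_lt_one τ ⟨hτ.1, hτ.2.le⟩))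
  -- `Vⁱ_x` does not vanish along the motion
  have hne : ∀ τ ∈ Icc (0 : ℝ) 1, fderiv ℝ V (c τ) (1, 0, 0) i ≠ 0 := by
    intro τ hτ h0
    refine hA ?_
    rw [hA0]
    refine eq_zero_of_hasDerivWithinAt_mul (f := fun τ => fderiv ℝ V (c τ) (1, 0, 0) i)
      (c := fun τ => ∑ k, fderiv ℝ V (c τ) (1, 0, 0) k * pd k (μ i) (V (c τ))) ?_ ?_ hτ h0 0 hmem0
    · have h1 : ContinuousOn (fun τ => fderiv ℝ V (c τ) (1, 0, 0)) (Icc 0 1) :=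
        hVxs.continuousOn.comp hcc hcD
      have h2 : ContinuousOn (fun τ => V (c τ)) (Icc 0 1) := hV.smooth.continuousOn.comp hcc hcD
      refine continuousOn_finsetSum _ fun k _ => (continuousOn_pi.1 h1 k).mul ?_
      exact (smooth_pd hμ.1.isOpen (hμ.1.smooth i) k).continuousOn.comp h2
        fun τ hτ => hV.mapsTo (hcD τ hτ)
    · intro τ hτ
      have h2 := (smooth_differentiableAt hV.isOpen hVxs (hcD τ hτ)).hasFDerivAt.comp_hasDerivWithinAt
        τ (hc' τ hτ)
      have h3 := hasDerivWithinAt_pi.1 h2 i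
      rwa [hV.fderiv_flow_dx hμ.1 (hcD τ hτ)] at h3
  -- The relation on a neighbourhood of the moving base point in the slice τ. It is shown to be
  -- locally independent of τ, so that connectedness carries it from 0 to 1.
  let P : ℝ → Prop := fun τ => ∀ᶠ z : ℝ × ℝ in 𝓝 (ξ τ, t),
    J (flowJet V (z.1, z.2, τ)) = φ (V (z.1, z.2, τ) i)
  have hloc : ∀ τ₀ ∈ Icc (0 : ℝ) 1, ∀ᶠ τ in 𝓝[Icc 0 1] τ₀, (P τ₀ ↔ P τ) := by
    intro τ₀ hτ₀
    obtain ⟨e, h0e, he, ε, hε, hball, hlev⟩ := hV.exists_level hyp hij hlam hJ hμ (hcD τ₀ hτ₀)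
      (hcΩ τ₀ hτ₀) (hne τ₀ hτ₀)
    -- A point of the slice τ is paired with the point of the slice τ' having the same V^i and t.
    -- The invariant agrees at the two points, and so do the values of φ.
    have key : ∀ τ ∈ Icc (0 : ℝ) 1, ∀ τ' ∈ Icc (0 : ℝ) 1, c τ ∈ e.source →
        e (c τ) ∈ Metric.ball (e (c τ₀)) ε → c τ' ∈ e.source →
        e (c τ') ∈ Metric.ball (e (c τ₀)) ε → P τ' → P τ := by
      intro τ hτ τ' hτ' hs hb hs' hb' hP
      have hι : Continuous (fun z : ℝ × ℝ => (z.1, z.2, τ)) := by fun_prop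
      have hιs : ∀ᶠ z : ℝ × ℝ in 𝓝 (ξ τ, t), (z.1, z.2, τ) ∈ e.source :=
        hι.continuousAt.preimage_mem_nhds (e.open_source.mem_nhds hs)
      have hec : ContinuousAt (fun z : ℝ × ℝ => e (z.1, z.2, τ)) (ξ τ, t) :=
        ContinuousAt.comp (g := e) (f := fun z : ℝ × ℝ => (z.1, z.2, τ)) (x := (ξ τ, t))
          (e.continuousAt hs) hι.continuousAt
      have hyc : ContinuousAt (fun z : ℝ × ℝ => (V (z.1, z.2, τ) i, z.2, τ')) (ξ τ, t) := by
        have h1 := hec.fst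
        simp only [he] at h1
        exact h1.prodMk (continuousAt_snd.prodMk continuousAt_const)
      have hy0 : (V (c τ) i, t, τ') = e (c τ') := by rw [he, hVi τ hτ, hVi τ' hτ']
      have hyb : ∀ᶠ z : ℝ × ℝ in 𝓝 (ξ τ, t),
          (V (z.1, z.2, τ) i, z.2, τ') ∈ Metric.ball (e (c τ₀)) ε :=
        hyc.preimage_mem_nhds (Metric.isOpen_ball.mem_nhds (by
          change (V (c τ) i, t, τ') ∈ _; rw [hy0]; exact hb'))
      have hmc : ContinuousAt (fun z : ℝ × ℝ => e.symm (V (z.1, z.2, τ) i, z.2, τ')) (ξ τ, t) :=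
        ContinuousAt.comp (g := e.symm) (f := fun z : ℝ × ℝ => (V (z.1, z.2, τ) i, z.2, τ'))
          (x := (ξ τ, t)) (e.symm.continuousAt (by
            change (V (c τ) i, t, τ') ∈ e.target; rw [hy0]; exact hball hb')) hyc
      have hm0 : e.symm (V (c τ) i, t, τ') = c τ' := by rw [hy0, e.left_inv hs']
      have hmc' : Tendsto (fun z : ℝ × ℝ => ((e.symm (V (z.1, z.2, τ) i, z.2, τ')).1,
          (e.symm (V (z.1, z.2, τ) i, z.2, τ')).2.1)) (𝓝 (ξ τ, t)) (𝓝 (ξ τ', t)) := by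
        have h1 := hmc.fst.prodMk hmc.snd.fst
        have h2 : ((e.symm (V (c τ) i, t, τ')).1, (e.symm (V (c τ) i, t, τ')).2.1) = (ξ τ', t) := by
          rw [hm0]
        rw [← h2]; exact h1
      filter_upwards [hιs, hec.preimage_mem_nhds (Metric.isOpen_ball.mem_nhds hb), hyb,
        hmc'.eventually hP] with z hzs hzb hzy hzP
      set q' := e.symm (V (z.1, z.2, τ) i, z.2, τ') with hq'
      have h1 : e q' = (V (z.1, z.2, τ) i, z.2, τ') := e.right_inv (hball hzy)
      rw [he] at h1
      obtain ⟨h2, h3⟩ := Prod.mk.inj h1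
      have h4 : (q'.1, q'.2.1, τ') = q' := by
        ext <;> simp [h3]
      rw [h4, h2] at hzP
      have h5 := hlev _ hzy (e (z.1, z.2, τ)) hzb (by rw [he]) (by rw [he])
      rw [e.left_inv hzs] at h5
      rw [h5]; exact hzP
    have h1 : ∀ᶠ τ in 𝓝[Icc 0 1] τ₀, c τ ∈ e.source ∧ e (c τ) ∈ Metric.ball (e (c τ₀)) ε := by
      have h2 : ContinuousWithinAt (fun τ => e (c τ)) (Icc 0 1) τ₀ :=
        (e.continuousAt h0e).comp_continuousWithinAt (hcc τ₀ hτ₀)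
      have h3 : ∀ᶠ τ in 𝓝[Icc 0 1] τ₀, c τ ∈ e.source :=
        (hcc τ₀ hτ₀).preimage_mem_nhdsWithin (e.open_source.mem_nhds h0e)
      exact h3.and (h2.preimage_mem_nhdsWithin (Metric.ball_mem_nhds _ hε))
    filter_upwards [h1, self_mem_nhdsWithin] with τ h2 hτ
    have hb0 : e (c τ₀) ∈ Metric.ball (e (c τ₀)) ε := Metric.mem_ball_self hε
    exact ⟨key τ hτ τ₀ hτ₀ h2.1 h2.2 h0e hb0, key τ₀ hτ₀ τ hτ h0e hb0 h2.1 h2.2⟩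
  have h01 : P 0 ↔ P 1 := (isPreconnected_Icc (a := (0 : ℝ)) (b := 1)).induction₂
    (fun τ τ' => (P τ ↔ P τ')) hloc (fun _ _ _ _ _ _ h1 h2 => h1.trans h2)
    (fun _ _ _ _ h => h.symm) hmem0 hmem1
  refine ⟨by rw [hB0]; exact hne 1 hmem1, ?_⟩
  have hP0 : P 0 := by
    rw [hA1] at hrel hAjet hAV
    filter_upwards [hrel, hAjet, hAV] with z h1 h2 h3
    rw [← h2, h1, h3]
  have hP1 := h01.1 hP0
  rw [hB1] at hBjet hBV ⊢
  filter_upwards [hP1, hBjet, hBV] with z h1 h2 h3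
  rw [h2, h1, h3]

theorem relation_of_reflTransGen (hyp : IsStrictlyHyperbolic lam U) {i j : Fin n} (hij : j ≠ i)
    (hlam : ∀ u ∈ U, pd j (lam i) u ≠ 0) {Ω : Set (Jet n)} {J : Jet n → ℝ}
    (hJ : IsExtraRiemannInvariantOfOrderOne lam U i Ω J) {φ : ℝ → ℝ} {A B : PointedFun n}
    (h : Relation.ReflTransGen (FlowStep lam U i j Ω) A B) (hA : dx A.2 A.1 i ≠ 0)
    (hrel : ∀ᶠ z in 𝓝 A.1, J (jet A.2 z) = φ (A.2 z i)) :
    ∀ᶠ z in 𝓝 B.1, J (jet B.2 z) = φ (B.2 z i) := by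
  have : dx B.2 B.1 i ≠ 0 ∧ ∀ᶠ z in 𝓝 B.1, J (jet B.2 z) = φ (B.2 z i) := by
    induction h with
    | refl => exact ⟨hA, hrel⟩
    | tail _ hs ih => exact hs.relation hyp hij hlam hJ ih.1 ih.2
  exact this.2

/-! ### The relation on a solution -/

theorem IsSolution.smooth_jet {W : Set (ℝ × ℝ)} {v : ℝ × ℝ → Fin n → ℝ}
    (hv : IsSolution lam U W v) : ContDiffOn ℝ ∞ (jet v) W :=
  contDiffOn_fst.prodMk (contDiffOn_snd.prodMk
    (hv.smooth.prodMk (smooth_fderiv_apply hv.isOpen hv.smooth (1, 0))))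

/-- The functions `uⁱ` and `t` are local coordinates where `uⁱ_x ≠ 0`. -/
theorem IsSolution.exists_chart {W : Set (ℝ × ℝ)} {v : ℝ × ℝ → Fin n → ℝ}
    (hv : IsSolution lam U W v) {i : Fin n} {O : Set (ℝ × ℝ)} (hO : IsOpen O) (hOW : O ⊆ W)
    {z : ℝ × ℝ} (hz : z ∈ O) (hne : dx v z i ≠ 0) :
    ∃ e : OpenPartialHomeomorph (ℝ × ℝ) (ℝ × ℝ), z ∈ e.source ∧ e.source ⊆ O ∧
      (∀ y, e y = (v y i, y.2)) ∧ ContDiffOn ℝ ∞ e.symm e.target := by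
  have hΨ : ContDiffOn ℝ ∞ (fun y : ℝ × ℝ => (v y i, y.2)) O :=
    ((contDiffOn_pi.1 hv.smooth i).mono hOW).prodMk contDiffOn_snd
  refine exists_smooth_local_inverse hO hΨ hz ?_
  have h1 : HasFDerivAt (fun y : ℝ × ℝ => (v y i, y.2)) _ z :=
    (hasFDerivAt_pi'.1 (hv.differentiableAt (hOW hz)).hasFDerivAt i).prodMk hasFDerivAt_snd
  rintro ⟨x, t⟩ h
  rw [h1.fderiv] at h
  have h2 : fderiv ℝ v z (x, t) i = 0 := congrArg Prod.fst h
  have h3 : t = 0 := congrArg Prod.snd h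
  subst h3
  have h4 : ((x, 0) : ℝ × ℝ) = x • (1, 0) := by simp
  rw [h4, map_smul, Pi.smul_apply, smul_eq_mul] at h2
  rw [(mul_eq_zero.1 h2).resolve_right hne]
  rfl

/-- A Riemann invariant is constant on a solution along the `i`-th characteristics. -/
theorem IsRiemannInvariant.fderiv_jet (hyp : IsStrictlyHyperbolic lam U) {i : Fin n}
    {Ω : Set (Jet n)} {J : Jet n → ℝ} (hJ : IsRiemannInvariant lam U i Ω J) {W : Set (ℝ × ℝ)}
    {v : ℝ × ℝ → Fin n → ℝ} (hv : IsSolution lam U W v) {z : ℝ × ℝ} (hz : z ∈ W)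
    (hzΩ : jet v z ∈ Ω) : fderiv ℝ (fun z => J (jet v z)) z (-lam i (v z), 1) = 0 := by
  have hvd := hv.differentiableAt hz
  have hvxs := smooth_fderiv_apply hv.isOpen hv.smooth (1, 0)
  have hvx := smooth_differentiableAt hv.isOpen hvxs hz
  have hvt := smooth_differentiableAt hv.isOpen (smooth_fderiv_apply hv.isOpen hv.smooth (0, 1)) hz
  have hjet : HasFDerivAt (jet v) ((ContinuousLinearMap.fst ℝ ℝ ℝ).prod
      ((ContinuousLinearMap.snd ℝ ℝ ℝ).prod ((fderiv ℝ v z).prod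
        (fderiv ℝ (fun z => fderiv ℝ v z (1, 0)) z)))) z :=
    hasFDerivAt_fst.prodMk (hasFDerivAt_snd.prodMk (hvd.hasFDerivAt.prodMk hvx.hasFDerivAt))
  have h1 : HasFDerivAt (fun z => J (jet v z)) _ z := HasFDerivAt.comp (g := J) (f := jet v) z
    (smooth_differentiableAt hJ.isOpen hJ.smooth hzΩ).hasFDerivAt hjet
  have he : ((-lam i (v z), 1) : ℝ × ℝ) = (-lam i (v z)) • (1, 0) + (0, 1) := by simp
  have hdir : ∀ k, fderiv ℝ v z (-lam i (v z), 1) k = (lam k (v z) - lam i (v z)) * dx v z k := by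
    intro k
    have := hv.eqn z hz k
    simp only [dt, dx] at this ⊢
    rw [he, map_add, map_smul, Pi.add_apply, Pi.smul_apply, this, smul_eq_mul]
    ring
  rw [h1.fderiv]
  -- The velocity of the jet along the characteristic dx/dt = -λ^i lies in the Monge distribution;
  -- the i-th component of u_x follows from differentiating the i-th equation in x.
  refine hJ.firstIntegral _ hzΩ (-lam i (v z), 1, fderiv ℝ v z (-lam i (v z), 1),
    fderiv ℝ (fun z => fderiv ℝ v z (1, 0)) z (-lam i (v z), 1)) ⟨?_, ?_, fun k _ => ?_, ?_⟩
  · simp [jet]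
  · simp only [hdir, sub_self, zero_mul]
  · simp only [hdir, jet]; ring
  · have hpi : ∀ {f : ℝ × ℝ → Fin n → ℝ} (_ : DifferentiableAt ℝ f z) e,
        fderiv ℝ f z e i = fderiv ℝ (fun q => f q i) z e := by
      intro f hf e
      rw [(hasFDerivAt_pi'.1 hf.hasFDerivAt i).fderiv]; rfl
    have hld := smooth_differentiableAt hyp.isOpen (hyp.smooth i) (hv.mapsTo hz)
    have h2 : (fun z => fderiv ℝ v z (0, 1) i) =ᶠ[𝓝 z]
        fun z => lam i (v z) * fderiv ℝ v z (1, 0) i := by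
      filter_upwards [hv.isOpen.mem_nhds hz] with y hy using hv.eqn y hy i
    have hlv : DifferentiableAt ℝ (fun z => lam i (v z)) z := hld.comp z hvd
    have hvxi : DifferentiableAt ℝ (fun z => fderiv ℝ v z (1, 0) i) z := differentiableAt_pi.1 hvx i
    simp only [jet, dx]
    rw [he, map_add, map_smul, Pi.add_apply, Pi.smul_apply, smul_eq_mul,
      fderiv_fderiv_comm hv.isOpen hv.smooth hz (1, 0) (0, 1), hpi hvt, h2.fderiv_eq,
      (hlv.hasFDerivAt.fun_mul hvxi.hasFDerivAt).fderiv, hpi hvx]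
    simp only [add_apply, smul_apply, smul_eq_mul, fderiv_comp_apply hld hvd]
    ring

/-- On a solution, the invariant is a smooth function of `uⁱ`. -/
theorem IsRiemannInvariant.exists_relation (hyp : IsStrictlyHyperbolic lam U) {i : Fin n}
    {Ω : Set (Jet n)} {J : Jet n → ℝ} (hJ : IsRiemannInvariant lam U i Ω J) {W : Set (ℝ × ℝ)}
    {v : ℝ × ℝ → Fin n → ℝ} (hv : IsSolution lam U W v) {z : ℝ × ℝ} (hz : z ∈ W)
    (hzΩ : jet v z ∈ Ω) (hne : dx v z i ≠ 0) :
    ∃ (φ : ℝ → ℝ) (S : Set ℝ), IsOpen S ∧ v z i ∈ S ∧ ContDiffOn ℝ ∞ φ S ∧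
      ∀ᶠ y in 𝓝 z, J (jet v y) = φ (v y i) := by
  set O : Set (ℝ × ℝ) := W ∩ jet v ⁻¹' Ω with hO
  have hOo : IsOpen O := hv.smooth_jet.continuousOn.isOpen_inter_preimage hv.isOpen hJ.isOpen
  obtain ⟨e, hze, heO, he, hes⟩ := hv.exists_chart (i := i) (O := O ∩ (W ∩ dx v ⁻¹' {p | p i ≠ 0}))
    (hOo.inter ((smooth_fderiv_apply hv.isOpen hv.smooth (1, 0)).continuousOn.isOpen_inter_preimage
      hv.isOpen (isOpen_compl_singleton.preimage (continuous_apply i))))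
    (fun y hy => hy.1.1) ⟨⟨hz, hzΩ⟩, hz, hne⟩ hne
  obtain ⟨ε, hε, hball⟩ := Metric.isOpen_iff.1 e.open_target _ (e.map_source hze)
  have hFs : ContDiffOn ℝ ∞ (fun y => J (jet v (e.symm y))) e.target :=
    hJ.smooth.comp (hv.smooth_jet.comp hes fun y hy => (heO (e.map_target hy)).1.1)
      fun y hy => (heO (e.map_target hy)).1.2
  have hmem : ∀ a s, (a, s) ∈ Metric.ball (e z) ε ↔
      a ∈ Metric.ball (v z i) ε ∧ s ∈ Metric.ball z.2 ε := by
    intro a s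
    rw [he]; simp only [Metric.mem_ball, Prod.dist_eq, max_lt_iff]
  have hz2 : z.2 ∈ Metric.ball z.2 ε := Metric.mem_ball_self hε
  -- The value φ(a) is that of the invariant at the point of the line t = const through `z` where
  -- v^i = a.
  refine ⟨fun a => J (jet v (e.symm (a, z.2))), Metric.ball (v z i) ε, Metric.isOpen_ball,
    Metric.mem_ball_self hε, ?_, ?_⟩
  · exact hFs.comp (ContDiff.contDiffOn (by fun_prop)) fun a ha => hball ((hmem _ _).2 ⟨ha, hz2⟩)
  -- In the coordinates (v^i, t) the second coordinate direction is the i-th characteristic one,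
  -- along which the invariant is constant.
  · have hsym : ∀ y ∈ e.target, fderiv ℝ e.symm y (0, 1) = (-lam i (v (e.symm y)), 1) := by
      intro y hy
      have hq := heO (e.map_target hy)
      have h3 : HasFDerivAt (fun y => ((v (e.symm y) i, (e.symm y).2) : ℝ × ℝ)) _ y :=
        HasFDerivAt.comp (g := fun q : ℝ × ℝ => ((v q i, q.2) : ℝ × ℝ)) (f := e.symm) y
          ((hasFDerivAt_pi'.1 (hv.differentiableAt hq.1.1).hasFDerivAt i).prodMk hasFDerivAt_snd)
          (smooth_differentiableAt e.open_target hes hy).hasFDerivAt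
      have h4 : (fun y => ((v (e.symm y) i, (e.symm y).2) : ℝ × ℝ)) =ᶠ[𝓝 y] id := by
        filter_upwards [e.open_target.mem_nhds hy] with y' hy'
        have := e.right_inv hy'
        rwa [he] at this
      have h5 := congrArg (fun L : ℝ × ℝ →L[ℝ] ℝ × ℝ => L (0, 1))
        ((h3.congr_of_eventuallyEq h4.symm).unique (hasFDerivAt_id y))
      set f := fderiv ℝ e.symm y (0, 1) with hf
      have h6 : fderiv ℝ v (e.symm y) f i = 0 := congrArg Prod.fst h5
      have h7 : f.2 = 1 := congrArg Prod.snd h5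
      have h8 : f = f.1 • (1, 0) + (0, 1) := by
        rw [← Prod.mk.eta (p := f), h7]; simp
      have h9 := hv.eqn _ hq.1.1 i
      simp only [dt, dx] at h9
      rw [h8, map_add, map_smul, Pi.add_apply, Pi.smul_apply, h9, smul_eq_mul, ← add_mul] at h6
      have h10 := (mul_eq_zero.1 h6).resolve_right hq.2.2
      rw [h8, eq_neg_of_add_eq_zero_left h10]
      simp
    have hd : ∀ y ∈ e.target, fderiv ℝ (fun y => J (jet v (e.symm y))) y (0, 1) = 0 := by
      intro y hy
      have hq := heO (e.map_target hy)
      have h1 : DifferentiableAt ℝ (fun q => J (jet v q)) (e.symm y) :=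
        (smooth_differentiableAt hJ.isOpen hJ.smooth hq.1.2).comp _
          (smooth_differentiableAt hv.isOpen hv.smooth_jet hq.1.1)
      have h2 : HasFDerivAt (fun y => J (jet v (e.symm y))) _ y :=
        HasFDerivAt.comp (g := fun q => J (jet v q)) (f := e.symm) y h1.hasFDerivAt
          (smooth_differentiableAt e.open_target hes hy).hasFDerivAt
      rw [h2.fderiv, ContinuousLinearMap.comp_apply, hsym y hy, hJ.fderiv_jet hyp hv hq.1.1 hq.1.2]
    have hec : ContinuousAt e z := e.continuousAt hze
    filter_upwards [hec.preimage_mem_nhds (Metric.ball_mem_nhds _ hε),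
      e.open_source.mem_nhds hze] with y hyb hys
    rw [mem_preimage, he y, hmem] at hyb
    have h1 := eq_of_fderiv_apply_eq_zero (f := fun y => J (jet v (e.symm y)))
      (convex_ball (e z) ε) (fun q hq => smooth_differentiableAt e.open_target hFs (hball hq))
      (x := (v y i, z.2)) (y := (v y i, y.2)) ((hmem _ _).2 ⟨hyb.1, hz2⟩) ((hmem _ _).2 hyb)
      (fun q hq => by
        have : ((v y i, y.2) - (v y i, z.2) : ℝ × ℝ) = (y.2 - z.2) • (0, 1) := by simp
        rw [this, map_smul, hd q (hball hq), smul_zero])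
    have h2 : e.symm (v y i, y.2) = y := by rw [← he, e.left_inv hys]
    rw [h2] at h1
    exact h1

/-! ### Orbits -/

/-- Passage from the relation to hodograph data. The transitivity of the flows is formulated for
data of the class of ρ, and this lemma makes it applicable to solutions given by the relation. -/
theorem IsOrbitChart.isClassGerm (hyp : IsStrictlyHyperbolic lam U)
    (semi : IsSemihamiltonian lam U) {i j : Fin n} (hij : j ≠ i)
    (hlam : ∀ u ∈ U, pd j (lam i) u ≠ 0) {Ω : Set (Jet n)} {y₀ : ℝ × ℝ × (Fin n → ℝ)}
    {p₀ : Fin n → ℝ} {δ r : ℝ} {θ : ℝ × ℝ × (Fin n → ℝ) → ℝ} {ρ : (Fin n → ℝ) → ℝ}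
    (h : IsOrbitChart lam U i j Ω y₀ p₀ δ r θ ρ) {z : ℝ × ℝ} {v : ℝ × ℝ → Fin n → ℝ}
    (hv : IsSolutionNear lam U z v) (hzy : (z.1, z.2, v z) ∈ Metric.ball y₀ δ)
    (hzp : dx v z ∈ Metric.ball p₀ r)
    (hrel : ∀ᶠ y in 𝓝 z, (dx v y i)⁻¹ = θ (y.1, y.2, v y)) :
    IsClassGerm lam i j (Metric.ball y₀.2.2 δ) ρ (jet v z) v := by
  obtain ⟨W, hzW, hvW⟩ := hv
  obtain ⟨U₁, w, hzU₁, hU₁, hw₁, hh⟩ := exists_hodograph hyp semi hvW hzW (h.ne_zero _ hzp)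
  have hzB : v z ∈ Metric.ball y₀.2.2 δ := by
    simp only [Metric.mem_ball, Prod.dist_eq, max_lt_iff] at hzy ⊢
    exact hzy.2.2
  have hw := hw₁.mono (hw₁.isOpen.inter (Metric.isOpen_ball (x := y₀.2.2) (ε := δ)))
    inter_subset_left
  have hdef := (h.compat.relation_iff hyp hij hlam Metric.isOpen_ball h.theta inter_subset_right hw
    hvW hzW hh ⟨hzU₁, hzB⟩ hzy (h.ne_zero _ hzp i)).1 hrel
  have hm : ∀ᶠ u in 𝓝 (v z), u ∈ U₁ ∩ Metric.ball y₀.2.2 δ := hw.isOpen.mem_nhds ⟨hzU₁, hzB⟩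
  obtain ⟨U', hU', hU'o, hzU'⟩ := eventually_nhds_iff.1 (hdef.and hm)
  refine ⟨U', w, hzU', fun u hu => (hU' u hu).2.2, ⟨hw.mono hU'o fun u hu => (hU' u hu).2,
    fun u hu => (hU' u hu).1⟩, hh, rfl, ?_⟩
  have hvd : ∀ᶠ y in 𝓝 z, DifferentiableAt ℝ v y := by
    filter_upwards [hvW.isOpen.mem_nhds hzW] with y hy using hvW.differentiableAt hy
  exact (hh.eventually_dx_mul hyp hU₁ hw₁ hvd hzU₁).self_of_nhds

theorem IsSolutionNear.continuousAt_jet {z : ℝ × ℝ} {v : ℝ × ℝ → Fin n → ℝ}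
    (hv : IsSolutionNear lam U z v) : ContinuousAt (jet v) z := by
  obtain ⟨W, hzW, hvW⟩ := hv
  exact (smooth_differentiableAt hvW.isOpen hvW.smooth_jet hzW).continuousAt

/-- The orbit of a solution that satisfies the relation `J = φ(uⁱ)`. -/
theorem IsOrbitChart.mem_orbit_iff (hyp : IsStrictlyHyperbolic lam U)
    (semi : IsSemihamiltonian lam U) {i j : Fin n} (hij : j ≠ i)
    (hlam : ∀ u ∈ U, pd j (lam i) u ≠ 0) {Ω : Set (Jet n)} {J : Jet n → ℝ}
    (hJ : IsExtraRiemannInvariantOfOrderOne lam U i Ω J) {y₀ : ℝ × ℝ × (Fin n → ℝ)}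
    {p₀ : Fin n → ℝ} {δ r : ℝ} {θ : ℝ × ℝ × (Fin n → ℝ) → ℝ} {ρ : (Fin n → ℝ) → ℝ}
    (h : IsOrbitChart lam U i j Ω y₀ p₀ δ r θ ρ) {φ : ℝ → ℝ} {N : Set (Jet n)} (hN : IsOpen N)
    (hNb : ∀ q ∈ N, baseJet q ∈ Metric.ball y₀ δ ∧ q.2.2.2 ∈ Metric.ball p₀ r ∧
      (J q = φ (q.2.2.1 i) ↔ (q.2.2.2 i)⁻¹ = θ (baseJet q)))
    {W : Set (ℝ × ℝ)} {u : ℝ × ℝ → Fin n → ℝ} (hu : IsSolution lam U W u)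
    (huN : ∀ y ∈ W, jet u y ∈ N) (hurel : ∀ y ∈ W, J (jet u y) = φ (u y i))
    {z : ℝ × ℝ} {v : ℝ × ℝ → Fin n → ℝ} (hv : IsSolutionNear lam U z v) (hvN : jet v z ∈ N)
    (hex : ∃ y ∈ W, (u y i, y.2) = (v z i, z.2)) :
    (z, v) ∈ orbit lam U i j Ω W u ↔ ∀ᶠ y in 𝓝 z, J (jet v y) = φ (v y i) := by
  have hurel' : ∀ y ∈ W, ∀ᶠ y' in 𝓝 y, J (jet u y') = φ (u y' i) := fun y hy => by
    filter_upwards [hu.isOpen.mem_nhds hy] with y' hy' using hurel y' hy'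
  have hgerm : ∀ {z : ℝ × ℝ} {v : ℝ × ℝ → Fin n → ℝ}, IsSolutionNear lam U z v → jet v z ∈ N →
      (∀ᶠ y in 𝓝 z, J (jet v y) = φ (v y i)) →
      IsClassGerm lam i j (Metric.ball y₀.2.2 δ) ρ (jet v z) v := by
    intro z v hv hvN hrel
    refine h.isClassGerm hyp semi hij hlam hv (hNb _ hvN).1 (hNb _ hvN).2.1 ?_
    filter_upwards [hrel, hv.continuousAt_jet.preimage_mem_nhds (hN.mem_nhds hvN)] with y h1 h2
    exact (hNb _ h2).2.2.1 h1
  constructor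
  · rintro ⟨y, hy, hyz⟩
    exact relation_of_reflTransGen hyp hij hlam hJ hyz
      (h.ne_zero _ (hNb _ (huN y hy)).2.1 i) (hurel' y hy)
  · intro hrel
    -- The germ of `u` to start from must have the same u^i and t at its base point, as no flow
    -- changes them.
    obtain ⟨⟨x, t⟩, hy, hyz⟩ := hex
    obtain ⟨x', t'⟩ := z
    obtain ⟨h1, h2⟩ := Prod.mk.inj hyz
    simp only at h2
    subst h2
    have hb := hNb _ (huN _ hy)
    have hb' := hNb _ hvN
    exact ⟨(x, t), hy, h.connected hyp semi hij hlam hb.1 hb'.1 h1.symm hb.2.1 hb'.2.1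
      (hgerm ⟨W, hy, hu⟩ (huN _ hy) (hurel' _ hy)) (hgerm hv hvN hrel)⟩

/-- A neighbourhood whose image under `(uⁱ, t)` is open. -/
theorem IsSolution.exists_image_isOpen {W : Set (ℝ × ℝ)} {v : ℝ × ℝ → Fin n → ℝ}
    (hv : IsSolution lam U W v) {i : Fin n} {z : ℝ × ℝ} (hz : z ∈ W) (hne : dx v z i ≠ 0)
    {P : ℝ × ℝ → Prop} (hP : ∀ᶠ y in 𝓝 z, P y) :
    ∃ W₁ : Set (ℝ × ℝ), IsOpen W₁ ∧ z ∈ W₁ ∧ W₁ ⊆ W ∧ (∀ y ∈ W₁, P y) ∧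
      IsOpen ((fun y : ℝ × ℝ => (v y i, y.2)) '' W₁) := by
  have hm : ∀ᶠ y in 𝓝 z, y ∈ W := hv.isOpen.mem_nhds hz
  obtain ⟨O, hOP, hO, hzO⟩ := eventually_nhds_iff.1 (hP.and hm)
  obtain ⟨e, hze, heO, he, -⟩ := hv.exists_chart hO (fun y hy => (hOP y hy).2) hzO hne
  refine ⟨e.source, e.open_source, hze, fun y hy => (hOP y (heO hy)).2,
    fun y hy => (hOP y (heO hy)).1, ?_⟩
  have : (fun y : ℝ × ℝ => (v y i, y.2)) = e := funext fun y => (he y).symm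
  rw [this, e.image_source_eq_target]
  exact e.open_target

end Hydro

end

/-! ### Choice of the neighbourhoods and proof of the theorem -/

theorem theorem8 {n : ℕ} (lam : Fin n → (Fin n → ℝ) → ℝ) (U : Set (Fin n → ℝ))
    (hyp : Hydro.IsStrictlyHyperbolic lam U) (semi : Hydro.IsSemihamiltonian lam U)
    (i j : Fin n) (hij : j ≠ i) (hlam : ∀ u ∈ U, Hydro.pd j (lam i) u ≠ 0)
    (Ω : Set (Hydro.Jet n)) (J : Hydro.Jet n → ℝ)
    (hJ : Hydro.IsExtraRiemannInvariantOfOrderOne lam U i Ω J)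
    (W : Set (ℝ × ℝ)) (u : ℝ × ℝ → Fin n → ℝ) (hu : Hydro.IsSolution lam U W u)
    (z₀ : ℝ × ℝ) (hz₀ : z₀ ∈ W) (hΩ : Hydro.jet u z₀ ∈ Ω)
    (generic : ∀ k, Hydro.dx u z₀ k ≠ 0) :
    ∃ (N : Set (Hydro.Jet n)) (W₀ : Set (ℝ × ℝ)) (S : Set ℝ)
      (I : ℝ × ℝ × (Fin n → ℝ) × ℝ → ℝ) (φ : ℝ → ℝ),
      -- the neighbourhoods in which the orbit is described
      IsOpen N ∧ N ⊆ Ω ∧ IsOpen W₀ ∧ z₀ ∈ W₀ ∧ W₀ ⊆ W ∧ (∀ z ∈ W₀, Hydro.jet u z ∈ N) ∧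
      -- the invariant is a function of `x, t, u, uⁱ_x`, and `φ` is a smooth function of `uⁱ`
      (∀ q ∈ N, J q = I (q.1, q.2.1, q.2.2.1, q.2.2.2 i)) ∧
      IsOpen S ∧ ContDiffOn ℝ ∞ φ S ∧ (∀ q ∈ N, q.2.2.1 i ∈ S) ∧
      -- the orbit is described by the relation `I(x, t, u, uⁱ_x) = φ(uⁱ)`
      (∀ z ∈ W₀, Hydro.SatisfiesRelationNear i I φ z u) ∧
      (∀ (z : ℝ × ℝ) (v : ℝ × ℝ → Fin n → ℝ), Hydro.IsSolutionNear lam U z v →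
        Hydro.jet v z ∈ N →
        ((z, v) ∈ Hydro.orbit lam U i j Ω W₀ u ↔ Hydro.SatisfiesRelationNear i I φ z v)) ∧
      -- the orbit is fixed by `φ`: every solution that satisfies the relation with the same
      -- `φ` has the same orbit
      (∀ (W' : Set (ℝ × ℝ)) (u' : ℝ × ℝ → Fin n → ℝ) (z' : ℝ × ℝ),
        Hydro.IsSolution lam U W' u' → z' ∈ W' → Hydro.jet u' z' ∈ N →
        Hydro.SatisfiesRelationNear i I φ z' u' →
        ∃ (N' : Set (Hydro.Jet n)) (W₁ : Set (ℝ × ℝ)),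
          IsOpen N' ∧ Hydro.jet u' z' ∈ N' ∧ IsOpen W₁ ∧ z' ∈ W₁ ∧ W₁ ⊆ W' ∧
          ∀ (z : ℝ × ℝ) (v : ℝ × ℝ → Fin n → ℝ), Hydro.IsSolutionNear lam U z v →
            Hydro.jet v z ∈ N' →
            ((z, v) ∈ Hydro.orbit lam U i j Ω W₀ u ↔
              (z, v) ∈ Hydro.orbit lam U i j Ω W₁ u')) := by
  obtain ⟨φ, S, hS, h0S, hφ, hφu⟩ := hJ.1.exists_relation hyp hu hz₀ hΩ (generic i)
  obtain ⟨θ, A, h0A, hθ, hθ0, hiff, -⟩ :=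
    Hydro.exists_theta hyp hij hlam hJ hΩ (generic i) hS hφ h0S hφu.self_of_nhds
  set q₀ := Hydro.jet u z₀ with hq₀
  set y₀ := Hydro.baseJet q₀ with hy₀
  set p₀ : Fin n → ℝ := q₀.2.2.2 with hp₀
  -- the size of the neighbourhood
  have hev : ∀ᶠ q in 𝓝 q₀, (J q = φ (q.2.2.1 i) ↔ (q.2.2.2 i)⁻¹ = θ (Hydro.baseJet q)) ∧ q ∈ Ω ∧
      q.2.2.1 i ∈ S ∧ ∀ k, q.2.2.2 k ≠ 0 := by
    have c1 : Continuous fun q : Hydro.Jet n => q.2.2.1 i := by fun_prop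
    have c2 : ∀ k, Continuous fun q : Hydro.Jet n => q.2.2.2 k := fun k => by fun_prop
    have hmΩ : ∀ᶠ q in 𝓝 q₀, q ∈ Ω := hJ.1.isOpen.mem_nhds hΩ
    have hmS : ∀ᶠ q : Hydro.Jet n in 𝓝 q₀, q.2.2.1 i ∈ S :=
      c1.continuousAt.preimage_mem_nhds (hS.mem_nhds h0S)
    exact hiff.and (hmΩ.and (hmS.and (eventually_all.2 fun k =>
      (c2 k).continuousAt.eventually_ne (generic k))))
  obtain ⟨r, hr, hrb⟩ := Metric.eventually_nhds_iff_ball.1 hev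
  have hθd := Hydro.smooth_differentiableAt hθ.isOpen hθ.smooth h0A
  have hevy : ∀ᶠ y in 𝓝 y₀, y ∈ A ∧ (θ y)⁻¹ ∈ Metric.ball (p₀ i) r := by
    have hmA : ∀ᶠ y in 𝓝 y₀, y ∈ A := hθ.isOpen.mem_nhds h0A
    refine hmA.and ((hθd.continuousAt.inv₀ (hθ.ne_zero _ h0A)).preimage_mem_nhds
      (Metric.isOpen_ball.mem_nhds ?_))
    rw [Pi.inv_apply, hθ0, inv_inv]
    exact Metric.mem_ball_self hr
  obtain ⟨δ', hδ', hδb⟩ := Metric.eventually_nhds_iff_ball.1 hevy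
  -- With δ ≤ r the product of the two balls lies in the ball around `q₀` where `hev` holds, the
  -- norm being the supremum norm.
  set δ := min δ' r with hδdef
  have hδ : 0 < δ := lt_min hδ' hr
  have hbA : Metric.ball y₀ δ ⊆ A := fun y hy =>
    (hδb y (Metric.ball_subset_ball (min_le_left _ _) hy)).1
  have hbq : ∀ y ∈ Metric.ball y₀ δ, ∀ p ∈ Metric.ball p₀ r, Hydro.mkJet y p ∈ Metric.ball q₀ r := by
    intro y hy p hp
    have hy' := Metric.ball_subset_ball (min_le_right δ' r) hy
    simp only [Metric.mem_ball, Prod.dist_eq, Hydro.mkJet, max_lt_iff, hy₀, Hydro.baseJet, hp₀] at hy' hp ⊢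
    tauto
  obtain ⟨ρ, hρ, hθρ⟩ := (⟨Metric.isOpen_ball, hθ.smooth.mono hbA, fun y hy => hθ.base y (hbA hy),
    fun y hy => hθ.ne_zero y (hbA hy), fun y hy => hθ.dx y (hbA hy), fun y hy => hθ.dt y (hbA hy),
    fun y hy => hθ.du y (hbA hy)⟩ : Hydro.IsTheta lam U i j (Metric.ball y₀ δ) θ).exists_isCompatible
      hyp hij hlam hδ
  have hy₀b : y₀ ∈ Metric.ball y₀ δ := Metric.mem_ball_self hδ
  have hp₀b : p₀ ∈ Metric.ball p₀ r := Metric.mem_ball_self hr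
  have chart : Hydro.IsOrbitChart lam U i j Ω y₀ p₀ δ r θ ρ :=
    ⟨hJ.1.isOpen, hr, hρ, hθρ, fun y hy =>
      (hδb y (Metric.ball_subset_ball (min_le_left _ _) hy)).2,
      fun p hp => (hrb _ (hbq y₀ hy₀b p hp)).2.2.2, fun y hy p hp => (hrb _ (hbq y hy p hp)).2.1⟩
  set N₀ : Set (Hydro.Jet n) := {q | Hydro.baseJet q ∈ Metric.ball y₀ δ ∧ q.2.2.2 ∈ Metric.ball p₀ r} with hN₀
  have hN₀o : IsOpen N₀ :=
    (Metric.isOpen_ball.preimage (by unfold Hydro.baseJet; fun_prop)).inter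
      (Metric.isOpen_ball.preimage (by fun_prop))
  have hN₀q : ∀ q ∈ N₀, q ∈ Metric.ball q₀ r := fun q hq => hbq _ hq.1 _ hq.2
  have hN₀b : ∀ q ∈ N₀, Hydro.baseJet q ∈ Metric.ball y₀ δ ∧ q.2.2.2 ∈ Metric.ball p₀ r ∧
      (J q = φ (q.2.2.1 i) ↔ (q.2.2.2 i)⁻¹ = θ (Hydro.baseJet q)) := fun q hq =>
    ⟨hq.1, hq.2, (hrb _ (hN₀q q hq)).1⟩
  have hnear : ∀ {z : ℝ × ℝ} {v : ℝ × ℝ → Fin n → ℝ}, Hydro.IsSolutionNear lam U z v → Hydro.jet v z ∈ N₀ →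
      ∀ᶠ y in 𝓝 z, Hydro.jet v y ∈ N₀ := fun hv hvN =>
    hv.continuousAt_jet.preimage_mem_nhds (hN₀o.mem_nhds hvN)
  -- the invariant as a function of `x, t, u, uⁱ_x`
  let I : ℝ × ℝ × (Fin n → ℝ) × ℝ → ℝ := fun y =>
    J (y.1, y.2.1, y.2.2.1, Function.update p₀ i y.2.2.2)
  have hI : ∀ q ∈ N₀, J q = I (q.1, q.2.1, q.2.2.1, q.2.2.2 i) := by
    intro q hq
    -- The frozen derivatives in `I` are those of `q₀`. The altered jet stays in the convex ball,
    -- where the invariant does not depend on them.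
    have h1 : Function.update p₀ i (q.2.2.2 i) ∈ Metric.ball p₀ r := by
      rw [Hydro.mem_ball_pi_iff hr]
      intro k
      by_cases hk : k = i
      · subst hk; rw [Function.update_self]; exact (Hydro.mem_ball_pi_iff hr).1 hq.2 k
      · rw [Function.update_of_ne hk]; exact Metric.mem_ball_self hr
    exact hJ.1.eq_of_mem_convex (convex_ball q₀ r) (fun q hq => (hrb q hq).2.1)
      (hbq _ hq.1 _ h1) (hN₀q q hq) rfl rfl rfl (Function.update_self ..)
  have hrel : ∀ {z : ℝ × ℝ} {v : ℝ × ℝ → Fin n → ℝ}, Hydro.IsSolutionNear lam U z v → Hydro.jet v z ∈ N₀ →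
      (Hydro.SatisfiesRelationNear i I φ z v ↔ ∀ᶠ y in 𝓝 z, J (Hydro.jet v y) = φ (v y i)) := by
    intro z v hv hvN
    refine eventually_congr ?_
    filter_upwards [hnear hv hvN] with y hy
    rw [hI _ hy]; rfl
  have hq₀N : q₀ ∈ N₀ := ⟨hy₀b, hp₀b⟩
  -- `W₀` is taken with an open image under (u^i, t), so that the set of jets cut by this image is
  -- open.
  obtain ⟨W₀, hW₀, hz₀W₀, hW₀W, hW₀P, hO⟩ := hu.exists_image_isOpen hz₀ (generic i)
    ((hnear ⟨W, hz₀, hu⟩ hq₀N).and hφu)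
  have huW₀ : Hydro.IsSolution lam U W₀ u := ⟨hW₀, hu.mapsTo.mono_left hW₀W, hu.smooth.mono hW₀W,
    fun z hz => hu.eqn z (hW₀W hz)⟩
  have hpc : Continuous fun q : Hydro.Jet n => (q.2.2.1 i, q.2.1) := by fun_prop
  -- Jets whose (u^i, t) is not attained by `u` on `W₀` are excluded: such germs may satisfy the
  -- relation but cannot be reached.
  refine ⟨N₀ ∩ (fun q : Hydro.Jet n => (q.2.2.1 i, q.2.1)) ⁻¹' ((fun y : ℝ × ℝ => (u y i, y.2)) '' W₀),
    W₀, S, I, φ, hN₀o.inter (hO.preimage hpc), fun q hq => (hrb _ (hN₀q q hq.1)).2.1, hW₀, hz₀W₀,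
    hW₀W, fun z hz => ⟨(hW₀P z hz).1, z, hz, rfl⟩, fun q hq => hI q hq.1, hS, hφ,
    fun q hq => (hrb _ (hN₀q q hq.1)).2.2.1, fun z hz => ?_, fun z v hv hvN => ?_,
    fun W' u' z' hu' hz' huN' hrel' => ?_⟩
  · rw [hrel ⟨W₀, hz, huW₀⟩ (hW₀P z hz).1]
    filter_upwards [hW₀.mem_nhds hz] with y hy using (hW₀P y hy).2
  · rw [hrel hv hvN.1]
    exact chart.mem_orbit_iff hyp semi hij hlam hJ hN₀o hN₀b huW₀ (fun y hy => (hW₀P y hy).1)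
      (fun y hy => (hW₀P y hy).2) hv hvN.1 hvN.2
  · have hu'n : Hydro.IsSolutionNear lam U z' u' := ⟨W', hz', hu'⟩
    obtain ⟨W₁, hW₁, hz'W₁, hW₁W, hW₁P, hO₁⟩ := hu'.exists_image_isOpen hz'
      (chart.ne_zero _ (hN₀b _ huN'.1).2.1 i)
      ((hnear hu'n huN'.1).and ((hrel hu'n huN'.1).1 hrel'))
    have huW₁ : Hydro.IsSolution lam U W₁ u' := ⟨hW₁, hu'.mapsTo.mono_left hW₁W, hu'.smooth.mono hW₁W,
      fun z hz => hu'.eqn z (hW₁W hz)⟩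
    -- The smaller neighbourhood also requires (u^i, t) to be attained by u' on `W₁`. In it both
    -- orbits are described by the same relation.
    refine ⟨(N₀ ∩ (fun q : Hydro.Jet n => (q.2.2.1 i, q.2.1)) ⁻¹'
      ((fun y : ℝ × ℝ => (u y i, y.2)) '' W₀)) ∩ (fun q : Hydro.Jet n => (q.2.2.1 i, q.2.1)) ⁻¹'
        ((fun y : ℝ × ℝ => (u' y i, y.2)) '' W₁), W₁, (hN₀o.inter (hO.preimage hpc)).inter
          (hO₁.preimage hpc), ⟨huN', z', hz'W₁, rfl⟩, hW₁, hz'W₁, hW₁W, fun z v hv hvN => ?_⟩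
    rw [chart.mem_orbit_iff hyp semi hij hlam hJ hN₀o hN₀b huW₀ (fun y hy => (hW₀P y hy).1)
        (fun y hy => (hW₀P y hy).2) hv hvN.1.1 hvN.1.2,
      chart.mem_orbit_iff hyp semi hij hlam hJ hN₀o hN₀b huW₁ (fun y hy => (hW₁P y hy).1)
        (fun y hy => (hW₁P y hy).2) hv hvN.1.1 hvN.2]
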